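/- **Setting.** Let $\Omega\subseteq\mathbb R^n$ be open, $0\in\Omega$, and let $f\in C^4(\Omega;\mathbb R^n)$ be such that $\partial_t u+\partial_x f(u)=0$ is strictly hyperbolic, with eigenvalues $\lambda_1(u)<\dots<\lambda_n(u)$ of $Df(u)$, each characteristic field being either genuinely nonlinear or linearly degenerate. The right eigenvectors $r_j$ (continuous near $0$) are normalized by $\nabla\lambda_j\cdot r_j=k_j$ with fixed $k_j>0$ if the $j$-th field is genuinely nonlinear and by $|r_j|=1$ if it is linearly degenerate. Let $R_j(\sigma)(u)$ be the integral curve of $r_j$ through $u$, and $S_j(\sigma)(u)$ the $j$-th Rankine–Hugoniot curve through $u$, tangent to $r_j(u)$ and parametrized by $\lambda_j(S_j(\sigma)(u))=\lambda_j(u)+k_j\sigma$ (genuinely nonlinear case) or by arc length (linearly degenerate case). Put $\psi_j(\sigma)=R_j(\sigma)$ for $\sigma\ge0$, $\psi_j(\sigma)=S_j(\sigma)$ for $\sigma<0$. All states are near $0$ and all wave sizes in absolute value less than a small $\rho>0$. Then $E(u^-,u^+)=(\sigma_1,\dots,\sigma_n)$ is defined by $u^+=\psi_n(\sigma_n)\circ\dots\circ\psi_1(\sigma_1)(u^-)$.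 Fix constants $C_0,\kappa_1,\kappa_2>0$ and a speed $\hat\lambda$ greater than all $\lambda_j(u)$ for $u$ near $0$. **The functional $\mathbf\Phi$.** For a right continuous piecewise constant $v$ with finitely many jumps let $(\sigma_{x,1},\dots,\sigma_{x,n})=E(v(x-),v(x+))$ at each jump $x$ and $$\mathbf V(v)=\sum_{x,i}|\sigma_{x,i}|,\qquad \mathbf Q(v)=\sum|\sigma_{x,i}\sigma_{y,j}|,\qquad \mathbf\Upsilon=\mathbf V+C_0\mathbf Q,$$ the sum in $\mathbf Q$ being over the pairs of jumps $x<y$ and indices with either $i>j$, or $i=j$, the $i$-th field genuinely nonlinear and $\min\{\sigma_{x,i},\sigma_{y,j}\}<0$. Let $\mathcal D^*_\delta$ be the set of integrable, $\Omega$-valued such $v$, all of whose jumps are solved by waves of size less than $\rho$, with $\mathbf\Upsilon(v)<\delta$. Put $A_j^-[v](x)=\sum_{y\le x}|\sigma_{y,j}|$, $A_j^+[v](x)=\sum_{y>x}|\sigma_{y,j}|$ and $$\mathbf A_i[v](q,x)=\sum_{j<i}A_j^+[v](x)+\sum_{j>i}A_j^-[v](x)+a,$$ where $a=0$ if the $i$-th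 field is linearly degenerate, and otherwise $a=A_i^+[v](x)$ for $q\ge0$ and $a=A_i^-[v](x)$ for $q<0$. With $q(x)$ defined by $\tilde v(x)=S_n(q_n(x))\circ\dots\circ S_1(q_1(x))(v(x))$, put $$\mathbf\Phi(v,\tilde v)=\sum_{i=1}^n\int_{\mathbb R}|q_i(x)|\Big(1+\kappa_1\mathbf A_i[v](q_i(x),x)+\kappa_1\mathbf A_i[\tilde v](-q_i(x),x)+\kappa_1\kappa_2\big(\mathbf Q(v)+\mathbf Q(\tilde v)\big)\Big)dx .$$ **Front tracking.** An $\varepsilon$-approximate front tracking solution is a map $w\colon[0,\infty)\times\mathbb R\to\Omega$, continuous from $[0,\infty)$ to $L^1_{loc}$, with right continuous $w(t,\cdot)$, that is piecewise constant with jumps along finitely many segments or half-lines (fronts) $x=x_\alpha(t)$ in the $t$-$x$ plane, which meet at end points only; every front that starts or ends at a time $t>0$ does so in an interaction, and each interaction has exactly two incoming fronts. Each front, with left and right states $u^-\ne u^+$, is of one of these types: * shock or contact discontinuity of a family $k$: $u^+=S_k(\sigma)(u^-)$, with $\sigma<0$ if the $k$-th field is genuinely nonlinear, and $|\dot x_\alpha-s|\le\varepsilon$,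 where $s$ is the Rankine–Hugoniot speed of the jump; * rarefaction of a genuinely nonlinear family $k$: $u^+=R_k(\sigma)(u^-)$ with $0<\sigma\le\varepsilon$ and $|\dot x_\alpha-\lambda_k(u^+)|\le\varepsilon$; * non-physical: $\dot x_\alpha=\hat\lambda$; such a front has size $|u^+-u^-|$ and family number $n+1$, and at each time the total size of the non-physical fronts is at most $\varepsilon$. The fronts present at time $t$ are those with starting time $\le t<$ end time. At time $t$, $Q(w)$ is the sum of $|\sigma_\alpha\sigma_\beta|$ over the pairs of fronts present, at positions $x_\alpha<x_\beta$, with $k_\alpha>k_\beta$, or with $k_\alpha=k_\beta\le n$, this field genuinely nonlinear and $\sigma_\alpha<0$ or $\sigma_\beta<0$. For two such solutions $w,\tilde w$, with $q(x)$ as above for $v=w(t,\cdot)$, $\tilde v=\tilde w(t,\cdot)$, let $$\Phi^\varepsilon(w,\tilde w)(t)=\sum_{i=1}^n\int_{\mathbb R}|q_i(x)|\Big(1+\kappa_1A_i(x)+\kappa_1\kappa_2\big(Q(w)+Q(\tilde w)\big)\Big)dx,$$ where $A_i(x)$ is the sum of $|\sigma_\alpha|$ over the physical fronts of $w$ and $\tilde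 w$ present at time $t$ with $x_\alpha<x$, $k_\alpha>i$ or with $x_\alpha>x$, $k_\alpha<i$, and, if the $i$-th field is genuinely nonlinear, also over the physical fronts of family $i$ that lie: if $q_i(x)<0$, to the left of $x$ in $w$ or to the right of $x$ in $\tilde w$; if $q_i(x)>0$, to the right of $x$ in $w$ or to the left of $x$ in $\tilde w$. Call $t\ge0$ *regular* for $w$ if any fronts present at time $t$ that issue from one and the same point are ordered as in a Riemann fan: from left to right their families increase, except that one family may have several rarefaction fronts. In particular, $t$ is regular if the fronts present at time $t$ are at distinct points. **Proposition.** For every sufficiently small $\rho>0$ there are $\delta_0>0$ and $C>0$ such that for every $\delta\in(0,\delta_0)$ and for all sufficiently small $\varepsilon>0$ (how small depending on $\delta$, but not on the solutions) the following holds. If $w,\tilde w$ are $\varepsilon$-approximate front tracking solutions with $w(t,\cdot),\tilde w(t,\cdot)\in\mathcal D^*_\delta$ for all $t\ge0$, then for every $t\ge0$ that is regular for both $w$ and $\tilde w$ $$\big|\mathbf\Phi(w(t,\cdot),\tilde w(t,\cdot))-\Phi^\varepsilon(w,\tilde w)(t)\big|\le C\,\varepsilon\,\|w(t,\cdot)-\tilde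 w(t,\cdot)\|_{L^1}.$$ -/

import Mathlib

open Set Filter Topology MeasureTheory

noncomputable section

/-- The state space `ℝⁿ` with its Euclidean norm. -/
abbrev State (n : ℕ) : Type := EuclideanSpace ℝ (Fin n)

/-- A strictly hyperbolic system `∂ₜ u + ∂ₓ f(u) = 0`, with `f` of class `C⁴` on the open set
`Ω ∋ 0`, each characteristic field being genuinely nonlinear or linearly degenerate, together with
its ordered eigenvalues `lam j` and its normalized right eigenvectors `r j`.
A continuous normalized choice of eigenvectors always exists near `0`. -/
structure HyperbolicSystem (n : ℕ) where
  f : State n → State n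
  Ω : Set (State n)
  isOpen_Ω : IsOpen Ω
  zero_mem : (0 : State n) ∈ Ω
  contDiffOn_f : ContDiffOn ℝ 4 f Ω
  lam : Fin n → State n → ℝ
  r : Fin n → State n → State n
  /-- the normalization constants `k_j` -/
  k : Fin n → ℝ
  k_pos : ∀ j, 0 < k j
  eigen : ∀ u ∈ Ω, ∀ j, fderiv ℝ f u (r j u) = lam j u • r j u
  lam_strictMono : ∀ u ∈ Ω, StrictMono fun j => lam j u
  /-- Each field is either genuinely nonlinear, and then `∇λ_j · r_j = k_j`, or linearly
  degenerate, and then `r_j` is a unit vector. -/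
  field_type : ∀ j,
    (∀ u ∈ Ω, fderiv ℝ (lam j) u (r j u) = k j) ∨
    (∀ u ∈ Ω, fderiv ℝ (lam j) u (r j u) = 0 ∧ ‖r j u‖ = 1)
  continuous_r : ∀ j, ∀ᶠ u in 𝓝 (0 : State n), ContinuousAt (r j) u

namespace HyperbolicSystem

variable {n : ℕ} (S : HyperbolicSystem n)

/-- The `j`-th characteristic field is genuinely nonlinear. -/
def GNL (j : Fin n) : Prop := ∀ u ∈ S.Ω, fderiv ℝ (S.lam j) u (S.r j u) ≠ 0

/-- `γ` is, on the parameter interval `[-ρ, ρ]`, the integral curve of `r_j` through `u`. -/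
def IsRarefactionCurve (ρ : ℝ) (j : Fin n) (u : State n) (γ : ℝ → State n) : Prop :=
  γ 0 = u ∧ ∀ σ ∈ Icc (-ρ) ρ, γ σ ∈ S.Ω ∧ HasDerivWithinAt γ (S.r j (γ σ)) (Icc (-ρ) ρ) σ

/-- `γ` is, on the parameter interval `[-ρ, ρ]`, the `j`-th shock (Rankine--Hugoniot) curve
through `u`: a `C¹` curve, tangent to `r_j(u)` at `u`, of states that are connected to `u` by a
discontinuity of speed `s σ`, where `s` is continuous and `s 0 = λ_j(u)`. The parameter satisfies
`λ_j(γ σ) = λ_j(u) + k_j σ` for a genuinely nonlinear field, and is the arc length otherwise. -/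
def IsShockCurve (ρ : ℝ) (j : Fin n) (u : State n) (γ : ℝ → State n) : Prop :=
  γ 0 = u ∧ ContDiffOn ℝ 1 γ (Icc (-ρ) ρ) ∧ HasDerivAt γ (S.r j u) 0 ∧
  (∀ σ ∈ Icc (-ρ) ρ, γ σ ∈ S.Ω) ∧
  (∃ s : ℝ → ℝ, ContinuousOn s (Icc (-ρ) ρ) ∧ s 0 = S.lam j u ∧
    ∀ σ ∈ Icc (-ρ) ρ, S.f (γ σ) - S.f u = s σ • (γ σ - u)) ∧
  (S.GNL j → ∀ σ ∈ Icc (-ρ) ρ, S.lam j (γ σ) = S.lam j u + S.k j * σ) ∧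
  (¬ S.GNL j → ∀ σ ∈ Icc (-ρ) ρ, ‖derivWithin γ (Icc (-ρ) ρ) σ‖ = 1)

open Classical in
/-- `R_j(σ)(u)`, for `|σ| ≤ ρ` and `u` near `0` (for small `ρ` the curve exists and is unique). -/
def rarefaction (ρ : ℝ) (j : Fin n) (σ : ℝ) (u : State n) : State n :=
  if h : ∃ γ, S.IsRarefactionCurve ρ j u γ then h.choose σ else u

open Classical in
/-- `S_j(σ)(u)`, for `|σ| ≤ ρ` and `u` near `0` (for small `ρ` the curve exists and is unique). -/
def shock (ρ : ℝ) (j : Fin n) (σ : ℝ) (u : State n) : State n :=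
  if h : ∃ γ, S.IsShockCurve ρ j u γ then h.choose σ else u

/-- The Lax curve `ψ_j(σ)(u)`. -/
def lax (ρ : ℝ) (j : Fin n) (σ : ℝ) (u : State n) : State n :=
  if 0 ≤ σ then S.rarefaction ρ j σ u else S.shock ρ j σ u

/-- `Ψ(σ)(u) = ψ_n(σ_n) ∘ ⋯ ∘ ψ_1(σ_1) (u)`. -/
def laxMap (ρ : ℝ) (u : State n) (σ : Fin n → ℝ) : State n :=
  (List.finRange n).foldl (fun v j => S.lax ρ j (σ j) v) u

/-- `𝐒(q)(u) = S_n(q_n) ∘ ⋯ ∘ S_1(q_1) (u)`. -/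
def shockMap (ρ : ℝ) (u : State n) (q : Fin n → ℝ) : State n :=
  (List.finRange n).foldl (fun v j => S.shock ρ j (q j) v) u

/-- The admitted wave sizes. -/
def sizeBox (n : ℕ) (ρ : ℝ) : Set (Fin n → ℝ) := {σ | ∀ i, |σ i| < ρ}

/-- `E(u⁻, u⁺)`: the sizes of the waves in the solution of the Riemann problem `(u⁻, u⁺)`. -/
def riemannSizes (ρ : ℝ) (um up : State n) : Fin n → ℝ :=
  Function.invFunOn (S.laxMap ρ um) (sizeBox n ρ) up

/-- The `q` with `u⁺ = 𝐒(q)(u⁻)`. -/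
def shockSizes (ρ : ℝ) (um up : State n) : Fin n → ℝ :=
  Function.invFunOn (S.shockMap ρ um) (sizeBox n ρ) up

/-! ### Functionals on piecewise constant functions -/

/-- Right continuous, piecewise constant functions with finitely many jumps. -/
def _root_.IsPiecewiseConst {n : ℕ} (v : ℝ → State n) : Prop :=
  ∃ F : Finset ℝ, ∀ x y, x ≤ y → (∀ z ∈ F, ¬ (x < z ∧ z ≤ y)) → v x = v y

/-- The set of points where the right continuous function `v` has a jump. -/
def _root_.jumpSet {n : ℕ} (v : ℝ → State n) : Set ℝ := {x | Function.leftLim v x ≠ v x}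

/-- The strength `σ_{x,i}`, from the Riemann problem with data `v(x-)`, `v(x+)`. -/
def strength (ρ : ℝ) (v : ℝ → State n) (x : ℝ) (i : Fin n) : ℝ :=
  S.riemannSizes ρ (Function.leftLim v x) (v x) i

/-- The set of pairs of approaching waves. -/
def approaching (ρ : ℝ) (v : ℝ → State n) : Set ((ℝ × Fin n) × (ℝ × Fin n)) :=
  {p | p.1.1 ∈ jumpSet v ∧ p.2.1 ∈ jumpSet v ∧ p.1.1 < p.2.1 ∧
    (p.2.2 < p.1.2 ∨ (p.1.2 = p.2.2 ∧ S.GNL p.1.2 ∧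
      min (S.strength ρ v p.1.1 p.1.2) (S.strength ρ v p.2.1 p.2.2) < 0))}

/-- The linear potential `𝐕`. -/
def V (ρ : ℝ) (v : ℝ → State n) : ℝ := ∑ᶠ x ∈ jumpSet v, ∑ i, |S.strength ρ v x i|

/-- The interaction potential `𝐐`. -/
def Q (ρ : ℝ) (v : ℝ → State n) : ℝ :=
  ∑ᶠ p ∈ S.approaching ρ v, |S.strength ρ v p.1.1 p.1.2 * S.strength ρ v p.2.1 p.2.2|

/-- `𝚼 = 𝐕 + C₀ 𝐐`. -/
def Upsilon (ρ C₀ : ℝ) (v : ℝ → State n) : ℝ := S.V ρ v + C₀ * S.Q ρ v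

/-- The set `𝒟*_δ` of the integrable piecewise constant functions with `𝚼 < δ`. It is part of the
definition that the Riemann problem at every jump is solved by small waves, so that the functional
`𝚼` makes sense. -/
def Dstar (ρ C₀ δ : ℝ) : Set (ℝ → State n) :=
  {v | IsPiecewiseConst v ∧ Integrable v ∧ (∀ x, v x ∈ S.Ω) ∧
    (∀ x ∈ jumpSet v, ∃ σ ∈ sizeBox n ρ, S.laxMap ρ (Function.leftLim v x) σ = v x) ∧
    S.Upsilon ρ C₀ v < δ}

/-- `A_j^-[v](x)`. -/
def Aminus (ρ : ℝ) (v : ℝ → State n) (j : Fin n) (x : ℝ) : ℝ :=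
  ∑ᶠ y ∈ jumpSet v ∩ Iic x, |S.strength ρ v y j|

/-- `A_j^+[v](x)`. -/
def Aplus (ρ : ℝ) (v : ℝ → State n) (j : Fin n) (x : ℝ) : ℝ :=
  ∑ᶠ y ∈ jumpSet v ∩ Ioi x, |S.strength ρ v y j|

open Classical in
/-- `𝐀_i[v](q,x)`. -/
def A (ρ : ℝ) (v : ℝ → State n) (i : Fin n) (q x : ℝ) : ℝ :=
  (∑ j ∈ Finset.univ.filter (· < i), S.Aplus ρ v j x) +
  (∑ j ∈ Finset.univ.filter (i < ·), S.Aminus ρ v j x) +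
  (if S.GNL i then (if 0 ≤ q then S.Aplus ρ v i x else S.Aminus ρ v i x) else 0)

/-- The weight `𝐖_i[v,v'](q,x)`. -/
def W (ρ κ₁ κ₂ : ℝ) (v v' : ℝ → State n) (i : Fin n) (q x : ℝ) : ℝ :=
  1 + κ₁ * S.A ρ v i q x + κ₁ * S.A ρ v' i (-q) x + κ₁ * κ₂ * (S.Q ρ v + S.Q ρ v')

/-- The stability functional `𝚽` on pairs of piecewise constant functions. -/
def Phi (ρ κ₁ κ₂ : ℝ) (v v' : ℝ → State n) : ℝ :=
  ∑ i, ∫ x, |S.shockSizes ρ (v x) (v' x) i| *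
    S.W ρ κ₁ κ₂ v v' i (S.shockSizes ρ (v x) (v' x) i) x

end HyperbolicSystem

/-! ### Approximate front tracking solutions -/

/-- The type of a front, with its family and its size. Contact discontinuities count as shocks. -/
inductive FrontKind (n : ℕ) where
  | shock (k : Fin n) (σ : ℝ)
  | rarefaction (k : Fin n) (σ : ℝ)
  | nonphysical

/-- A front: a segment, or half-line, in the `t`-`x` plane separating two constant states. -/
structure Front (n : ℕ) where
  birth : ℝ
  death : EReal
  start : ℝ
  speed : ℝ
  left : State n
  right : State n
  kind : FrontKind n

namespace Front

variable {n : ℕ} (a : Front n)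

/-- The position of the front at time `t`. -/
def pos (t : ℝ) : ℝ := a.start + a.speed * (t - a.birth)

/-- The front is present at time `t`; an interaction time belongs to the outgoing fronts. -/
def Alive (t : ℝ) : Prop := a.birth ≤ t ∧ (t : EReal) < a.death

/-- The signed size of a physical front, the strength `|u⁺ - u⁻|` of a non-physical one. -/
def size : ℝ :=
  match a.kind with
  | .shock _ σ => σ
  | .rarefaction _ σ => σ
  | .nonphysical => ‖a.right - a.left‖

/-- The front is physical and of the family `k`. -/
def IsPhysical (k : Fin n) : Prop :=
  (∃ σ, a.kind = .shock k σ) ∨ (∃ σ, a.kind = .rarefaction k σ)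

/-- The number of the family, starting with `0`; non-physical fronts form the last family `n`. -/
def rank : ℕ :=
  match a.kind with
  | .shock k _ => k
  | .rarefaction k _ => k
  | .nonphysical => n

/-- The conditions on a single front in an `ε`-approximate front tracking solution; `lamHat` is
the speed of the non-physical fronts. -/
def Admissible (S : HyperbolicSystem n) (ρ lamHat ε : ℝ) : Prop :=
  match a.kind with
  | .shock k σ => |σ| < ρ ∧ a.right = S.shock ρ k σ a.left ∧ (S.GNL k → σ < 0) ∧
      ∃ s : ℝ, S.f a.right - S.f a.left = s • (a.right - a.left) ∧ |a.speed - s| ≤ ε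
  | .rarefaction k σ => S.GNL k ∧ 0 < σ ∧ σ ≤ ε ∧ a.right = S.rarefaction ρ k σ a.left ∧
      |a.speed - S.lam k a.right| ≤ ε
  | .nonphysical => a.speed = lamHat

end Front

/-- A function `u(t,x)` together with finitely many fronts. -/
structure FrontPattern (n : ℕ) where
  u : ℝ → ℝ → State n
  N : ℕ
  front : Fin N → Front n

namespace FrontPattern

variable {n : ℕ}

open Classical in
/-- `w` is an `ε`-approximate front tracking solution. -/
structure IsApproxSolution (S : HyperbolicSystem n) (ρ lamHat ε : ℝ) (w : FrontPattern n) :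
    Prop where
  mem_Ω : ∀ t, 0 ≤ t → ∀ x, w.u t x ∈ S.Ω
  /-- continuity in time with values in `L¹_loc` -/
  continuous_L1loc : ∀ t₀, 0 ≤ t₀ → ∀ R : ℝ,
    Tendsto (fun t => ∫ x in (-R)..R, ‖w.u t x - w.u t₀ x‖) (𝓝[Ici 0] t₀) (𝓝 0)
  /-- right continuous representatives -/
  right_continuous : ∀ t, 0 ≤ t → ∀ x, ContinuousWithinAt (w.u t) (Ici x) x
  /-- `u` is locally constant outside the fronts -/
  locally_const : ∀ t, 0 ≤ t → ∀ x,
    (∀ a, (w.front a).birth ≤ t → (t : EReal) ≤ (w.front a).death → (w.front a).pos t ≠ x) →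
    ∀ᶠ p : ℝ × ℝ in 𝓝[{p | 0 ≤ p.1}] (t, x), w.u p.1 p.2 = w.u t x
  birth_nonneg : ∀ a, 0 ≤ (w.front a).birth
  birth_lt_death : ∀ a, ((w.front a).birth : EReal) < (w.front a).death
  left_ne_right : ∀ a, (w.front a).left ≠ (w.front a).right
  /-- the states on the two sides of a front -/
  sides : ∀ a t, (w.front a).birth < t → (t : EReal) < (w.front a).death →
    Function.leftLim (w.u t) ((w.front a).pos t) = (w.front a).left ∧
    w.u t ((w.front a).pos t) = (w.front a).right
  /-- fronts meet at their end points only -/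
  disjoint : ∀ a b, a ≠ b → ∀ t, (w.front a).birth < t → (t : EReal) < (w.front a).death →
    (w.front b).birth ≤ t → (t : EReal) ≤ (w.front b).death →
    (w.front a).pos t ≠ (w.front b).pos t
  /-- each interaction involves exactly two incoming fronts -/
  two_incoming : ∀ t, 0 < t → ∀ x,
    (∃ a, ((w.front a).birth = t ∨ (w.front a).death = (t : EReal)) ∧ (w.front a).pos t = x) →
    {a | (w.front a).death = (t : EReal) ∧ (w.front a).pos t = x}.ncard = 2
  admissible : ∀ a, (w.front a).Admissible S ρ lamHat ε
  /-- the total strength of the non-physical fronts is at most `ε` -/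
  nonphysical_small : ∀ t, 0 ≤ t →
    ∑ a ∈ Finset.univ.filter
      (fun a => (w.front a).Alive t ∧ (w.front a).kind = FrontKind.nonphysical),
      ‖(w.front a).right - (w.front a).left‖ ≤ ε

/-- The fronts present at time `t` at one and the same point (which happens only at time `0` and
at interaction times, when these are the fronts that leave the point) are ordered as in the
solution of a Riemann problem: from left to right, that is, in the order of their speeds,
the families increase, except that one family may have several rarefaction fronts. -/
def FanOrdered (w : FrontPattern n) (t : ℝ) : Prop :=
  ∀ a b, (w.front a).Alive t → (w.front b).Alive t → (w.front a).pos t = (w.front b).pos t →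
    (w.front a).speed < (w.front b).speed →
    (w.front a).rank < (w.front b).rank ∨
    ∃ k σ σ', (w.front a).kind = .rarefaction k σ ∧ (w.front b).kind = .rarefaction k σ'

/-- Two fronts approach each other at time `t`, the first one being on the left. -/
def Approaching (S : HyperbolicSystem n) (w : FrontPattern n) (t : ℝ) (a b : Fin w.N) : Prop :=
  (w.front a).Alive t ∧ (w.front b).Alive t ∧ (w.front a).pos t < (w.front b).pos t ∧
  ((w.front b).rank < (w.front a).rank ∨
    ∃ k, S.GNL k ∧ (w.front a).IsPhysical k ∧ (w.front b).IsPhysical k ∧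
      ((w.front a).size < 0 ∨ (w.front b).size < 0))

open Classical in
/-- The interaction potential of a front tracking solution; non-physical fronts are included. -/
def Q (S : HyperbolicSystem n) (w : FrontPattern n) (t : ℝ) : ℝ :=
  ∑ p ∈ Finset.univ.filter (fun p : Fin w.N × Fin w.N => w.Approaching S t p.1 p.2),
    |(w.front p.1).size * (w.front p.2).size|

open Classical in
/-- The total strength of the physical fronts of family `k` on the left of `x` at time `t`. -/
def leftWaves (w : FrontPattern n) (t : ℝ) (k : Fin n) (x : ℝ) : ℝ :=
  ∑ a ∈ Finset.univ.filter (fun a =>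
    (w.front a).Alive t ∧ (w.front a).IsPhysical k ∧ (w.front a).pos t < x), |(w.front a).size|

open Classical in
/-- The total strength of the physical fronts of family `k` on the right of `x` at time `t`. -/
def rightWaves (w : FrontPattern n) (t : ℝ) (k : Fin n) (x : ℝ) : ℝ :=
  ∑ a ∈ Finset.univ.filter (fun a =>
    (w.front a).Alive t ∧ (w.front a).IsPhysical k ∧ x < (w.front a).pos t), |(w.front a).size|

open Classical in
/-- `A_i(x)` at time `t`: the total strength of the physical fronts in `w` and `w'` that approach
an `i`-wave of size `q` located at `x`. -/
def A (S : HyperbolicSystem n) (w w' : FrontPattern n) (t : ℝ) (i : Fin n) (q x : ℝ) : ℝ :=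
  (∑ k ∈ Finset.univ.filter (i < ·), (w.leftWaves t k x + w'.leftWaves t k x)) +
  (∑ k ∈ Finset.univ.filter (· < i), (w.rightWaves t k x + w'.rightWaves t k x)) +
  (if S.GNL i then
    (if q < 0 then w.leftWaves t i x + w'.rightWaves t i x
     else if 0 < q then w'.leftWaves t i x + w.rightWaves t i x
     else 0)
   else 0)

/-- The stability functional `Φ^ε(w, w')(t)` of two front tracking solutions. -/
def PhiEps (S : HyperbolicSystem n) (ρ κ₁ κ₂ : ℝ) (w w' : FrontPattern n) (t : ℝ) : ℝ :=
  ∑ i, ∫ x, |S.shockSizes ρ (w.u t x) (w'.u t x) i| *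
    (1 + κ₁ * A S w w' t i (S.shockSizes ρ (w.u t x) (w'.u t x) i) x +
      κ₁ * κ₂ * (w.Q S t + w'.Q S t))

end FrontPattern

end

/-! Both functionals integrate the same factors |q_i|, which are at most K |w - w̃|; only the
weights differ. The bold weight reads the wave sizes from the Riemann problems at the jumps of
w(t,·), the weight of Φ^ε reads them from the fronts. So it suffices that the two weights agree up
to O(ε) at almost every x.

The heart is a local statement (`IsApproxSolution.abs_strength_sub_waveSum_le`): at a regular time,
the Riemann size σ_{x,k} differs from the signed sum of the sizes of the k-fronts at x by at most K
times the strength of the non-physical fronts at x. Shortly after t the fronts that leave x are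
separated and ordered as in a fan. If all are physical, crossing them composes wave curves in the
order of the families: rarefactions of one family merge by the flow property, any other front is
alone in its family, and for a linearly degenerate field shock and rarefaction curves coincide.
Hence the right state is exactly the Lax map at the summed sizes (`fan_eq_laxMap`). A non-physical
front has the last family number, so it is the rightmost one, there is only one, and it moves the
right state by its strength (`norm_sub_laxMap_le_defect`). The Lax map has a Lipschitz inverse, and
the errors at all points sum up to K ε.

Fronts of one family that share a point at a regular time are rarefactions, so their sizes add
without cancellation and the merged wave has the sign of each of them (`size_neg_iff`,
`abs_waveSum`). This gives the comparison of the approaching strengths. The interaction potential is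
bilinear in sizes of total at most δ, it is Lipschitz even across its sign condition
(`abs_pairPotential_sub_le`), and the non-physical fronts contribute at most δ ε to it.

All this rests on `exists_riemannConstants`: for small ρ the Lax and shock maps are bi-Lipschitz in
the sizes near 0. Since the wave curves are defined by choice, they first have to be shown to exist
and to be unique: rarefactions come from a local flow, shocks from the implicit function theorem for
a desingularized Rankine–Hugoniot equation, with a continuation argument for uniqueness. Strict
differentiability at the single point 0 is all the regularity that the compositions need. -/

noncomputable section

/-! ### Calculus: parameter integrals and continuous induction -/

section General

variable {X : Type} [NormedAddCommGroup X] [NormedSpace ℝ X] [FiniteDimensional ℝ X]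

/-- An integral over `[0,1]` of a `Cᵏ` function depending on a parameter is of class `Cᵏ`. -/
theorem contDiff_integral_of_contDiff (k : ℕ) :
    ∀ {Y : Type} [NormedAddCommGroup Y] [NormedSpace ℝ Y] [CompleteSpace Y] (G : X → ℝ → Y),
      ContDiff ℝ k (Function.uncurry G) → ContDiff ℝ k fun x => ∫ θ in (0 : ℝ)..1, G x θ := by
  induction k with
  | zero =>
    intro Y _ _ _ G hG
    simp only [Nat.cast_zero, contDiff_zero] at hG ⊢
    exact intervalIntegral.continuous_parametric_intervalIntegral_of_continuous' hG 0 1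
  | succ k ih =>
    intro Y _ _ _ G hG
    have hG1 : ContDiff ℝ (k + 1 : ℕ) (Function.uncurry G) := hG
    rw [Nat.cast_succ] at hG1 ⊢
    rw [contDiff_succ_iff_hasFDerivAt] at hG1
    obtain ⟨G', hG'c, hG'⟩ := hG1
    -- The partial derivative in `x`. It takes values in `X →L[ℝ] Y`, so the induction hypothesis
    -- has to cover all target spaces.
    set D : X → ℝ → X →L[ℝ] Y := fun x θ => (G' (x, θ)).comp (ContinuousLinearMap.inl ℝ X ℝ)
    have hD : ContDiff ℝ k (Function.uncurry D) := by
      have : Function.uncurry D = fun p => (G' p).comp (ContinuousLinearMap.inl ℝ X ℝ) := rfl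
      rw [this]
      exact hG'c.clm_comp contDiff_const
    rw [contDiff_succ_iff_hasFDerivAt]
    refine ⟨fun x => ∫ θ in (0 : ℝ)..1, D x θ, ih D hD, fun x => ?_⟩
    have hDc : Continuous (Function.uncurry D) := hD.continuous
    have hGc : Continuous (Function.uncurry G) := hG.continuous
    obtain ⟨M, hM⟩ := ((isCompact_closedBall x 1).prod (isCompact_Icc (a := (0:ℝ)) (b := 1))).exists_bound_of_continuousOn
      hDc.continuousOn
    refine intervalIntegral.hasFDerivAt_integral_of_dominated_of_fderiv_le
      (bound := fun _ => M) (Metric.closedBall_mem_nhds x one_pos) ?_ ?_ ?_ ?_ ?_ ?_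
    · exact Eventually.of_forall fun y =>
        (hGc.comp (Continuous.prodMk_right y)).aestronglyMeasurable
    · exact (hGc.comp (Continuous.prodMk_right x)).intervalIntegrable 0 1
    · exact (hDc.comp (Continuous.prodMk_right x)).aestronglyMeasurable
    · refine Eventually.of_forall fun t ht y hy => hM (y, t) ⟨hy, ?_⟩
      rw [uIoc_of_le zero_le_one] at ht
      exact Ioc_subset_Icc_self ht
    · exact intervalIntegrable_const
    · refine Eventually.of_forall fun t _ y _ => ?_
      exact HasFDerivAt.comp (g := Function.uncurry G) (f := fun e => (e, t)) y (hG' (y, t))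
        (hasFDerivAt_prodMk_left y t)

/-- Continuous induction: a quantity that is small initially, and small as long as it was not
large before, remains small. -/
theorem lt_of_continuousOn_of_bootstrap {φ : ℝ → ℝ} {T a b : ℝ} (hab : a < b)
    (hφ : ContinuousOn φ (Icc 0 T)) (h0 : φ 0 < b)
    (h : ∀ t ∈ Icc 0 T, (∀ s ∈ Icc 0 t, φ s < b) → φ t ≤ a) :
    ∀ t ∈ Icc 0 T, φ t < b := by
  by_contra hcon
  push Not at hcon
  obtain ⟨t₁, ht₁, hbt₁⟩ := hcon
  set B := Icc 0 T ∩ φ ⁻¹' Ici b with hB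
  have hBc : IsCompact B :=
    isCompact_Icc.of_isClosed_subset (hφ.preimage_isClosed_of_isClosed isClosed_Icc isClosed_Ici)
      inter_subset_left
  -- The first time at which φ reaches `b`. Before it φ ≤ `a`, hence also at it, by continuity.
  obtain ⟨t, ⟨htT, htb⟩, hmin⟩ := hBc.exists_isLeast ⟨t₁, ht₁, hbt₁⟩
  have hlt : ∀ s ∈ Ico 0 t, φ s < b := fun s hs => by
    by_contra hsb
    exact absurd (hmin ⟨⟨hs.1, hs.2.le.trans htT.2⟩, not_lt.1 hsb⟩) (not_le.2 hs.2)
  have ht0 : 0 < t := by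
    rcases htT.1.lt_or_eq with h' | h'
    · exact h'
    · subst h'; exact absurd h0 (not_lt.2 htb)
  have hle : ∀ s ∈ Ico 0 t, φ s ≤ a := fun s hs =>
    h s ⟨hs.1, hs.2.le.trans htT.2⟩ fun s' hs' => hlt s' ⟨hs'.1, hs'.2.trans_lt hs.2⟩
  have hcont : ContinuousWithinAt φ (Ico 0 t) t :=
    (hφ t htT).mono fun s hs => ⟨hs.1, hs.2.le.trans htT.2⟩
  have hcl : t ∈ closure (Ico 0 t) := by
    rw [closure_Ico ht0.ne]; exact right_mem_Icc.2 ht0.le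
  have : φ t ≤ a := by
    have := mem_closure_iff_nhdsWithin_neBot.1 hcl
    exact le_of_tendsto hcont (eventually_nhdsWithin_of_forall hle)
  exact absurd (this.trans_lt hab) (not_lt.2 htb)

end General

/-! ### Local flow of a C¹ vector field -/

section Flow

variable {E : Type} [NormedAddCommGroup E] [NormedSpace ℝ E]

/-- A fencing argument: the bound on the speed is needed only at times when the distance from `γ 0`
equals `M * s`, and there `ha` keeps the curve in the ball of radius `a`. No prior knowledge that
the curve remains in that ball is required. -/
theorem norm_sub_le_of_hasDerivWithinAt_right {v : E → E} {a M ρ : ℝ} {γ : ℝ → E} (hM : 0 ≤ M)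
    (hv : ∀ x, ‖x‖ ≤ a → ‖v x‖ < M) (ha : ‖γ 0‖ + M * ρ ≤ a)
    (hγ : ContinuousOn γ (Icc 0 ρ))
    (hγ' : ∀ σ ∈ Ico 0 ρ, HasDerivWithinAt γ (v (γ σ)) (Ici σ) σ) :
    ∀ σ ∈ Icc 0 ρ, ‖γ σ - γ 0‖ ≤ M * σ := by
  intro σ hσ
  refine image_norm_le_of_norm_deriv_right_lt_deriv_boundary (f := fun s => γ s - γ 0)
    (f' := fun s => v (γ s)) (B := fun s => M * s) (B' := fun _ => M) (a := 0) (b := ρ)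
    (hγ.sub continuousOn_const) (fun s hs => (hγ' s hs).sub_const _) (by simp)
    (fun s => by simpa using (hasDerivAt_id s).const_mul M) (fun s hs h => hv _ ?_) hσ
  calc ‖γ s‖ = ‖(γ s - γ 0) + γ 0‖ := by simp
    _ ≤ M * s + ‖γ 0‖ := by rw [← h]; exact norm_add_le _ _
    _ ≤ a := by nlinarith [hs.2]

/-- An integral curve of a bounded vector field stays close to its initial point. -/
theorem norm_sub_le_of_hasDerivWithinAt {v : E → E} {a M ρ : ℝ} {γ : ℝ → E} (hM : 0 ≤ M)
    (hv : ∀ x, ‖x‖ ≤ a → ‖v x‖ < M) (ha : ‖γ 0‖ + M * ρ ≤ a)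
    (hγ : ∀ σ ∈ Icc (-ρ) ρ, HasDerivWithinAt γ (v (γ σ)) (Icc (-ρ) ρ) σ) :
    ∀ σ ∈ Icc (-ρ) ρ, ‖γ σ - γ 0‖ ≤ M * |σ| := by
  have hc : ContinuousOn γ (Icc (-ρ) ρ) := fun σ hσ => (hγ σ hσ).continuousWithinAt
  have hpos : ∀ σ ∈ Icc 0 ρ, ‖γ σ - γ 0‖ ≤ M * σ := by
    refine norm_sub_le_of_hasDerivWithinAt_right hM hv ha
      (hc.mono fun σ h => ⟨by linarith [h.1, h.2], h.2⟩) fun σ h => ?_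
    refine (hγ σ ⟨by linarith [h.1, h.2], h.2.le⟩).mono_of_mem_nhdsWithin ?_
    exact mem_of_superset (Icc_mem_nhdsGE h.2) fun s hs => ⟨by linarith [hs.1, h.1, h.2], hs.2⟩
  -- Time reversal: `s ↦ γ (-s)` is an integral curve of `-v`.
  have hneg : ∀ σ ∈ Icc 0 ρ, ‖γ (-σ) - γ (-0)‖ ≤ M * σ := by
    refine norm_sub_le_of_hasDerivWithinAt_right (v := fun x => -v x) (γ := fun s => γ (-s)) hM
      (fun x hx => by simpa using hv x hx) (by simpa using ha)
      (hc.comp continuousOn_neg fun σ h => ⟨by linarith [h.2], by linarith [h.1, h.2]⟩)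
      fun σ h => ?_
    have h1 := (hγ (-σ) ⟨by linarith [h.2], by linarith [h.1, h.2]⟩).scomp σ
      (hasDerivAt_neg σ).hasDerivWithinAt (s := Icc σ ρ)
      fun s hs => ⟨by linarith [hs.2], by linarith [hs.1, h.1, h.2]⟩
    simpa [Function.comp_def] using h1.mono_of_mem_nhdsWithin (Icc_mem_nhdsGE h.2)
  intro σ hσ
  rcases le_total 0 σ with h | h
  · rw [abs_of_nonneg h]; exact hpos σ ⟨h, hσ.2⟩
  · rw [abs_of_nonpos h]
    simpa using hneg (-σ) ⟨by linarith, by linarith [hσ.1]⟩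


/-- Picard–Lindelöf gives a flow that is Lipschitz in the initial value. Its strict derivative at
the origin is obtained by splitting an increment into one in time and one in the initial value, each
estimated by the mean value inequality. Uniqueness holds because every integral curve stays in the
ball where `v` is Lipschitz. -/
theorem exists_localFlow_aux [CompleteSpace E] {v : E → E} (hv : ContDiffAt ℝ 1 v 0) :
    ∃ Φ : ℝ × E → E, ∃ ρ₀ > 0,
      HasStrictFDerivAt Φ (ContinuousLinearMap.snd ℝ ℝ E +
        (ContinuousLinearMap.fst ℝ ℝ E).smulRight (v 0)) (0, 0) ∧
      (∀ u, ‖u‖ < ρ₀ → Φ (0, u) = u) ∧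
      (∀ u, ‖u‖ < ρ₀ → ∀ σ, |σ| < ρ₀ → HasDerivAt (fun s => Φ (s, u)) (v (Φ (σ, u))) σ) ∧
      (∀ u ρ γ, ‖u‖ < ρ₀ → 0 < ρ → ρ < ρ₀ → γ 0 = u →
        (∀ σ ∈ Icc (-ρ) ρ, HasDerivWithinAt γ (v (γ σ)) (Icc (-ρ) ρ) σ) →
        ∀ σ ∈ Icc (-ρ) ρ, γ σ = Φ (σ, u)) := by
  obtain ⟨ε, hε, a, r, L, K, hr, hpl⟩ := IsPicardLindelof.of_contDiffAt_one hv
  have hpl := hpl 0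
  obtain ⟨α, hα, L', hL'⟩ := hpl.exists_forall_mem_closedBall_eq_hasDerivWithinAt_lipschitzOnWith
  have hlip : LipschitzOnWith K v (Metric.closedBall 0 a) :=
    hpl.lipschitzOnWith 0 ⟨by simp [hε.le], by simp [hε.le]⟩
  have hbd : ∀ x, ‖x‖ ≤ a → ‖v x‖ < L + 1 := fun x hx => by
    have := hpl.norm_le 0 ⟨by simp [hε.le], by simp [hε.le]⟩ x (by simpa using hx)
    linarith
  have hL0 : (0:ℝ) ≤ L + 1 := by positivity
  have ha : 0 < (a:ℝ) := by
    have := hpl.mul_max_le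
    have h2 : (0:ℝ) ≤ L * max ((0:ℝ) + ε - 0) (0 - (0 - ε)) := by
      refine mul_nonneg L.2 (le_max_of_le_left ?_); linarith
    have h3 : (0:ℝ) < r := hr
    simp only at this
    linarith
  -- the common radius
  obtain ⟨ρ₀, hρ₀, h1, h2, h3⟩ : ∃ ρ₀ > (0:ℝ), ρ₀ ≤ ε ∧ ρ₀ ≤ r ∧ ρ₀ + (L + 1) * ρ₀ ≤ a := by
    refine ⟨min ε (min r (a / (L + 2))), by positivity, min_le_left _ _,
      (min_le_right _ _).trans (min_le_left _ _), ?_⟩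
    have h4 : min ε (min (r:ℝ) (a / (L + 2))) ≤ a / (L + 2) :=
      (min_le_right _ _).trans (min_le_right _ _)
    have h5 : (0:ℝ) < L + 2 := by positivity
    rw [le_div_iff₀ h5] at h4
    linarith
  have hsol : ∀ u, ‖u‖ < ρ₀ → ∀ σ, |σ| < ρ₀ →
      HasDerivAt (fun s => α u s) (v (α u σ)) σ := fun u hu σ hσ => by
    have hσ' := abs_lt.1 hσ
    refine ((hα u (by simpa using hu.le.trans h2)).2 σ ⟨by linarith, by linarith⟩).hasDerivAt
      (Icc_mem_nhds (by linarith) (by linarith))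
  have hinit : ∀ u, ‖u‖ < ρ₀ → α u 0 = u := fun u hu =>
    (hα u (by simpa using hu.le.trans h2)).1
  have hconf : ∀ u ρ γ, ‖u‖ < ρ₀ → 0 < ρ → ρ < ρ₀ → γ 0 = u →
      (∀ σ ∈ Icc (-ρ) ρ, HasDerivWithinAt γ (v (γ σ)) (Icc (-ρ) ρ) σ) →
      ∀ σ ∈ Icc (-ρ) ρ, ‖γ σ - u‖ ≤ (L + 1) * |σ| ∧ ‖γ σ‖ ≤ a := by
    intro u ρ γ hu hρ hρρ h0 hγ σ hσ
    have h4 : ‖γ σ - γ 0‖ ≤ (L + 1) * |σ| := by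
      refine norm_sub_le_of_hasDerivWithinAt hL0 hbd ?_ hγ σ hσ
      rw [h0]; nlinarith
    rw [h0] at h4
    refine ⟨h4, ?_⟩
    have h5 : |σ| ≤ ρ := abs_le.2 hσ
    calc ‖γ σ‖ = ‖(γ σ - u) + u‖ := by simp
      _ ≤ (L + 1) * |σ| + ‖u‖ := (norm_add_le _ _).trans (by gcongr)
      _ ≤ a := by nlinarith
  have hsol' : ∀ u, ‖u‖ < ρ₀ → ∀ ρ, ρ < ρ₀ → ∀ σ ∈ Icc (-ρ) ρ,
      HasDerivWithinAt (α u) (v (α u σ)) (Icc (-ρ) ρ) σ := fun u hu ρ hρ σ hσ =>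
    (hsol u hu σ ((abs_le.2 hσ).trans_lt hρ)).hasDerivWithinAt
  have hconfα : ∀ u, ‖u‖ < ρ₀ → ∀ σ, |σ| < ρ₀ →
      ‖α u σ - u‖ ≤ (L + 1) * |σ| ∧ ‖α u σ‖ ≤ a := fun u hu σ hσ => by
    obtain ⟨ρ, hρ1, hρ2⟩ := exists_between hσ
    exact hconf u ρ (α u) hu ((abs_nonneg _).trans_lt hρ1) hρ2 (hinit u hu)
      (hsol' u hu ρ hρ2) σ (abs_le.1 hρ1.le)
  refine ⟨fun p => α p.2 p.1, ρ₀, hρ₀, ?_, hinit, hsol, ?_⟩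
  · refine HasStrictFDerivAt.of_isLittleO (Asymptotics.isLittleO_iff.2 fun c hc => ?_)
    have hvc : ContinuousAt v 0 := hv.continuousAt
    obtain ⟨η, hη, hvη⟩ := Metric.continuousAt_iff.1 hvc (c / 2) (by positivity)
    -- The three bounds on `d` make the flow available, keep it where `v` is within `c / 2` of `v
    -- 0`, and make the effect of the initial value on the increment small.
    obtain ⟨d, hd, hd1, hd2, hd3⟩ : ∃ d > (0:ℝ), d ≤ ρ₀ ∧ d + (L + 1) * d ≤ η ∧
        K * L' * d ≤ c / 2 := by
      refine ⟨min ρ₀ (min (η / (L + 2)) (c / 2 / (K * L' + 1))), by positivity,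
        min_le_left _ _, ?_, ?_⟩
      · have h4 := (min_le_right ρ₀ (min (η / (L + 2)) (c / 2 / (K * L' + 1)))).trans
          (min_le_left _ _)
        rw [le_div_iff₀ (by positivity)] at h4
        linarith
      · have h4 := (min_le_right ρ₀ (min (η / (L + 2)) (c / 2 / (K * L' + 1)))).trans
          (min_le_right _ _)
        have h5 : 0 ≤ min ρ₀ (min (η / (L + 2)) (c / 2 / (K * L' + 1))) := by positivity
        rw [le_div_iff₀ (by positivity)] at h4
        linarith
    have hnear : ∀ᶠ p : (ℝ × E) × (ℝ × E) in 𝓝 ((0, 0), (0, 0)),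
        (|p.1.1| < d ∧ ‖p.1.2‖ < d) ∧ (|p.2.1| < d ∧ ‖p.2.2‖ < d) := by
      have h4 : ∀ᶠ p : ℝ × E in 𝓝 (0, 0), |p.1| < d ∧ ‖p.2‖ < d := by
        refine Metric.eventually_nhds_iff.2 ⟨d, hd, fun p hp => ?_⟩
        rw [Prod.dist_eq, max_lt_iff] at hp
        simpa using hp
      exact h4.prod_nhds h4
    filter_upwards [hnear] with p ⟨⟨hσ, hu⟩, hσ', hu'⟩
    obtain ⟨⟨σ, u⟩, σ', u'⟩ := p
    simp only at hσ hu hσ' hu' ⊢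
    have hIcc : ∀ s ∈ Ioo (-d) d, |s| < ρ₀ := fun s hs => (abs_lt.2 hs).trans_le hd1
    have hu1 := hu.trans_le hd1
    have hu1' := hu'.trans_le hd1
    have e1 : ‖(α u σ - σ • v 0) - (α u σ' - σ' • v 0)‖ ≤ c / 2 * ‖σ - σ'‖ := by
      refine (convex_Ioo (-d) d).norm_image_sub_le_of_norm_hasDerivWithin_le
        (f := fun s => α u s - s • v 0) (f' := fun s => v (α u s) - v 0)
        (fun s hs => ?_) (fun s hs => ?_) (abs_lt.1 hσ') (abs_lt.1 hσ)
      · have := (hsol u hu1 s (hIcc s hs)).sub ((hasDerivAt_id s).smul_const (v 0))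
        rw [one_smul] at this
        exact this.hasDerivWithinAt
      · rw [← dist_eq_norm]
        refine (hvη ?_).le
        rw [dist_zero_right]
        have h4 := (hconfα u hu1 s (hIcc s hs)).1
        have h5 := abs_lt.2 hs
        calc ‖α u s‖ = ‖(α u s - u) + u‖ := by simp
          _ ≤ (L + 1) * |s| + ‖u‖ := (norm_add_le _ _).trans (by gcongr)
          _ < η := by nlinarith
    -- The difference of two solutions has a derivative of size at most K L' ‖u - u'‖, and it is
    -- followed only over the short time σ'.
    have e2 : ‖(α u σ' - α u' σ') - (α u 0 - α u' 0)‖ ≤ K * L' * ‖u - u'‖ * ‖σ' - 0‖ := by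
      refine (convex_Ioo (-d) d).norm_image_sub_le_of_norm_hasDerivWithin_le
        (f := fun s => α u s - α u' s) (f' := fun s => v (α u s) - v (α u' s))
        (fun s hs => ?_) (fun s hs => ?_) ⟨by linarith, hd⟩ (abs_lt.1 hσ')
      · exact ((hsol u hu1 s (hIcc s hs)).sub (hsol u' hu1' s (hIcc s hs))).hasDerivWithinAt
      · have h4 := hlip.norm_sub_le (x := α u s) (y := α u' s)
          (by simpa using (hconfα u hu1 s (hIcc s hs)).2)
          (by simpa using (hconfα u' hu1' s (hIcc s hs)).2)
        have h6 := abs_lt.1 (hIcc s hs)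
        have h5 := (hL' s ⟨by linarith, by linarith⟩).norm_sub_le (x := u) (y := u')
          (by simpa using hu1.le.trans h2) (by simpa using hu1'.le.trans h2)
        calc _ ≤ K * ‖α u s - α u' s‖ := h4
          _ ≤ K * (L' * ‖u - u'‖) := by gcongr
          _ = _ := by ring
    rw [hinit u hu1, hinit u' hu1', sub_zero, Real.norm_eq_abs] at e2
    have e3 : K * L' * ‖u - u'‖ * |σ'| ≤ c / 2 * ‖u - u'‖ := by
      calc K * L' * ‖u - u'‖ * |σ'| ≤ K * L' * ‖u - u'‖ * d := by gcongr
        _ = K * L' * d * ‖u - u'‖ := by ring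
        _ ≤ _ := by gcongr
    have hn1 : ‖σ - σ'‖ ≤ ‖((σ, u) - (σ', u') : ℝ × E)‖ := norm_fst_le ((σ, u) - (σ', u') : ℝ × E)
    have hn2 : ‖u - u'‖ ≤ ‖((σ, u) - (σ', u') : ℝ × E)‖ := norm_snd_le ((σ, u) - (σ', u') : ℝ × E)
    calc _ = ‖((α u σ - σ • v 0) - (α u σ' - σ' • v 0)) +
          ((α u σ' - α u' σ') - (u - u'))‖ := by
          congr 1
          simp [sub_smul]
          abel
      _ ≤ c / 2 * ‖σ - σ'‖ + c / 2 * ‖u - u'‖ := (norm_add_le _ _).trans (by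
          gcongr; exact e2.trans e3)
      _ ≤ c / 2 * ‖((σ, u) - (σ', u') : ℝ × E)‖ + c / 2 * ‖((σ, u) - (σ', u') : ℝ × E)‖ := by
          gcongr
      _ = _ := by ring
  · intro u ρ γ hu hρ hρ' h0 hγ
    have hγc : ContinuousOn γ (Icc (-ρ) ρ) := fun s hs => (hγ s hs).continuousWithinAt
    have hαc : ContinuousOn (α u) (Icc (-ρ) ρ) := fun s hs =>
      (hsol' u hu ρ hρ' s hs).continuousWithinAt
    refine ODE_solution_unique_of_mem_Icc (v := fun _ => v) (s := fun _ => Metric.closedBall 0 a)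
      (K := K) (t₀ := 0) (fun _ _ => hlip) ⟨by linarith, hρ⟩ hγc
      (fun s hs => (hγ s (Ioo_subset_Icc_self hs)).hasDerivAt (Icc_mem_nhds hs.1 hs.2))
      (fun s hs => ?_) hαc
      (fun s hs => (hsol' u hu ρ hρ' s (Ioo_subset_Icc_self hs)).hasDerivAt
        (Icc_mem_nhds hs.1 hs.2)) (fun s hs => ?_) (h0.trans (hinit u hu).symm)
    · simpa using (hconf u ρ γ hu hρ hρ' h0 hγ s (Ioo_subset_Icc_self hs)).2
    · simpa using (hconf u ρ (α u) hu hρ hρ' (hinit u hu) (hsol' u hu ρ hρ') s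
        (Ioo_subset_Icc_self hs)).2

/-- The local flow of a `C¹` vector field: existence, uniqueness, group property, and strict
differentiability in time and initial value jointly. -/
theorem exists_localFlow [CompleteSpace E] {v : E → E} (hv : ContDiffAt ℝ 1 v 0) :
    ∃ Φ : ℝ × E → E, ∃ ρ₀ > 0,
      HasStrictFDerivAt Φ (ContinuousLinearMap.snd ℝ ℝ E +
        (ContinuousLinearMap.fst ℝ ℝ E).smulRight (v 0)) (0, 0) ∧
      (∀ u, ‖u‖ < ρ₀ → Φ (0, u) = u) ∧
      (∀ u, ‖u‖ < ρ₀ → ∀ σ, |σ| < ρ₀ → HasDerivAt (fun s => Φ (s, u)) (v (Φ (σ, u))) σ) ∧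
      (∀ u ρ γ, ‖u‖ < ρ₀ → 0 < ρ → ρ < ρ₀ → γ 0 = u →
        (∀ σ ∈ Icc (-ρ) ρ, HasDerivWithinAt γ (v (γ σ)) (Icc (-ρ) ρ) σ) →
        ∀ σ ∈ Icc (-ρ) ρ, γ σ = Φ (σ, u)) ∧
      (∀ u σ σ', ‖u‖ < ρ₀ → |σ| < ρ₀ → |σ'| < ρ₀ → Φ (σ, Φ (σ', u)) = Φ (σ + σ', u)) := by
  obtain ⟨Φ, ρ₁, hρ₁, hd, h0, hs, hu⟩ := exists_localFlow_aux hv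
  have hΦ0 : Φ (0, 0) = 0 := h0 0 (by simpa using hρ₁)
  obtain ⟨ρ₂, hρ₂, hball⟩ := Metric.continuousAt_iff.1 hd.continuousAt ρ₁ hρ₁
  refine ⟨Φ, min (ρ₁ / 3) ρ₂, by positivity, hd, fun u h => h0 u ?_, fun u h σ hσ => hs u ?_ σ ?_,
    fun u ρ γ h hρ hρ' => hu u ρ γ ?_ hρ ?_, fun u σ σ' h hσ hσ' => ?_⟩
  any_goals (have := lt_min_iff.1 ‹‖u‖ < _›; linarith)
  · have := lt_min_iff.1 hσ; linarith
  · have := lt_min_iff.1 hρ'; linarith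
  have hl := lt_min_iff.1 h
  have hlσ := lt_min_iff.1 hσ
  have hlσ' := lt_min_iff.1 hσ'
  have hw : ‖Φ (σ', u)‖ < ρ₁ := by
    have := @hball (σ', u) (by
      rw [Prod.dist_eq]; simpa using ⟨hlσ'.2, hl.2⟩)
    simpa [hΦ0] using this
  -- Both sides are integral curves through Φ(σ', u). The radius ρ₁ / 3 leaves room for the shifted
  -- time `s + σ'`.
  have key := hu (Φ (σ', u)) (ρ₁ / 3) (fun s => Φ (s + σ', u)) hw (by positivity) (by linarith)
    (by simp) (fun s hs' => ?_) σ (abs_le.1 hlσ.1.le)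
  · exact key.symm
  · have h4 := hs u (by linarith) (s + σ') ((abs_add_le _ _).trans_lt (by
      have := abs_le.2 hs'; linarith))
    exact (h4.comp_add_const s σ').hasDerivWithinAt

end Flow
end

/-! ### The Rankine–Hugoniot locus -/

noncomputable section

section Hugoniot

variable {E : Type} [NormedAddCommGroup E] [NormedSpace ℝ E] [FiniteDimensional ℝ E]

/-- A `Cᵏ` function on a neighbourhood of `0` coincides near `0` with a global `Cᵏ` function. -/
theorem exists_contDiff_eventuallyEq {E : Type} [NormedAddCommGroup E] [InnerProductSpace ℝ E]
    [FiniteDimensional ℝ E] {k : ℕ} {f : E → E} {Ω : Set E} (hΩ : IsOpen Ω) (h0 : 0 ∈ Ω)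
    (hf : ContDiffOn ℝ k f Ω) : ∃ g : E → E, ContDiff ℝ k g ∧ g =ᶠ[𝓝 0] f := by
  obtain ⟨R, hR, hsub⟩ := Metric.nhds_basis_closedBall.mem_iff.1 (hΩ.mem_nhds h0)
  let χ : ContDiffBump (0 : E) := ⟨R / 2, R, by positivity, by linarith⟩
  refine ⟨fun x => χ x • f x, ?_, ?_⟩
  · rw [contDiff_iff_contDiffAt]
    intro x
    by_cases hx : x ∈ Ω
    · exact χ.contDiffAt.smul (hf.contDiffAt (hΩ.mem_nhds hx))
    · have hx' : x ∉ Metric.closedBall (0 : E) R := fun h => hx (hsub h)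
      have : (fun x => χ x • f x) =ᶠ[𝓝 x] fun _ => 0 := by
        filter_upwards [Metric.isClosed_closedBall.isOpen_compl.mem_nhds hx'] with y hy
        have : χ y = 0 := χ.zero_of_le_dist (by
          simp only [mem_compl_iff, Metric.mem_closedBall, not_le] at hy; exact hy.le)
        simp [this]
      exact contDiffAt_const.congr_of_eventuallyEq this
  · filter_upwards [χ.eventuallyEq_one] with x hx
    simp [hx]

/-- The average of the derivative of `g` over the segment from `u` to `u + w`. -/
def averageDeriv (g : E → E) (z : E × E) : E →L[ℝ] E :=
  ∫ θ in (0 : ℝ)..1, fderiv ℝ g (z.1 + θ • z.2)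

theorem contDiff_averageDeriv {g : E → E} {k : ℕ} (hg : ContDiff ℝ (k + 1 : ℕ) g) :
    ContDiff ℝ k (averageDeriv g) := by
  refine contDiff_integral_of_contDiff k (fun (z : E × E) θ => fderiv ℝ g (z.1 + θ • z.2)) ?_
  have h1 : ContDiff ℝ k (fderiv ℝ g) := hg.fderiv_right (by norm_cast)
  have h2 : ContDiff ℝ k fun p : (E × E) × ℝ => p.1.1 + p.2 • p.1.2 := by fun_prop
  exact h1.comp h2

theorem averageDeriv_zero (g : E → E) (u : E) : averageDeriv g (u, 0) = fderiv ℝ g u := by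
  simp [averageDeriv]

theorem averageDeriv_apply {g : E → E} {k : ℕ} (hg : ContDiff ℝ (k + 1 : ℕ) g) (u w : E) :
    averageDeriv g (u, w) w = g (u + w) - g u := by
  have h1 : Continuous (fderiv ℝ g) := hg.continuous_fderiv (by norm_num)
  have h2 : Continuous fun θ : ℝ => fderiv ℝ g (u + θ • w) := by fun_prop
  rw [averageDeriv, ContinuousLinearMap.intervalIntegral_apply (h2.intervalIntegrable 0 1)]
  rw [intervalIntegral.integral_eq_sub_of_hasDerivAt (f := fun θ : ℝ => g (u + θ • w))]
  · simp
  · intro θ _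
    have h3 : HasDerivAt (fun θ : ℝ => u + θ • w) w θ := by
      simpa using ((hasDerivAt_id θ).smul_const w).const_add u
    exact ((hg.differentiable (by norm_num)) _).hasFDerivAt.comp_hasDerivAt θ h3
  · exact (h2.clm_apply continuous_const).intervalIntegrable 0 1

/-- The Rankine--Hugoniot locus near a state with a simple eigenvalue: it is parametrized by
`τ ↦ u + τ p(u,τ)`, with speed `s(u,τ)`. -/
theorem exists_hugoniot {g : E → E} (hg : ContDiff ℝ (3 : ℕ) g) (ℓ : E →L[ℝ] ℝ) (e : E) (μ : ℝ)
    (he : fderiv ℝ g 0 e = μ • e) (hℓ : ℓ e = 1)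
    (hinj : ∀ (x : E) (t : ℝ), fderiv ℝ g 0 x - μ • x = t • e → ℓ x = 0 → x = 0 ∧ t = 0) :
    ∃ (p : E × ℝ → E) (s : E × ℝ → ℝ), ContDiffAt ℝ 2 p 0 ∧ ContDiffAt ℝ 2 s 0 ∧ p 0 = e ∧
      s 0 = μ ∧
      (∀ᶠ z : E × ℝ in 𝓝 0, ℓ (p z) = 1 ∧ g (z.1 + z.2 • p z) - g z.1 = (s z * z.2) • p z) ∧
      (∀ᶠ u in 𝓝 (0 : E), fderiv ℝ g u (p (u, 0)) = s (u, 0) • p (u, 0)) ∧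
      ∃ r > 0, ∀ u v σ, ‖u‖ < r → ‖v - u‖ < r → |σ - μ| < r → g v - g u = σ • (v - u) →
        v = u + ℓ (v - u) • p (u, ℓ (v - u)) ∧ (v ≠ u → σ = s (u, ℓ (v - u))) := by
  have hA : ContDiff ℝ 2 (averageDeriv g) := contDiff_averageDeriv (k := 2) hg
  -- With v = u + τ p the Rankine–Hugoniot equation is divisible by τ. The quotient, in terms of the
  -- averaged derivative, is an eigenvector equation for p with eigenvalue s, and it remains
  -- meaningful at τ = 0. The second component normalizes p.
  set F : (E × ℝ) × (E × ℝ) → E × ℝ := fun q =>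
    (averageDeriv g (q.1.1, q.1.2 • q.2.1) q.2.1 - q.2.2 • q.2.1, ℓ q.2.1) with hF
  have hFc : ContDiff ℝ 2 F := by
    refine ContDiff.prodMk ((ContDiff.clm_apply (hA.comp ?_) ?_).sub ?_) ?_ <;> fun_prop
  set q₀ : (E × ℝ) × (E × ℝ) := (0, (e, μ)) with hq₀
  set T : E × ℝ →L[ℝ] E × ℝ := ContinuousLinearMap.prod
    ((fderiv ℝ g 0 - μ • ContinuousLinearMap.id ℝ E).comp (ContinuousLinearMap.fst ℝ E ℝ) -
      (ContinuousLinearMap.snd ℝ E ℝ).smulRight e) (ℓ.comp (ContinuousLinearMap.fst ℝ E ℝ)) with hT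
  have hTapp : ∀ x t, T (x, t) = (fderiv ℝ g 0 x - μ • x - t • e, ℓ x) := fun x t => by
    simp [hT]
  have hTF : fderiv ℝ F q₀ ∘L .inr ℝ (E × ℝ) (E × ℝ) = T := by
    have h1 : HasFDerivAt (fun y : E × ℝ => F (0, y)) (fderiv ℝ F q₀ ∘L .inr ℝ (E × ℝ) (E × ℝ))
        (e, μ) := by
      have h2 : HasFDerivAt F (fderiv ℝ F q₀) (0, (e, μ)) :=
        (hFc.differentiable (by norm_num) q₀).hasFDerivAt
      exact HasFDerivAt.comp (g := F) (f := fun y => ((0 : E × ℝ), y)) (e, μ) h2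
        (hasFDerivAt_prodMk_right (0 : E × ℝ) (e, μ))
    have h2 : HasFDerivAt (fun y : E × ℝ => F (0, y)) T (e, μ) := by
      have h3 : (fun y : E × ℝ => F (0, y)) =
          fun y : E × ℝ => (fderiv ℝ g 0 y.1 - y.2 • y.1, ℓ y.1) := by
        funext y
        simp [hF, averageDeriv_zero]
      rw [h3]
      have h4 : HasFDerivAt (fun y : E × ℝ => fderiv ℝ g 0 y.1 - y.2 • y.1)
          ((fderiv ℝ g 0 - μ • ContinuousLinearMap.id ℝ E).comp (ContinuousLinearMap.fst ℝ E ℝ) -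
            (ContinuousLinearMap.snd ℝ E ℝ).smulRight e) (e, μ) := by
        have h5 := ((fderiv ℝ g 0).hasFDerivAt (x := e)).comp (e, μ)
          (hasFDerivAt_fst (𝕜 := ℝ) (E := E) (F := ℝ))
        have h6 := (hasFDerivAt_snd (𝕜 := ℝ) (E := E) (F := ℝ) (p := (e, μ))).smul
          (hasFDerivAt_fst (𝕜 := ℝ) (E := E) (F := ℝ) (p := (e, μ)))
        refine (h5.sub h6).congr_fderiv ?_
        ext x <;> simp
      exact h4.prodMk (ℓ.hasFDerivAt.comp (e, μ) hasFDerivAt_fst)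
    exact h1.unique h2
  have hTinj : Function.Injective T := by
    rw [injective_iff_map_eq_zero]
    rintro ⟨x, t⟩ h
    rw [hTapp, Prod.mk_eq_zero, sub_eq_zero] at h
    obtain ⟨h1, h2⟩ := hinj x t h.1 h.2
    simp [h1, h2]
  -- Simplicity of the eigenvalue, in the form `hinj`, makes the partial derivative `T` in (p, s)
  -- injective, hence invertible in finite dimension.
  set Te : (E × ℝ) ≃L[ℝ] (E × ℝ) :=
    (LinearEquiv.ofInjectiveEndo (T : E × ℝ →ₗ[ℝ] E × ℝ) hTinj).toContinuousLinearEquiv with hTe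
  have hTeT : (Te : E × ℝ →L[ℝ] E × ℝ) = T := by ext x <;> simp [hTe]
  have if₂ : (fderiv ℝ F q₀ ∘L .inr ℝ (E × ℝ) (E × ℝ)).IsInvertible := by
    rw [hTF]; exact ⟨Te, hTeT⟩
  have hFq : ContDiffAt ℝ 2 F q₀ := hFc.contDiffAt
  have hF0 : F q₀ = (0, 1) := by simp [hF, hq₀, averageDeriv_zero, he, hℓ]
  set ψ := hFq.implicitFunction (by norm_num) if₂ with hψ
  have hψc : ContDiffAt ℝ 2 ψ 0 := hFq.contDiffAt_implicitFunction (by norm_num) if₂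
  have hψ0 : ψ 0 = (e, μ) := hFq.implicitFunction_apply_self (by norm_num) if₂
  have hψF : ∀ᶠ z in 𝓝 (0 : E × ℝ), F (z, ψ z) = (0, 1) := by
    have := hFq.eventually_apply_implicitFunction (by norm_num) if₂
    rwa [hF0] at this
  have hψu : ∀ᶠ q in 𝓝 q₀, F q = (0, 1) → ψ q.1 = q.2 := by
    have := hFq.eventually_apply_eq_iff_implicitFunction (by norm_num) if₂
    rw [hF0] at this
    exact this.mono fun q hq => hq.1
  refine ⟨fun z => (ψ z).1, fun z => (ψ z).2, hψc.fst, hψc.snd, by simp [hψ0], by simp [hψ0],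
    ?_, ?_, ?_⟩
  · filter_upwards [hψF] with z hz
    simp only [hF, Prod.mk.injEq, sub_eq_zero] at hz
    refine ⟨hz.2, ?_⟩
    rw [← averageDeriv_apply (k := 2) hg, map_smul, hz.1, smul_smul, mul_comm]
  · have h1 : Tendsto (fun u : E => (u, (0 : ℝ))) (𝓝 0) (𝓝 (0 : E × ℝ)) :=
      (Continuous.prodMk_left (0 : ℝ)).tendsto 0
    filter_upwards [h1.eventually hψF] with u hu
    simp only [hF, Prod.mk.injEq, sub_eq_zero, zero_smul, averageDeriv_zero] at hu
    exact hu.1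
  · obtain ⟨η, hη, hψη⟩ := Metric.eventually_nhds_iff.1 hψu
    set C : ℝ := ‖(Te.symm : E × ℝ →L[ℝ] E × ℝ)‖ + 1 with hC
    have hCpos : 0 < C := by positivity
    have hTC : ∀ y, ‖y‖ ≤ C * ‖T y‖ := fun y => by
      have h1 : Te.symm (T y) = y := by rw [← hTeT]; exact Te.symm_apply_apply y
      calc ‖y‖ = ‖(Te.symm : E × ℝ →L[ℝ] E × ℝ) (T y)‖ := by rw [ContinuousLinearEquiv.coe_coe, h1]
        _ ≤ ‖(Te.symm : E × ℝ →L[ℝ] E × ℝ)‖ * ‖T y‖ := ContinuousLinearMap.le_opNorm _ _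
        _ ≤ C * ‖T y‖ := by gcongr; rw [hC]; linarith
    -- The first bound on κ lets ‖x‖ be absorbed, giving ‖x‖ ≤ 2 |t| ‖e‖; with the second one, x / t
    -- lies within η of `e`, where the implicit function is the only solution.
    obtain ⟨κ, hκ, hκ1, hκ2⟩ : ∃ κ > 0, C * (2 * κ) ≤ 1 / 2 ∧ 2 * (C * (2 * κ)) * ‖e‖ < η := by
      refine ⟨min (1 / (4 * C)) (η / (4 * C * (‖e‖ + 1))), by positivity, ?_, ?_⟩
      · have := min_le_left (1 / (4 * C)) (η / (4 * C * (‖e‖ + 1)))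
        rw [le_div_iff₀ (by positivity)] at this
        linarith
      · have h1 : 0 < min (1 / (4 * C)) (η / (4 * C * (‖e‖ + 1))) := by positivity
        have := min_le_right (1 / (4 * C)) (η / (4 * C * (‖e‖ + 1)))
        rw [le_div_iff₀ (by positivity)] at this
        have h2 := mul_pos h1 hCpos
        nlinarith
    have hAc : ContinuousAt (averageDeriv g) (0, 0) := hA.continuous.continuousAt
    obtain ⟨d, hd, hAd⟩ := Metric.continuousAt_iff.1 hAc κ hκ
    refine ⟨min (min d κ) (min η (η / (‖ℓ‖ + 1))), by positivity, fun u v σ hu hv hσ hRH => ?_⟩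
    simp only [lt_min_iff] at hu hv hσ
    by_cases hvu : v = u
    · simp [hvu]
    set x := v - u with hx
    have hx0 : x ≠ 0 := sub_ne_zero.2 hvu
    have hvx : v = u + x := by simp [hx]
    have hAx : averageDeriv g (u, x) x = σ • x := by
      rw [averageDeriv_apply (k := 2) hg, ← hRH, hvx]
    set t := ℓ x with ht
    have hAclose : ‖averageDeriv g (u, x) - fderiv ℝ g 0‖ < κ := by
      have := @hAd (u, x) (by rw [Prod.dist_eq]; simpa using ⟨hu.1.1, hv.1.1⟩)
      rwa [averageDeriv_zero, dist_eq_norm] at this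
    -- The jump x is almost an eigenvector at the origin: it is an exact eigenvector of a nearby
    -- operator, for a nearby eigenvalue.
    have hb1 : ‖fderiv ℝ g 0 x - μ • x‖ ≤ 2 * κ * ‖x‖ := by
      have h1 : fderiv ℝ g 0 x - μ • x =
          (σ - μ) • x - (averageDeriv g (u, x) - fderiv ℝ g 0) x := by
        rw [sub_apply, hAx, sub_smul]; abel
      rw [h1]
      calc _ ≤ ‖(σ - μ) • x‖ + ‖(averageDeriv g (u, x) - fderiv ℝ g 0) x‖ := norm_sub_le _ _
        _ ≤ κ * ‖x‖ + κ * ‖x‖ := by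
          gcongr
          · rw [norm_smul]; gcongr; exact hσ.1.2.le
          · exact (ContinuousLinearMap.le_opNorm _ _).trans (by gcongr)
        _ = _ := by ring
    -- Subtracting t e does not change (Dg(0) - μ) x and makes ℓ vanish, so the inverse of `T`
    -- bounds what remains.
    have hb2 : ‖x - t • e‖ ≤ C * (2 * κ) * ‖x‖ := by
      have h1 : T (x - t • e, 0) = (fderiv ℝ g 0 x - μ • x, 0) := by
        rw [hTapp]
        ext
        · simp only [map_sub, map_smul, he, smul_sub, smul_comm μ t]; simp
        · simp [hℓ, ht]
      calc ‖x - t • e‖ ≤ ‖((x - t • e, 0) : E × ℝ)‖ := norm_fst_le ((x - t • e, 0) : E × ℝ)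
        _ ≤ C * ‖T (x - t • e, 0)‖ := hTC _
        _ ≤ C * (2 * κ * ‖x‖) := by rw [h1]; gcongr; simpa using hb1
        _ = _ := by ring
    have hxpos : 0 < ‖x‖ := norm_pos_iff.2 hx0
    have hb3 : ‖x‖ ≤ 2 * (|t| * ‖e‖) := by
      have h1 : ‖x‖ ≤ ‖x - t • e‖ + |t| * ‖e‖ := by
        calc ‖x‖ = ‖(x - t • e) + t • e‖ := by simp
          _ ≤ _ := (norm_add_le _ _).trans (by rw [norm_smul, Real.norm_eq_abs])
      nlinarith
    have ht0 : t ≠ 0 := by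
      intro h; rw [h] at hb3; simp at hb3; exact hx0 hb3
    have htpos : 0 < |t| := abs_pos.2 ht0
    have hF1 : F ((u, t), (t⁻¹ • x, σ)) = (0, 1) := by
      simp only [hF, smul_smul, mul_inv_cancel₀ ht0, one_smul, map_smul, hAx]
      ext
      · simp [mul_comm]
      · simp [← ht, ht0]
    have hclose : dist ((u, t), (t⁻¹ • x, σ)) q₀ < η := by
      have hτσ : |t| < η ∧ dist (t⁻¹ • x) e < η ∧ |σ - μ| < η := ?_
      · rw [hq₀, Prod.dist_eq, Prod.dist_eq, max_lt_iff, max_lt_iff]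
        refine ⟨⟨by simpa using hu.2.1, by simpa using hτσ.1⟩, ?_⟩
        rw [Prod.dist_eq, max_lt_iff]
        exact hτσ.2
      refine ⟨?_, ?_, hσ.2.1⟩
      · have h1 : |t| ≤ ‖ℓ‖ * ‖x‖ := ℓ.le_opNorm x
        have h2 := hv.2.2
        rw [lt_div_iff₀ (by positivity)] at h2
        nlinarith
      · rw [dist_eq_norm]
        have h1 : t⁻¹ • x - e = t⁻¹ • (x - t • e) := by
          rw [smul_sub t⁻¹ x, smul_smul, inv_mul_cancel₀ ht0, one_smul]
        rw [h1, norm_smul, norm_inv, Real.norm_eq_abs, inv_mul_lt_iff₀ htpos]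
        calc _ ≤ C * (2 * κ) * ‖x‖ := hb2
          _ ≤ C * (2 * κ) * (2 * (|t| * ‖e‖)) := by gcongr
          _ = |t| * (2 * (C * (2 * κ)) * ‖e‖) := by ring
          _ < |t| * η := by gcongr
    have hfin := hψη hclose hF1
    simp only at hfin
    refine ⟨?_, fun _ => by simp only [hfin]⟩
    simp only [hfin]
    rw [ smul_smul, mul_inv_cancel₀ ht0, one_smul, hvx]

end Hugoniot

/-! ### Eigenvectors of an operator with distinct eigenvalues -/

section LinearAlgebra

variable {E : Type} [AddCommGroup E] [Module ℝ E] [FiniteDimensional ℝ E] {n : ℕ}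

/-- An endomorphism of an `n`-dimensional space with `n` distinct eigenvalues has no other
eigenvalues, and its eigenspaces are lines. -/
theorem exists_eq_smul_of_eigenvectors (hn : Module.finrank ℝ E = n) (A : E →ₗ[ℝ] E)
    {e : Fin n → E} {μ : Fin n → ℝ} (hμ : Function.Injective μ) (he : ∀ i, e i ≠ 0)
    (hA : ∀ i, A (e i) = μ i • e i) {x : E} (hx : x ≠ 0) {ν : ℝ} (hν : A x = ν • x) :
    ∃ j, ν = μ j ∧ ∃ c : ℝ, x = c • e j := by
  have hli : LinearIndependent ℝ e := Module.End.eigenvectors_linearIndependent' A μ hμ e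
    fun i => ⟨Module.End.mem_eigenspace_iff.2 (hA i), he i⟩
  have hspan : x ∈ Submodule.span ℝ (range e) := by
    rw [hli.span_eq_top_of_card_eq_finrank' (by simp [hn])]; trivial
  obtain ⟨c, rfl⟩ := (Submodule.mem_span_range_iff_exists_fun ℝ).1 hspan
  have h1 : ∑ i, (c i * (μ i - ν)) • e i = 0 := by
    have : ∑ i, (c i * (μ i - ν)) • e i = A (∑ i, c i • e i) - ν • ∑ i, c i • e i := by
      rw [map_sum, Finset.smul_sum, ← Finset.sum_sub_distrib]
      refine Finset.sum_congr rfl fun i _ => ?_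
      rw [map_smul, hA, smul_smul, smul_smul, ← sub_smul]; congr 1; ring
    rw [this, hν, sub_self]
  have h2 : ∀ i, c i * (μ i - ν) = 0 := Fintype.linearIndependent_iff.1 hli _ h1
  obtain ⟨j, hj⟩ : ∃ j, c j ≠ 0 := by
    by_contra h
    push Not at h
    exact hx (by simp [h])
  have hνj : μ j = ν := sub_eq_zero.1 ((mul_eq_zero.1 (h2 j)).resolve_left hj)
  refine ⟨j, hνj.symm, c j, Finset.sum_eq_single j (fun i _ hij => ?_) (by simp)⟩
  have : c i = 0 := (mul_eq_zero.1 (h2 i)).resolve_right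
    (sub_ne_zero.2 fun h => hij (hμ (h.trans hνj.symm)))
  simp [this]

end LinearAlgebra
end

/-! ### Regularity of eigenvalues and eigenvectors -/

noncomputable section

namespace HyperbolicSystem

variable {n : ℕ} (S : HyperbolicSystem n)

theorem r_ne_zero {u : State n} (hu : u ∈ S.Ω) (j : Fin n) : S.r j u ≠ 0 := by
  intro h
  rcases S.field_type j with h1 | h1
  · have := h1 u hu
    rw [h, map_zero] at this
    exact (S.k_pos j).ne this
  · have := (h1 u hu).2
    rw [h, norm_zero] at this
    exact zero_ne_one this

theorem fderiv_lam_of_gnl {j : Fin n} (hj : S.GNL j) {u : State n} (hu : u ∈ S.Ω) :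
    fderiv ℝ (S.lam j) u (S.r j u) = S.k j := by
  rcases S.field_type j with h1 | h1
  · exact h1 u hu
  · exact absurd (h1 u hu).1 (hj u hu)

theorem linearlyDegenerate_of_not_gnl {j : Fin n} (hj : ¬ S.GNL j) {u : State n} (hu : u ∈ S.Ω) :
    fderiv ℝ (S.lam j) u (S.r j u) = 0 ∧ ‖S.r j u‖ = 1 := by
  rcases S.field_type j with h1 | h1
  · exact absurd (fun u hu => by rw [h1 u hu]; exact (S.k_pos j).ne') hj
  · exact h1 u hu

theorem eventually_mem_Ω : ∀ᶠ u in 𝓝 (0 : State n), u ∈ S.Ω :=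
  S.isOpen_Ω.mem_nhds S.zero_mem

/-- The eigenvectors at the origin. -/
def basisZero (j : Fin n) : Module.Basis (Fin n) ℝ (State n) :=
  haveI : Nonempty (Fin n) := ⟨j⟩
  basisOfLinearIndependentOfCardEqFinrank (b := fun i => S.r i 0)
    (Module.End.eigenvectors_linearIndependent' (fderiv ℝ S.f 0 : State n →ₗ[ℝ] State n)
      (fun i => S.lam i 0) (S.lam_strictMono 0 S.zero_mem).injective _
      fun i => ⟨Module.End.mem_eigenspace_iff.2 (S.eigen 0 S.zero_mem i),
        S.r_ne_zero S.zero_mem i⟩) (by simp)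

theorem basisZero_apply (j i : Fin n) : S.basisZero j i = S.r i 0 := by
  simp [basisZero]

/-- The `j`-th Hugoniot locus near the origin. -/
structure HugoniotData (j : Fin n) where
  ell : State n →L[ℝ] ℝ
  p : State n × ℝ → State n
  s : State n × ℝ → ℝ
  contDiffAt_p : ContDiffAt ℝ 2 p 0
  contDiffAt_s : ContDiffAt ℝ 2 s 0
  p_zero : p 0 = S.r j 0
  hugoniot : ∀ᶠ z in 𝓝 (0 : State n × ℝ), ell (p z) = 1 ∧
    S.f (z.1 + z.2 • p z) - S.f z.1 = (s z * z.2) • p z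
  lam_eq : ∀ᶠ u in 𝓝 (0 : State n), S.lam j u = s (u, 0)
  r_eq : ∀ᶠ u in 𝓝 (0 : State n), S.r j u = ell (S.r j u) • p (u, 0)
  unique : ∃ r > 0, ∀ u v σ, ‖u‖ < r → ‖v - u‖ < r → |σ - S.lam j 0| < r →
    S.f v - S.f u = σ • (v - u) →
    v = u + ell (v - u) • p (u, ell (v - u)) ∧ (v ≠ u → σ = s (u, ell (v - u)))

/-- The implicit function theorem is applied to all families at once, with the dual basis of the
eigenvectors at 0 as normalizations. Only the complete list of eigenvalues s_i(u, 0) can be matched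
with the ordered list λ_i(u), whose continuity is not given. -/
theorem nonempty_hugoniotData (j : Fin n) : Nonempty (S.HugoniotData j) := by
  -- A globally smooth flux, so that its derivative can be averaged over arbitrary segments.
  obtain ⟨g, hg, hgf⟩ := exists_contDiff_eventuallyEq (k := 4) S.isOpen_Ω S.zero_mem
    (by exact_mod_cast S.contDiffOn_f)
  have hg3 : ContDiff ℝ (3 : ℕ) g := hg.of_le (by norm_num)
  have hgD : ∀ᶠ u in 𝓝 (0 : State n), fderiv ℝ g u = fderiv ℝ S.f u :=
    hgf.eventuallyEq_nhds.mono fun u hu => hu.fderiv_eq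
  have hD0 : fderiv ℝ g 0 = fderiv ℝ S.f 0 := hgD.self_of_nhds
  set b := S.basisZero j with hb
  have hcoord : ∀ i i', b.coord i (S.r i' 0) = if i' = i then 1 else 0 := fun i i' => by
    rw [← S.basisZero_apply j i', ← hb, Module.Basis.coord_apply, b.repr_self,
      Finsupp.single_apply]
  have hinj0 := (S.lam_strictMono 0 S.zero_mem).injective
  have hex : ∀ i, ∃ (p : State n × ℝ → State n) (s : State n × ℝ → ℝ), ContDiffAt ℝ 2 p 0 ∧
      ContDiffAt ℝ 2 s 0 ∧ p 0 = S.r i 0 ∧ s 0 = S.lam i 0 ∧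
      (∀ᶠ z : State n × ℝ in 𝓝 0, LinearMap.toContinuousLinearMap (b.coord i) (p z) = 1 ∧
        g (z.1 + z.2 • p z) - g z.1 = (s z * z.2) • p z) ∧
      (∀ᶠ u in 𝓝 (0 : State n), fderiv ℝ g u (p (u, 0)) = s (u, 0) • p (u, 0)) ∧
      ∃ r > 0, ∀ u v σ, ‖u‖ < r → ‖v - u‖ < r → |σ - S.lam i 0| < r →
        g v - g u = σ • (v - u) →
        v = u + LinearMap.toContinuousLinearMap (b.coord i) (v - u) •
          p (u, LinearMap.toContinuousLinearMap (b.coord i) (v - u)) ∧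
        (v ≠ u → σ = s (u, LinearMap.toContinuousLinearMap (b.coord i) (v - u))) := by
    intro i
    refine exists_hugoniot hg3 _ (S.r i 0) (S.lam i 0) ?_ ?_ ?_
    · rw [hD0]; exact S.eigen 0 S.zero_mem i
    · simp [hcoord]
    · intro x t hx hℓ
      -- The equation in eigencoordinates: the component i' = i forces t = 0, and then distinctness
      -- of the eigenvalues kills the other components.
      have hrep : ∀ i', (S.lam i' 0 - S.lam i 0) * b.repr x i' = if i' = i then t else 0 := by
        intro i'
        have h1 : b.repr (fderiv ℝ g 0 x) i' = S.lam i' 0 * b.repr x i' := by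
          have h2 : fderiv ℝ g 0 x = ∑ m, b.repr x m • (S.lam m 0 • b m) := by
            conv_lhs => rw [← b.sum_repr x]
            rw [map_sum]
            refine Finset.sum_congr rfl fun m _ => ?_
            rw [map_smul, hD0, hb, S.basisZero_apply j m, S.eigen 0 S.zero_mem m]
          rw [h2]
          simp [Finsupp.single_apply, mul_comm]
        have h2 := congrArg (fun y => b.repr y i') hx
        have h3 : b.repr (S.r i 0) i' = if i' = i then 1 else 0 := by
          have := hcoord i' i
          rw [Module.Basis.coord_apply] at this
          rw [this]
          simp [eq_comm]
        simp only [map_sub, map_smul, Finsupp.sub_apply, Finsupp.smul_apply, h1, smul_eq_mul,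
          h3] at h2
        rw [sub_mul, h2]; simp
      have hℓ' : b.repr x i = 0 := by simpa using hℓ
      have ht : t = 0 := by
        have := hrep i
        simpa using this.symm
      refine ⟨?_, ht⟩
      apply b.repr.map_eq_zero_iff.1
      ext i'
      by_cases h : i' = i
      · rw [h, hℓ']; rfl
      · have := hrep i'
        rw [if_neg h] at this
        exact (mul_eq_zero.1 this).resolve_left (sub_ne_zero.2 fun h' => h (hinj0 h'))
  choose p s hp hs hp0 hs0 hH hE hU using hex
  have hcur : Tendsto (fun u : State n => (u, (0 : ℝ))) (𝓝 0) (𝓝 (0 : State n × ℝ)) :=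
    (Continuous.prodMk_left (0 : ℝ)).tendsto 0
  have hℓp : ∀ᶠ u in 𝓝 (0 : State n), ∀ i, b.coord i (p i (u, 0)) = 1 := by
    rw [eventually_all]
    exact fun i => (hcur.eventually (hH i)).mono fun u hu => hu.1
  have hmono : ∀ᶠ u in 𝓝 (0 : State n), StrictMono fun i => s i (u, 0) := by
    have : ∀ᶠ u in 𝓝 (0 : State n), ∀ i i', i < i' → s i (u, 0) < s i' (u, 0) := by
      simp only [eventually_all]
      intro i i' hii
      have h1 : ∀ m, Tendsto (fun u : State n => s m (u, 0)) (𝓝 0) (𝓝 (S.lam m 0)) := fun m => by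
        rw [← hs0 m]; exact (hs m).continuousAt.tendsto.comp hcur
      exact (h1 i).eventually_lt (h1 i') (S.lam_strictMono 0 S.zero_mem hii)
    exact this.mono fun u hu i i' h => hu i i' h
  have hE' : ∀ᶠ u in 𝓝 (0 : State n), ∀ i, fderiv ℝ S.f u (p i (u, 0)) =
      s i (u, 0) • p i (u, 0) := by
    rw [eventually_all]
    intro i
    filter_upwards [hE i, hgD] with u h1 h2
    rw [← h2, h1]
  have hpne : ∀ u, (∀ i, b.coord i (p i (u, 0)) = 1) → ∀ i, p i (u, 0) ≠ 0 := fun u hu i h => by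
    have := hu i
    rw [h, map_zero] at this
    exact zero_ne_one this
  have hlam : ∀ᶠ u in 𝓝 (0 : State n), ∀ i, S.lam i u = s i (u, 0) := by
    filter_upwards [hE', hmono, hℓp, S.eventually_mem_Ω] with u h1 h2 h3 h4
    have hr := S.lam_strictMono u h4
    have : (fun i => S.lam i u) = fun i => s i (u, 0) := by
      -- Two increasing families with the same range are equal, and each range is the set of all
      -- eigenvalues of Df(u).
      rw [← hr.range_inj h2]
      apply Subset.antisymm
      · rintro _ ⟨i, rfl⟩
        obtain ⟨m, hm, -⟩ := exists_eq_smul_of_eigenvectors (by simp)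
          (fderiv ℝ S.f u : State n →ₗ[ℝ] State n) h2.injective (hpne u h3) h1
          (S.r_ne_zero h4 i) (S.eigen u h4 i)
        exact ⟨m, hm.symm⟩
      · rintro _ ⟨i, rfl⟩
        obtain ⟨m, hm, -⟩ := exists_eq_smul_of_eigenvectors (by simp)
          (fderiv ℝ S.f u : State n →ₗ[ℝ] State n) hr.injective (S.r_ne_zero h4)
          (S.eigen u h4) (hpne u h3 i) (h1 i)
        exact ⟨m, hm.symm⟩
    exact fun i => congrFun this i
  have hcurz : Tendsto (fun z : State n × ℝ => z.1 + z.2 • p j z) (𝓝 0) (𝓝 0) := by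
    have : ContinuousAt (fun z : State n × ℝ => z.1 + z.2 • p j z) 0 :=
      continuousAt_fst.add (continuousAt_snd.smul (hp j).continuousAt)
    simpa [ContinuousAt] using this
  refine ⟨⟨LinearMap.toContinuousLinearMap (b.coord j), p j, s j, hp j, hs j, hp0 j, ?_,
    hlam.mono fun u hu => hu j, ?_, ?_⟩⟩
  · filter_upwards [hH j, hcurz.eventually hgf, continuousAt_fst.eventually hgf] with z h1 h2 h3
    rw [← h2, ← h3]; exact h1
  · filter_upwards [hE', hmono, hℓp, S.eventually_mem_Ω, hlam] with u h1 h2 h3 h4 h5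
    obtain ⟨m, hm, c, hc⟩ := exists_eq_smul_of_eigenvectors (by simp)
      (fderiv ℝ S.f u : State n →ₗ[ℝ] State n) h2.injective (hpne u h3) h1
      (S.r_ne_zero h4 j) (S.eigen u h4 j)
    rw [h5 j] at hm
    obtain rfl := h2.injective hm
    have : LinearMap.toContinuousLinearMap (b.coord j) (S.r j u) = c := by
      rw [hc, map_smul]; simp [h3 j]
    rw [this]; exact hc
  · obtain ⟨r, hr, hu⟩ := hU j
    obtain ⟨d, hd, hball⟩ := Metric.eventually_nhds_iff.1 hgf
    refine ⟨min r (d / 2), by positivity, fun u v σ h1 h2 h3 h4 => ?_⟩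
    simp only [lt_min_iff] at h1 h2 h3
    refine hu u v σ h1.1 h2.1 h3.1 ?_
    rw [hball (y := v) ?_, hball (y := u) ?_, h4]
    · simpa using h1.2.trans (by linarith)
    · rw [dist_zero_right]
      calc ‖v‖ = ‖(v - u) + u‖ := by simp
        _ ≤ ‖v - u‖ + ‖u‖ := norm_add_le _ _
        _ < d := by linarith

namespace HugoniotData

variable {S} {j : Fin n}

/-- Near 0 the eigenvalue is the speed of the Hugoniot locus at τ = 0. -/
theorem contDiffAt_lam (H : S.HugoniotData j) : ContDiffAt ℝ 2 (S.lam j) 0 := by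
  have h1 : ContDiffAt ℝ 2 (fun u : State n => H.s (u, 0)) 0 :=
    ContDiffAt.comp (0 : State n) (g := H.s) H.contDiffAt_s (by fun_prop)
  exact h1.congr_of_eventuallyEq H.lam_eq

theorem ell_r_zero (H : S.HugoniotData j) : H.ell (S.r j 0) = 1 := by
  rw [← H.p_zero]; exact H.hugoniot.self_of_nhds.1

/-- The eigenvector is a multiple of the smooth p(u, 0), and the normalization determines the
factor. In the genuinely nonlinear case it is k / (∇λ · p), which costs one of the two derivatives
of λ; in the degenerate case it is ±1 / ‖p‖, with the sign fixed by the continuity of `r`. -/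
theorem contDiffAt_r (H : S.HugoniotData j) : ContDiffAt ℝ 1 (S.r j) 0 := by
  have hp : ContDiffAt ℝ 2 (fun u : State n => H.p (u, 0)) 0 :=
    ContDiffAt.comp (0 : State n) (g := H.p) H.contDiffAt_p (by fun_prop)
  have hp1 : ContDiffAt ℝ 1 (fun u : State n => H.p (u, 0)) 0 := hp.of_le (by norm_num)
  have hp0 : H.p ((0 : State n), (0 : ℝ)) = S.r j 0 := H.p_zero
  by_cases hj : S.GNL j
  · have hD : ContDiffAt ℝ 1 (fun u => fderiv ℝ (S.lam j) u (H.p (u, 0))) 0 :=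
      (H.contDiffAt_lam.fderiv_right (by norm_num)).clm_apply hp1
    have hD0 : fderiv ℝ (S.lam j) 0 (H.p (0, 0)) ≠ 0 := by
      rw [hp0, S.fderiv_lam_of_gnl hj S.zero_mem]; exact (S.k_pos j).ne'
    have h2 : ContDiffAt ℝ 1
        (fun u => (S.k j / fderiv ℝ (S.lam j) u (H.p (u, 0))) • H.p (u, 0)) 0 :=
      (contDiffAt_const.div hD hD0).smul hp1
    refine h2.congr_of_eventuallyEq ?_
    filter_upwards [H.r_eq, S.eventually_mem_Ω] with u h3 h4
    have h5 := S.fderiv_lam_of_gnl hj h4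
    rw [h3, map_smul, smul_eq_mul] at h5
    have h6 : fderiv ℝ (S.lam j) u (H.p (u, 0)) ≠ 0 := fun h => by
      rw [h, mul_zero] at h5; exact (S.k_pos j).ne h5
    rw [← h5, mul_div_cancel_right₀ _ h6, ← h3]
  · have hpn : ContDiffAt ℝ 1 (fun u : State n => ‖H.p (u, 0)‖⁻¹ • H.p (u, 0)) 0 := by
      have hne : H.p ((0 : State n), (0 : ℝ)) ≠ 0 := by
        rw [hp0]; exact S.r_ne_zero S.zero_mem j
      exact ((hp1.norm ℝ hne).inv (norm_ne_zero_iff.2 hne)).smul hp1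
    refine hpn.congr_of_eventuallyEq ?_
    have hpos : ∀ᶠ u in 𝓝 (0 : State n), 0 < H.ell (S.r j u) := by
      have hc : ContinuousAt (fun u => H.ell (S.r j u)) 0 :=
        H.ell.continuous.continuousAt.comp (S.continuous_r j).self_of_nhds
      exact hc.eventually_const_lt (by simp only [H.ell_r_zero]; exact one_pos)
    filter_upwards [H.r_eq, S.eventually_mem_Ω, hpos] with u h3 h4 h5
    have h6 := (S.linearlyDegenerate_of_not_gnl hj h4).2
    rw [h3, norm_smul, Real.norm_eq_abs, abs_of_pos h5] at h6
    have h7 : H.ell (S.r j u) = ‖H.p (u, 0)‖⁻¹ := eq_inv_of_mul_eq_one_left h6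
    rw [← h7, ← h3]

end HugoniotData
end HyperbolicSystem
end

/-! ### Rarefaction curves and genuinely nonlinear shock curves -/

noncomputable section

theorem exists_radius_of_eventually {E : Type} [NormedAddCommGroup E] {P : E × ℝ → Prop}
    (h : ∀ᶠ y in 𝓝 0, P y) : ∃ d > 0, ∀ u σ, ‖u‖ < d → |σ| < d → P (u, σ) := by
  obtain ⟨d, hd, hP⟩ := Metric.eventually_nhds_iff.1 h
  refine ⟨d, hd, fun u σ hu hσ => hP ?_⟩
  rw [dist_zero_right, Prod.norm_def, max_lt_iff]
  exact ⟨hu, hσ⟩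

/-- The derivative at the origin of `(σ, u) ↦ T(σ)(u)` if `T(0) = id` and `T(σ)(0)` has the tangent
vector `e`. -/
def curveDeriv {E : Type} [NormedAddCommGroup E] [NormedSpace ℝ E] (e : E) : ℝ × E →L[ℝ] E :=
  ContinuousLinearMap.snd ℝ ℝ E + (ContinuousLinearMap.fst ℝ ℝ E).smulRight e

namespace HyperbolicSystem

variable {n : ℕ} (S : HyperbolicSystem n)

/-- The rarefaction curves form a local flow. -/
theorem exists_rarefaction_flow (j : Fin n) :
    ∃ Φ : ℝ × State n → State n, ∃ ρ₀ > 0, HasStrictFDerivAt Φ (curveDeriv (S.r j 0)) 0 ∧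
      (∀ u, ‖u‖ < ρ₀ → Φ (0, u) = u) ∧
      (∀ u, ‖u‖ < ρ₀ → ∀ σ, |σ| < ρ₀ → Φ (σ, u) ∈ S.Ω ∧
        HasDerivAt (fun s => Φ (s, u)) (S.r j (Φ (σ, u))) σ) ∧
      (∀ ρ u σ, 0 < ρ → ρ < ρ₀ → ‖u‖ < ρ₀ → |σ| ≤ ρ → S.rarefaction ρ j σ u = Φ (σ, u)) ∧
      (∀ u σ σ', ‖u‖ < ρ₀ → |σ| < ρ₀ → |σ'| < ρ₀ → Φ (σ, Φ (σ', u)) = Φ (σ + σ', u)) := by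
  obtain ⟨H⟩ := S.nonempty_hugoniotData j
  obtain ⟨Φ, ρ₁, hρ₁, hd, h0, hs, hu, hadd⟩ := exists_localFlow H.contDiffAt_r
  have hΦ0 : Φ (0, 0) = 0 := h0 0 (by simpa using hρ₁)
  have hΩ : ∀ᶠ y : ℝ × State n in 𝓝 (0, 0), Φ y ∈ S.Ω := by
    have : Tendsto Φ (𝓝 (0, 0)) (𝓝 0) := by
      have := hd.continuousAt.tendsto; rwa [hΦ0] at this
    exact this.eventually S.eventually_mem_Ω
  obtain ⟨ρ₂, hρ₂, hΩ'⟩ := Metric.eventually_nhds_iff.1 hΩ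
  have hmem : ∀ u, ‖u‖ < ρ₂ → ∀ σ, |σ| < ρ₂ → Φ (σ, u) ∈ S.Ω := fun u hu σ hσ =>
    hΩ' (by rw [Prod.dist_eq]; simpa using ⟨hσ, hu⟩)
  refine ⟨Φ, min ρ₁ ρ₂, by positivity, hd, fun u h => h0 u (lt_min_iff.1 h).1,
    fun u h σ hσ => ⟨hmem u (lt_min_iff.1 h).2 σ (lt_min_iff.1 hσ).2,
      hs u (lt_min_iff.1 h).1 σ (lt_min_iff.1 hσ).1⟩, ?_, fun u σ σ' h hσ hσ' =>
      hadd u σ σ' (lt_min_iff.1 h).1 (lt_min_iff.1 hσ).1 (lt_min_iff.1 hσ').1⟩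
  intro ρ u σ hρ hρ' hu' hσ
  rw [lt_min_iff] at hρ' hu'
  -- The flow shows that a curve exists; uniqueness then identifies the curve that `rarefaction`
  -- chooses with the flow.
  have hex : ∃ γ, S.IsRarefactionCurve ρ j u γ := by
    refine ⟨fun s => Φ (s, u), h0 u hu'.1, fun s hs' => ?_⟩
    have hs1 := abs_le.2 hs'
    exact ⟨hmem u hu'.2 s (hs1.trans_lt hρ'.2),
      (hs u hu'.1 s (hs1.trans_lt hρ'.1)).hasDerivWithinAt⟩
  rw [rarefaction, dif_pos hex]
  exact hu u ρ _ hu'.1 hρ hρ'.1 hex.choose_spec.1 (fun s hs' => (hex.choose_spec.2 s hs').2) σ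
    (abs_le.1 hσ)

-- The definition of `shock` picks some shock curve, so its values are known only once all shock
-- curves through `u` agree on the whole parameter interval.
variable {S} in
theorem shock_eq_of_unique {ρ : ℝ} {j : Fin n} {u : State n} {γ : ℝ → State n}
    (hγ : S.IsShockCurve ρ j u γ)
    (huniq : ∀ γ', S.IsShockCurve ρ j u γ' → ∀ σ ∈ Icc (-ρ) ρ, γ' σ = γ σ) {σ : ℝ}
    (hσ : |σ| ≤ ρ) : S.shock ρ j σ u = γ σ := by
  have hex : ∃ γ, S.IsShockCurve ρ j u γ := ⟨γ, hγ⟩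
  rw [shock, dif_pos hex]
  exact huniq _ hex.choose_spec σ (abs_le.1 hσ)

/-- The shock curves of a genuinely nonlinear field. -/
theorem exists_shock_of_gnl {j : Fin n} (hj : S.GNL j) :
    ∃ Ψ : ℝ × State n → State n, ∃ ρ₀ > 0, HasStrictFDerivAt Ψ (curveDeriv (S.r j 0)) 0 ∧
      (∀ ρ u σ, 0 < ρ → ρ < ρ₀ → ‖u‖ < ρ₀ → |σ| ≤ ρ → S.shock ρ j σ u = Ψ (σ, u)) := by
  obtain ⟨H⟩ := S.nonempty_hugoniotData j
  have hk := (S.k_pos j).ne'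
  set Γ : State n × ℝ → State n := fun z => z.1 + z.2 • H.p z with hΓ
  have hΓ0 : Γ 0 = 0 := by simp [hΓ]
  have hΓc : ContDiffAt ℝ 2 Γ 0 := contDiffAt_fst.add (contDiffAt_snd.smul H.contDiffAt_p)
  have hΓd : HasFDerivAt Γ (ContinuousLinearMap.fst ℝ (State n) ℝ +
      (ContinuousLinearMap.snd ℝ (State n) ℝ).smulRight (S.r j 0)) 0 := by
    have h1 := (hasFDerivAt_snd (𝕜 := ℝ) (E := State n) (F := ℝ) (p := 0)).smul
      (H.contDiffAt_p.differentiableAt (by norm_num)).hasFDerivAt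
    refine (hasFDerivAt_fst.add h1).congr_fderiv ?_
    simp [H.p_zero]
  have hlamc : ContDiffAt ℝ 2 (S.lam j) (Γ 0) := by rw [hΓ0]; exact H.contDiffAt_lam
  -- The change of parameter from the abscissa τ to the increment of λ_j divided by k_j. By the
  -- normalization ∇λ_j · r_j = k_j its derivative at 0 is the identity, so it has a local inverse
  -- Θ.
  set G : State n × ℝ → State n × ℝ := fun z => (z.1, (S.lam j (Γ z) - S.lam j z.1) / S.k j)
    with hG
  have hG0 : G 0 = 0 := by simp [hG, hΓ0]
  have hGc : ContDiffAt ℝ 2 G 0 := by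
    have h1 : ContDiffAt ℝ 2 (fun z => S.lam j (Γ z)) 0 := hlamc.comp 0 hΓc
    have h2 : ContDiffAt ℝ 2 (fun z : State n × ℝ => S.lam j z.1) 0 :=
      ContDiffAt.comp (0 : State n × ℝ) (g := S.lam j) H.contDiffAt_lam contDiffAt_fst
    exact contDiffAt_fst.prodMk ((h1.sub h2).div_const _)
  have hGd : HasFDerivAt G (ContinuousLinearEquiv.refl ℝ (State n × ℝ) : _ →L[ℝ] _) 0 := by
    have h0 : HasFDerivAt (S.lam j) (fderiv ℝ (S.lam j) 0) 0 :=
      (H.contDiffAt_lam.differentiableAt (by norm_num)).hasFDerivAt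
    have h1 : HasFDerivAt (fun z => S.lam j (Γ z)) _ 0 :=
      HasFDerivAt.comp (g := S.lam j) (f := Γ) 0 (by rw [hΓ0]; exact h0) hΓd
    have h2 : HasFDerivAt (fun z : State n × ℝ => S.lam j z.1) _ 0 :=
      HasFDerivAt.comp (g := S.lam j) (f := Prod.fst) (0 : State n × ℝ) h0 hasFDerivAt_fst
    have h3 := (h1.sub h2).const_mul (S.k j)⁻¹
    have h4 : HasFDerivAt G _ 0 := (hasFDerivAt_fst (𝕜 := ℝ) (E := State n) (F := ℝ)
      (p := 0)).prodMk (h3.congr_of_eventuallyEq (Eventually.of_forall fun z => by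
        simp only [Pi.sub_apply]; ring))
    refine h4.congr_fderiv ?_
    ext x
    all_goals simp [S.fderiv_lam_of_gnl hj S.zero_mem, hk]
  have h2ne : (2 : WithTop ℕ∞) ≠ 0 := by norm_num
  set Θ := hGc.localInverse hGd h2ne with hΘ
  have hGs := hGc.hasStrictFDerivAt' hGd h2ne
  have hΘc : ContDiffAt ℝ 2 Θ 0 := by
    have := hGc.to_localInverse hGd h2ne
    rwa [hG0] at this
  have hΘd : HasStrictFDerivAt Θ (ContinuousLinearEquiv.refl ℝ (State n × ℝ) : _ →L[ℝ] _) 0 := by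
    have := hGs.to_localInverse
    rwa [hG0] at this
  have hΘG : ∀ᶠ z in 𝓝 0, Θ (G z) = z := hGs.eventually_left_inverse
  have hGΘ : ∀ᶠ y in 𝓝 0, G (Θ y) = y := by
    have := hGs.eventually_right_inverse
    rwa [hG0] at this
  have hΘ0 : Θ 0 = 0 := by
    have := hΘG.self_of_nhds; rwa [hG0] at this
  have hΘt : Tendsto Θ (𝓝 0) (𝓝 0) := by
    have := hΘc.continuousAt.tendsto; rwa [hΘ0] at this
  have hΓΘc : ContDiffAt ℝ 2 (fun y => Γ (Θ y)) 0 :=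
    ContDiffAt.comp (0 : State n × ℝ) (g := Γ) (by rw [hΘ0]; exact hΓc) hΘc
  have hsΘc : ContDiffAt ℝ 2 (fun y => H.s (Θ y)) 0 :=
    ContDiffAt.comp (0 : State n × ℝ) (g := H.s) (by rw [hΘ0]; exact H.contDiffAt_s) hΘc
  have hfst : Tendsto (Prod.fst : State n × ℝ → State n) (𝓝 0) (𝓝 0) := continuousAt_fst
  obtain ⟨d₂, hd₂, hinv⟩ := exists_radius_of_eventually hΘG
  obtain ⟨r, hr, huniq, hrd⟩ : ∃ r > 0, (∀ u v σ, ‖u‖ < r → ‖v - u‖ < r →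
      |σ - S.lam j 0| < r → S.f v - S.f u = σ • (v - u) →
      v = u + H.ell (v - u) • H.p (u, H.ell (v - u)) ∧ (v ≠ u → σ = H.s (u, H.ell (v - u)))) ∧
      ∀ x, ‖x‖ < r → |H.ell x| < d₂ := by
    obtain ⟨r, hr, huniq⟩ := H.unique
    refine ⟨min r (d₂ / (‖H.ell‖ + 1)), by positivity, fun u v σ h1 h2 h3 =>
      huniq u v σ (lt_min_iff.1 h1).1 (lt_min_iff.1 h2).1 (lt_min_iff.1 h3).1, fun x hx => ?_⟩
    have h1 := (lt_min_iff.1 hx).2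
    rw [lt_div_iff₀ (by positivity)] at h1
    have h2 := H.ell.le_opNorm x
    rw [Real.norm_eq_abs] at h2
    nlinarith [norm_nonneg x]
  have hs0 : H.s 0 = S.lam j 0 := H.lam_eq.self_of_nhds.symm
  -- conditions near the origin
  have ev1 : ∀ᶠ y in 𝓝 (0 : State n × ℝ), G (Θ y) = y ∧ (H.ell (H.p (Θ y)) = 1 ∧
      S.f (Γ (Θ y)) - S.f (Θ y).1 = (H.s (Θ y) * (Θ y).2) • H.p (Θ y)) ∧ Γ (Θ y) ∈ S.Ω := by
    refine hGΘ.and ((hΘt.eventually H.hugoniot).and ?_)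
    have : Tendsto (fun y => Γ (Θ y)) (𝓝 0) (𝓝 0) := by
      have := hΓΘc.continuousAt.tendsto; rwa [hΘ0, hΓ0] at this
    exact this.eventually S.eventually_mem_Ω
  have ev2 : ∀ᶠ y in 𝓝 (0 : State n × ℝ), ContDiffAt ℝ 2 (fun y => Γ (Θ y)) y ∧
      ContDiffAt ℝ 2 (fun y => H.s (Θ y)) y ∧ ContDiffAt ℝ 2 Θ y ∧ ContDiffAt ℝ 2 H.p y ∧
      ContDiffAt ℝ 2 (S.lam j) y.1 := by
    refine (hΓΘc.eventually (by norm_num)).and ((hsΘc.eventually (by norm_num)).and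
      ((hΘc.eventually (by norm_num)).and ((H.contDiffAt_p.eventually (by norm_num)).and ?_)))
    exact continuousAt_fst.eventually (H.contDiffAt_lam.eventually (by norm_num))
  have ev3 : ∀ᶠ y in 𝓝 (0 : State n × ℝ), ‖Γ (Θ y) - y.1‖ < r / 2 ∧
      |H.s (Θ y) - S.lam j 0| < r / 2 := by
    refine Eventually.and ?_ ?_
    · have h1 : ContinuousAt (fun y : State n × ℝ => ‖Γ (Θ y) - y.1‖) 0 :=
        (hΓΘc.continuousAt.sub continuousAt_fst).norm
      exact h1.eventually_lt_const (by simp only [hΘ0, hΓ0]; simpa using hr)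
    · have h1 : ContinuousAt (fun y : State n × ℝ => |H.s (Θ y) - S.lam j 0|) 0 :=
        (hsΘc.continuousAt.sub continuousAt_const).abs
      exact h1.eventually_lt_const (by simp only [hΘ0, hs0]; simpa using hr)
  have ev4 : ∀ᶠ y in 𝓝 (0 : State n × ℝ), S.lam j y.1 = H.s (y.1, 0) ∧
      S.r j y.1 = H.ell (S.r j y.1) • H.p (y.1, 0) ∧ y.1 ∈ S.Ω :=
    hfst.eventually (H.lam_eq.and (H.r_eq.and S.eventually_mem_Ω))
  obtain ⟨d₁, hd₁, hloc⟩ := exists_radius_of_eventually (ev1.and (ev2.and (ev3.and ev4)))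
  have hΨd : HasStrictFDerivAt (fun q : ℝ × State n => Γ (Θ (q.2, q.1))) (curveDeriv (S.r j 0))
      0 := by
    have h1 : ContDiffAt ℝ 2 (fun q : ℝ × State n => Γ (Θ (q.2, q.1))) 0 :=
      ContDiffAt.comp (0 : ℝ × State n) (g := fun y => Γ (Θ y)) hΓΘc (by fun_prop)
    refine h1.hasStrictFDerivAt' ?_ h2ne
    have h2 : HasFDerivAt (fun y => Γ (Θ y)) _ 0 :=
      HasFDerivAt.comp (g := Γ) (f := Θ) 0 (by rw [hΘ0]; exact hΓd) hΘd.hasFDerivAt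
    have h3 : HasFDerivAt (fun q : ℝ × State n => (q.2, q.1)) _ 0 :=
      (hasFDerivAt_snd (𝕜 := ℝ) (p := (0 : ℝ × State n))).prodMk hasFDerivAt_fst
    have h4 := HasFDerivAt.comp (g := fun y => Γ (Θ y)) (f := fun q : ℝ × State n => (q.2, q.1))
      0 h2 h3
    refine h4.congr_fderiv ?_
    ext x <;> simp [curveDeriv]
  refine ⟨fun q => Γ (Θ (q.2, q.1)), min d₁ (min d₂ r), by positivity, hΨd, ?_⟩
  intro ρ u σ hρ hρ' hu hσ
  simp only [lt_min_iff] at hρ' hu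
  have hσd : ∀ σ ∈ Icc (-ρ) ρ, |σ| < d₁ := fun σ h => (abs_le.2 h).trans_lt hρ'.1
  have hfst' : ∀ σ ∈ Icc (-ρ) ρ, (Θ (u, σ)).1 = u := fun σ h =>
    congrArg Prod.fst (hloc u σ hu.1 (hσd σ h)).1.1
  have hlamΓ : ∀ σ ∈ Icc (-ρ) ρ, S.lam j (Γ (Θ (u, σ))) = S.lam j u + S.k j * σ := fun σ h => by
    have h1 := congrArg Prod.snd (hloc u σ hu.1 (hσd σ h)).1.1
    simp only [hG, hfst' σ h] at h1
    rw [div_eq_iff hk] at h1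
    linarith
  have hΘu0 : Θ (u, 0) = (u, 0) := by
    have h1 : G (u, 0) = (u, 0) := by simp [hG, hΓ]
    have h2 := hinv u 0 hu.2.1 (by simpa using hd₂)
    rwa [h1] at h2
  have h0mem : (0 : ℝ) ∈ Icc (-ρ) ρ := ⟨by linarith, hρ.le⟩
  obtain ⟨-, ⟨hc1, hc2, hc3, hc4, hc5⟩, -, hlam0, hr0, hu0⟩ :=
    hloc u 0 hu.1 (by simpa using hd₁)
  have hIcc : Icc (-ρ) ρ ∈ 𝓝 (0 : ℝ) := Icc_mem_nhds (by linarith) hρ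
  have hinc : ContDiff ℝ 2 fun σ : ℝ => (u, σ) := by fun_prop
  refine shock_eq_of_unique (γ := fun σ => Γ (Θ (u, σ))) ⟨?_, ?_, ?_, ?_, ?_, ?_, ?_⟩ ?_ hσ
  · simp [hΘu0, hΓ]
  · intro σ h
    have h1 := (hloc u σ hu.1 (hσd σ h)).2.1.1
    have h2 : ContDiffAt ℝ 2 (fun σ => Γ (Θ (u, σ))) σ :=
      ContDiffAt.comp σ (g := fun y => Γ (Θ y)) h1 hinc.contDiffAt
    exact (h2.of_le (by norm_num)).contDiffWithinAt
  · -- the tangent vector at the initial point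
    have hT : HasDerivAt (fun σ => (Θ (u, σ)).2) (deriv (fun σ => (Θ (u, σ)).2) 0) 0 := by
      have h2 : ContDiffAt ℝ 2 (fun σ => Θ (u, σ)) 0 :=
        ContDiffAt.comp (0 : ℝ) (g := Θ) hc3 hinc.contDiffAt
      exact (h2.snd.differentiableAt (by norm_num)).hasDerivAt
    set c := deriv (fun σ => (Θ (u, σ)).2) 0 with hc
    have hpd : DifferentiableAt ℝ (fun τ : ℝ => H.p (u, τ)) 0 := by
      have h2 : ContDiffAt ℝ 2 (fun τ => H.p (u, τ)) 0 :=
        ContDiffAt.comp (0 : ℝ) (g := H.p) hc4 hinc.contDiffAt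
      exact h2.differentiableAt (by norm_num)
    have hγ : HasDerivAt (fun τ : ℝ => u + τ • H.p (u, τ)) (H.p (u, 0)) 0 := by
      have h2 := ((hasDerivAt_id (0 : ℝ)).smul hpd.hasDerivAt).const_add u
      simpa using h2
    have hγ' : HasDerivAt (fun σ => u + (Θ (u, σ)).2 • H.p (u, (Θ (u, σ)).2))
        (c • H.p (u, 0)) 0 := by
      have h2 : (Θ (u, 0)).2 = 0 := by rw [hΘu0]
      exact HasDerivAt.scomp (g₁ := fun τ : ℝ => u + τ • H.p (u, τ)) (0 : ℝ)
        (by rw [h2]; exact hγ) hT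
    have hγ'' : HasDerivAt (fun σ => Γ (Θ (u, σ))) (c • H.p (u, 0)) 0 := by
      refine hγ'.congr_of_eventuallyEq ?_
      filter_upwards [hIcc] with σ h
      have h1 := hfst' σ h
      have h2 : Θ (u, σ) = (u, (Θ (u, σ)).2) := Prod.ext h1 rfl
      rw [h2]
    convert! hγ'' using 1
    -- The tangent is c p(u, 0) and r_j(u) is a multiple of p(u, 0) as well. Since ∇λ_j maps both to
    -- k_j, they are equal.
    have hl : HasDerivAt (fun σ => S.lam j (Γ (Θ (u, σ))))
        (fderiv ℝ (S.lam j) u (c • H.p (u, 0))) 0 := by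
      have h3 : HasFDerivAt (S.lam j) (fderiv ℝ (S.lam j) u) (Γ (Θ (u, 0))) := by
        have : Γ (Θ (u, 0)) = u := by simp [hΘu0, hΓ]
        rw [this]
        exact (hc5.differentiableAt (by norm_num)).hasFDerivAt
      exact h3.comp_hasDerivAt (0 : ℝ) hγ''
    have hl' : HasDerivAt (fun σ => S.lam j (Γ (Θ (u, σ)))) (S.k j) 0 := by
      have h3 : HasDerivAt (fun σ : ℝ => S.lam j u + S.k j * σ) (S.k j) 0 := by
        simpa using ((hasDerivAt_id (0 : ℝ)).const_mul (S.k j)).const_add (S.lam j u)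
      refine h3.congr_of_eventuallyEq ?_
      filter_upwards [hIcc] with σ h using hlamΓ σ h
    have h5 := hl.unique hl'
    have h6 := S.fderiv_lam_of_gnl hj hu0
    rw [hr0] at h6 ⊢
    rw [map_smul, smul_eq_mul] at h5 h6
    have h7 : fderiv ℝ (S.lam j) u (H.p (u, 0)) ≠ 0 := fun h => by
      rw [h, mul_zero] at h5; exact hk h5.symm
    rw [mul_right_cancel₀ h7 (h6.trans h5.symm)]
  · exact fun σ h => (hloc u σ hu.1 (hσd σ h)).1.2.2
  · refine ⟨fun σ => H.s (Θ (u, σ)), fun σ h => ?_, ?_, fun σ h => ?_⟩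
    · have h1 := (hloc u σ hu.1 (hσd σ h)).2.1.2.1
      have h2 : ContDiffAt ℝ 2 (fun σ => H.s (Θ (u, σ))) σ :=
        ContDiffAt.comp σ (g := fun y => H.s (Θ y)) h1 hinc.contDiffAt
      exact h2.continuousAt.continuousWithinAt
    · simp only [hΘu0]; exact hlam0.symm
    · have h1 := (hloc u σ hu.1 (hσd σ h)).1.2.1.2
      rw [hfst' σ h] at h1
      rw [h1]
      have h2 : Γ (Θ (u, σ)) - u = (Θ (u, σ)).2 • H.p (Θ (u, σ)) := by
        simp only [hΓ, hfst' σ h]; abel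
      rw [h2, smul_smul]
  · exact fun _ => hlamΓ
  · exact fun h => absurd hj h
  · rintro γ ⟨g0, gC, -, -, ⟨s, hsc, hs0', hRH⟩, glam, -⟩
    have glam := glam hj
    have gcont : ContinuousOn (fun σ => max ‖γ σ - u‖ |s σ - S.lam j 0|) (Icc (-ρ) ρ) :=
      ((gC.continuousOn.sub continuousOn_const).norm).sup ((hsc.sub continuousOn_const).abs)
    -- As long as the state and the speed of a competing curve are within `r`, local uniqueness puts
    -- it on the constructed curve, and there the distance is even below `r / 2`. Controlling the
    -- speed excludes branches that belong to other families.
    have hpt : ∀ σ ∈ Icc (-ρ) ρ, max ‖γ σ - u‖ |s σ - S.lam j 0| < r →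
        γ σ = Γ (Θ (u, σ)) ∧ max ‖γ σ - u‖ |s σ - S.lam j 0| < r / 2 := by
      intro σ h hlt
      rw [max_lt_iff] at hlt
      obtain ⟨h1, h2⟩ := huniq u (γ σ) (s σ) hu.2.2 hlt.1 hlt.2 (hRH σ h)
      set τ := H.ell (γ σ - u) with hτ
      have h3 : G (u, τ) = (u, σ) := by
        simp only [hG, hΓ, ← h1, glam σ h]
        rw [add_sub_cancel_left, mul_div_cancel_left₀ _ hk]
      have h4 : Θ (u, σ) = (u, τ) := by
        rw [← h3]; exact hinv u τ hu.2.1 (hrd _ hlt.1)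
      have h5 : γ σ = Γ (Θ (u, σ)) := by rw [h4]; exact h1
      obtain ⟨-, -, ⟨h6, h7⟩, -⟩ := hloc u σ hu.1 (hσd σ h)
      refine ⟨h5, max_lt (by rw [h5]; exact h6) ?_⟩
      have h8 : s σ = H.s (Θ (u, σ)) := by
        -- A zero jump does not determine its speed. By the parametrization with λ_j it occurs only
        -- at σ = 0, where the speed is prescribed.
        by_cases hγu : γ σ = u
        · have h9 := glam σ h
          rw [hγu] at h9
          have h10 : σ = 0 := by
            have : S.k j * σ = 0 := by linarith
            exact (mul_eq_zero.1 this).resolve_left hk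
          rw [h10, hs0', hΘu0]; exact hlam0
        · rw [h4]; exact h2 hγu
      rw [h8]; exact h7
    -- The distance starts at or below `r / 2` and cannot take the value `3 * r / 4`, so by the
    -- intermediate value theorem it never reaches `r`.
    have hall : ∀ σ ∈ Icc (-ρ) ρ, max ‖γ σ - u‖ |s σ - S.lam j 0| < r := by
      by_contra hcon
      push Not at hcon
      obtain ⟨σ, hσ', hge⟩ := hcon
      have hstart : max ‖γ 0 - u‖ |s 0 - S.lam j 0| ≤ r / 2 := by
        have h6 := (hloc u 0 hu.1 (by simpa using hd₁)).2.2.1.2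
        rw [hΘu0, ← hlam0] at h6
        rw [g0, hs0', sub_self, norm_zero]
        exact max_le (by positivity) h6.le
      obtain ⟨σ', hσ'', heq⟩ := isPreconnected_Icc.intermediate_value h0mem hσ' gcont
        (show 3 * r / 4 ∈ Icc _ _ from ⟨by linarith, by linarith⟩)
      have := (hpt σ' hσ'' (by simp only at heq; linarith)).2
      simp only at heq
      linarith
    exact fun σ h => (hpt σ h (hall σ h)).1

end HyperbolicSystem
end

/-! ### Linearly degenerate shock curves, parametrized by arc length -/

noncomputable section

section ArcLength

variable {E : Type} [NormedAddCommGroup E] [NormedSpace ℝ E]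

theorem hasDerivAt_integral_norm {E : Type} [NormedAddCommGroup E] {D : ℝ → E} {d : ℝ} (hD : ContinuousOn D (Ioo (-d) d)) {τ : ℝ}
    (hτ : |τ| < d) : HasDerivAt (fun τ => ∫ t in (0 : ℝ)..τ, ‖D t‖) ‖D τ‖ τ := by
  have hτ' := abs_lt.1 hτ
  have hd : 0 < d := (abs_nonneg _).trans_lt hτ
  have hsub : uIcc 0 τ ⊆ Ioo (-d) d := by
    intro x hx
    exact (convex_Ioo (-d) d).ordConnected.uIcc_subset ⟨by linarith, hd⟩ hτ' hx
  exact intervalIntegral.integral_hasDerivAt_right (hD.norm.mono hsub).intervalIntegrable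
    (hD.norm.stronglyMeasurableAtFilter isOpen_Ioo _ hτ')
    (hD.norm.continuousAt (isOpen_Ioo.mem_nhds hτ'))

/-- A curve parametrized by arc length that moves along the graph `Γ` over the line: its abscissa
is determined by the arc length of `Γ`. -/
theorem integral_norm_eq_of_arcLength {Γ D : ℝ → E} {d : ℝ}
    (hΓ : ∀ τ, |τ| < d → HasDerivAt Γ (D τ) τ) (hD : ContinuousOn D (Ioo (-d) d))
    (ℓ : E →L[ℝ] ℝ) {γ : ℝ → E} {ρ t : ℝ} (ht : t ≤ ρ)
    (hγ : ContDiffOn ℝ 1 γ (Icc (-ρ) ρ)) {e : E} (hγ0 : HasDerivAt γ e 0) (he : 0 < ℓ e)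
    (hγ1 : ∀ σ ∈ Icc (-ρ) ρ, ‖derivWithin γ (Icc (-ρ) ρ) σ‖ = 1)
    (hγΓ : ∀ σ ∈ Icc (-t) t, |ℓ (γ σ - γ 0)| < d ∧ γ σ = Γ (ℓ (γ σ - γ 0))) :
    ∀ σ ∈ Icc (-t) t, ∫ x in (0 : ℝ)..ℓ (γ σ - γ 0), ‖D x‖ = σ := by
  intro σ₀ hσ₀
  have ht0 : 0 ≤ t := by linarith [hσ₀.1, hσ₀.2]
  rcases ht0.eq_or_lt with rfl | ht0
  · have : σ₀ = 0 := by
      have := hσ₀.1; have := hσ₀.2; simp at *; linarith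
    subst this; simp
  set τ : ℝ → ℝ := fun σ => ℓ (γ σ - γ 0) with hτ
  have hsub : Icc (-t) t ⊆ Icc (-ρ) ρ := Icc_subset_Icc (by linarith) ht
  have hIoo : Ioo (-t) t ⊆ Icc (-ρ) ρ := Ioo_subset_Icc_self.trans hsub
  have hnhds : ∀ σ ∈ Ioo (-t) t, Icc (-ρ) ρ ∈ 𝓝 σ := fun σ hσ =>
    Icc_mem_nhds (by linarith [hσ.1]) (by linarith [hσ.2])
  have hγd : ∀ σ ∈ Ioo (-t) t, HasDerivAt γ (derivWithin γ (Icc (-ρ) ρ) σ) σ := fun σ hσ =>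
    ((hγ.differentiableOn (by norm_num) σ (hIoo hσ)).hasDerivWithinAt).hasDerivAt (hnhds σ hσ)
  have hτd : ∀ σ ∈ Ioo (-t) t, HasDerivAt τ (ℓ (derivWithin γ (Icc (-ρ) ρ) σ)) σ := fun σ hσ =>
    ℓ.hasFDerivAt.comp_hasDerivAt σ ((hγd σ hσ).sub_const _)
  have heq : ∀ σ ∈ Ioo (-t) t, derivWithin γ (Icc (-ρ) ρ) σ =
      ℓ (derivWithin γ (Icc (-ρ) ρ) σ) • D (τ σ) := fun σ hσ => by
    have h1 : HasDerivAt (fun σ => Γ (τ σ)) (ℓ (derivWithin γ (Icc (-ρ) ρ) σ) • D (τ σ)) σ :=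
      HasDerivAt.scomp (g₁ := Γ) σ (hΓ _ (hγΓ σ (Ioo_subset_Icc_self hσ)).1) (hτd σ hσ)
    refine (hγd σ hσ).unique (h1.congr_of_eventuallyEq ?_)
    filter_upwards [isOpen_Ioo.mem_nhds hσ] with s hs
    exact (hγΓ s (Ioo_subset_Icc_self hs)).2
  have h0mem : (0 : ℝ) ∈ Ioo (-t) t := ⟨by linarith, ht0⟩
  have hcont : ContinuousOn (fun σ => ℓ (derivWithin γ (Icc (-ρ) ρ) σ)) (Ioo (-t) t) := by
    have h1 : ContinuousOn (derivWithin γ (Icc (-ρ) ρ)) (Icc (-ρ) ρ) :=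
      ((contDiffOn_one_iff_derivWithin (uniqueDiffOn_Icc (by linarith))).1 hγ).2
    exact ℓ.continuous.comp_continuousOn (h1.mono hIoo)
  have hunit : ∀ σ ∈ Ioo (-t) t, |ℓ (derivWithin γ (Icc (-ρ) ρ) σ)| * ‖D (τ σ)‖ = 1 :=
    fun σ hσ => by
      rw [← Real.norm_eq_abs, ← norm_smul, ← heq σ hσ]; exact hγ1 σ (hIoo hσ)
  -- Unit speed prevents the derivative of the abscissa from vanishing, so it keeps the positive
  -- sign it has at 0 and the curve never turns back.
  have hpos : ∀ σ ∈ Ioo (-t) t, 0 < ℓ (derivWithin γ (Icc (-ρ) ρ) σ) := by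
    intro σ hσ
    by_contra hneg
    have h1 : 0 < ℓ (derivWithin γ (Icc (-ρ) ρ) 0) := by
      rw [(hγd 0 h0mem).unique hγ0]; exact he
    obtain ⟨σ', hσ', h2⟩ := isPreconnected_Ioo.intermediate_value hσ h0mem hcont
      (show (0 : ℝ) ∈ Icc _ _ from ⟨not_lt.1 hneg, h1.le⟩)
    have h3 := hunit σ' hσ'
    simp only at h2
    rw [h2] at h3
    simp at h3
  set M : ℝ → ℝ := fun x => ∫ s in (0 : ℝ)..x, ‖D s‖ with hM
  -- The signed arc length of the graph up to the abscissa therefore grows at rate 1, as σ does.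
  have hMd : ∀ σ ∈ Ioo (-t) t, HasDerivAt (fun σ => M (τ σ)) 1 σ := fun σ hσ => by
    have h1 := (hasDerivAt_integral_norm hD (hγΓ σ (Ioo_subset_Icc_self hσ)).1).comp σ (hτd σ hσ)
    convert! h1 using 1
    have := hunit σ hσ
    rw [abs_of_pos (hpos σ hσ), mul_comm] at this
    exact this.symm
  have hMc : ContinuousOn (fun σ => M (τ σ)) (Icc (-t) t) := by
    intro σ hσ
    have h1 : ContinuousAt M (τ σ) := (hasDerivAt_integral_norm hD (hγΓ σ hσ).1).continuousAt
    have h2 : ContinuousOn τ (Icc (-t) t) :=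
      ℓ.continuous.comp_continuousOn ((hγ.continuousOn.mono hsub).sub continuousOn_const)
    exact h1.comp_continuousWithinAt (h2 σ hσ)
  have hM0 : M (τ 0) = 0 := by simp [hM, hτ]
  change M (τ σ₀) = σ₀
  rcases lt_trichotomy σ₀ 0 with h | h | h
  · obtain ⟨c, -, hc⟩ := exists_hasDerivAt_eq_slope (fun σ => M (τ σ)) (fun _ => 1) h
      (hMc.mono fun x hx => ⟨hσ₀.1.trans hx.1, by linarith [hx.2]⟩)
      fun x hx => hMd x ⟨by linarith [hσ₀.1, hx.1], by linarith [hx.2]⟩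
    rw [hM0, eq_div_iff (by linarith)] at hc
    linarith
  · rw [h, hM0]
  · obtain ⟨c, -, hc⟩ := exists_hasDerivAt_eq_slope (fun σ => M (τ σ)) (fun _ => 1) h
      (hMc.mono fun x hx => ⟨by linarith [hx.1], hx.2.trans hσ₀.2⟩)
      fun x hx => hMd x ⟨by linarith [hx.1], by linarith [hσ₀.2, hx.2]⟩
    rw [hM0, eq_div_iff (by linarith)] at hc
    linarith

end ArcLength

namespace HyperbolicSystem

variable {n : ℕ} (S : HyperbolicSystem n)

/-- The shock curves of a linearly degenerate field are its rarefaction curves. -/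
theorem shock_eq_rarefaction_flow {j : Fin n} (hj : ¬ S.GNL j) {Φ : ℝ × State n → State n}
    {ρ₁ : ℝ} (hρ₁ : 0 < ρ₁) (hΦ : ContinuousAt Φ 0) (hΦ0 : ∀ u, ‖u‖ < ρ₁ → Φ (0, u) = u)
    (hΦd : ∀ u, ‖u‖ < ρ₁ → ∀ σ, |σ| < ρ₁ → Φ (σ, u) ∈ S.Ω ∧
        HasDerivAt (fun s => Φ (s, u)) (S.r j (Φ (σ, u))) σ) :
    ∃ ρ₀ > 0, ∀ ρ u σ, 0 < ρ → ρ < ρ₀ → ‖u‖ < ρ₀ → |σ| ≤ ρ → S.shock ρ j σ u = Φ (σ, u) := by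
  obtain ⟨H⟩ := S.nonempty_hugoniotData j
  set Γ : State n × ℝ → State n := fun z => z.1 + z.2 • H.p z with hΓ
  have hΓ0 : Γ 0 = 0 := by simp [hΓ]
  have hΓc : ContDiffAt ℝ 2 Γ 0 := contDiffAt_fst.add (contDiffAt_snd.smul H.contDiffAt_p)
  have hΦ00 : Φ 0 = 0 := hΦ0 0 (by simpa using hρ₁)
  have hΦt : Tendsto (fun y : State n × ℝ => Φ (y.2, y.1)) (𝓝 0) (𝓝 0) := by
    have h1 : Tendsto Φ (𝓝 0) (𝓝 0) := by
      have := hΦ.tendsto; rwa [hΦ00] at this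
    have h2 : Tendsto (fun y : State n × ℝ => (y.2, y.1)) (𝓝 0) (𝓝 (0 : ℝ × State n)) :=
      (continuous_snd.prodMk continuous_fst).tendsto 0
    exact h1.comp h2
  have hfst : Tendsto (Prod.fst : State n × ℝ → State n) (𝓝 0) (𝓝 0) := continuousAt_fst
  -- the graph of the Hugoniot curve
  have ev1 : ∀ᶠ z in 𝓝 (0 : State n × ℝ), ContDiffAt ℝ 2 Γ z ∧ H.ell (H.p z) = 1 :=
    (hΓc.eventually (by norm_num)).and (H.hugoniot.mono fun z hz => hz.1)
  obtain ⟨d, hd, hgraph⟩ := exists_radius_of_eventually ev1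
  set D : State n → ℝ → State n := fun u τ => fderiv ℝ Γ (u, τ) (0, 1) with hDdef
  have hΓD : ∀ u, ‖u‖ < d → ∀ τ, |τ| < d → HasDerivAt (fun τ => Γ (u, τ)) (D u τ) τ :=
    fun u hu τ hτ => by
      have h1 := ((hgraph u τ hu hτ).1.differentiableAt (by norm_num)).hasFDerivAt
      exact HasFDerivAt.comp_hasDerivAt (l := Γ) (f := fun τ => (u, τ)) τ h1
        ((hasDerivAt_const τ u).prodMk (hasDerivAt_id τ))
  have hDc : ∀ u, ‖u‖ < d → ContinuousOn (D u) (Ioo (-d) d) := fun u hu τ hτ => by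
    have h1 : ContinuousAt (fderiv ℝ Γ) (u, τ) :=
      ((hgraph u τ hu (abs_lt.2 hτ)).1.fderiv_right (m := 1) (by norm_num)).continuousAt
    have h2 : ContinuousAt (fun τ => fderiv ℝ Γ (u, τ)) τ :=
      ContinuousAt.comp (g := fderiv ℝ Γ) h1 (by fun_prop)
    exact (h2.clm_apply continuousAt_const).continuousWithinAt
  have hDpos : ∀ u, ‖u‖ < d → ∀ τ, |τ| < d → 0 < ‖D u τ‖ := fun u hu τ hτ => by
    rw [norm_pos_iff]
    intro h0
    have h1 : HasDerivAt (fun τ => H.ell (Γ (u, τ))) (H.ell (D u τ)) τ :=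
      H.ell.hasFDerivAt.comp_hasDerivAt τ (hΓD u hu τ hτ)
    have h2 : HasDerivAt (fun τ => H.ell u + τ) 1 τ := (hasDerivAt_id τ).const_add _
    have h3 : H.ell (D u τ) = 1 := by
      refine h1.unique (h2.congr_of_eventuallyEq ?_)
      filter_upwards [isOpen_Ioo.mem_nhds (abs_lt.1 hτ)] with x hx
      simp [hΓ, (hgraph u x hu (abs_lt.2 hx)).2]
    rw [h0, map_zero] at h3
    exact zero_ne_one h3
  -- The arc length of the graph is strictly increasing in the abscissa, hence determines it.
  have hMinj : ∀ u, ‖u‖ < d → ∀ τ τ', |τ| < d → |τ'| < d →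
      ∫ x in (0 : ℝ)..τ, ‖D u x‖ = ∫ x in (0 : ℝ)..τ', ‖D u x‖ → τ = τ' := by
    intro u hu τ τ' hτ hτ' h
    have hmono : StrictMonoOn (fun τ => ∫ x in (0 : ℝ)..τ, ‖D u x‖) (Ioo (-d) d) := by
      refine strictMonoOn_of_deriv_pos (convex_Ioo _ _) (fun x hx => ?_) fun x hx => ?_
      · exact (hasDerivAt_integral_norm (hDc u hu) (abs_lt.2 hx)).continuousAt.continuousWithinAt
      · rw [interior_Ioo] at hx
        rw [(hasDerivAt_integral_norm (hDc u hu) (abs_lt.2 hx)).deriv]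
        exact hDpos u hu x (abs_lt.2 hx)
    exact hmono.injOn (abs_lt.1 hτ) (abs_lt.1 hτ') h
  obtain ⟨r, hr, huniq, hrd⟩ : ∃ r > 0, (∀ u v σ, ‖u‖ < r → ‖v - u‖ < r →
      |σ - S.lam j 0| < r → S.f v - S.f u = σ • (v - u) →
      v = u + H.ell (v - u) • H.p (u, H.ell (v - u)) ∧ (v ≠ u → σ = H.s (u, H.ell (v - u)))) ∧
      ∀ x, ‖x‖ < r → |H.ell x| < d := by
    obtain ⟨r, hr, huniq⟩ := H.unique
    refine ⟨min r (d / (‖H.ell‖ + 1)), by positivity, fun u v σ h1 h2 h3 =>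
      huniq u v σ (lt_min_iff.1 h1).1 (lt_min_iff.1 h2).1 (lt_min_iff.1 h3).1, fun x hx => ?_⟩
    have h1 := (lt_min_iff.1 hx).2
    rw [lt_div_iff₀ (by positivity)] at h1
    have h2 := H.ell.le_opNorm x
    rw [Real.norm_eq_abs] at h2
    nlinarith [norm_nonneg x]
  -- conditions near the origin
  have ev2 : ∀ᶠ y in 𝓝 (0 : State n × ℝ), ContDiffAt ℝ 1 (S.r j) (Φ (y.2, y.1)) ∧
      ContDiffAt ℝ 2 (S.lam j) (Φ (y.2, y.1)) ∧ ‖Φ (y.2, y.1) - y.1‖ < r / 2 ∧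
      |S.lam j y.1 - S.lam j 0| < r / 2 ∧ 0 < H.ell (S.r j y.1) ∧ y.1 ∈ S.Ω := by
    refine (hΦt.eventually (H.contDiffAt_r.eventually (by norm_num))).and
      ((hΦt.eventually (H.contDiffAt_lam.eventually (by norm_num))).and (Eventually.and ?_
        (Eventually.and ?_ (Eventually.and ?_ (hfst.eventually S.eventually_mem_Ω)))))
    · have h1 := (hΦt.sub hfst).norm
      simp only [sub_zero, norm_zero] at h1
      exact h1.eventually_lt_const (by positivity)
    · have h1 : Tendsto (fun u => |S.lam j u - S.lam j 0|) (𝓝 0) (𝓝 0) := by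
        simpa using (H.contDiffAt_lam.continuousAt.sub
          (continuousAt_const (y := S.lam j 0))).abs.tendsto
      exact (h1.comp hfst).eventually_lt_const (by positivity)
    · have h1 : Tendsto (fun u => H.ell (S.r j u)) (𝓝 0) (𝓝 1) := by
        rw [← H.ell_r_zero]
        exact (H.ell.continuous.continuousAt.comp H.contDiffAt_r.continuousAt).tendsto
      exact (h1.comp hfst).eventually_const_lt one_pos
  obtain ⟨d₂, hd₂, hloc⟩ := exists_radius_of_eventually ev2
  refine ⟨min (min d ρ₁) (min d₂ r), by positivity, ?_⟩
  intro ρ u σ hρ hρ' hu hσ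
  simp only [lt_min_iff] at hρ' hu
  obtain ⟨⟨hρd, hρρ⟩, hρd₂, hρr⟩ := hρ'
  obtain ⟨⟨hud, huρ⟩, hud₂, hur⟩ := hu
  have h0mem : (0 : ℝ) ∈ Icc (-ρ) ρ := ⟨by linarith, hρ.le⟩
  have hΦu : Φ (0, u) = u := hΦ0 u huρ
  obtain ⟨-, -, -, hlam0, hell, huΩ⟩ := hloc u 0 hud₂ (by simpa using hd₂)
  have hmem : ∀ s, |s| ≤ ρ → |s| < ρ₁ ∧ |s| < d₂ := fun s hs =>
    ⟨hs.trans_lt hρρ, hs.trans_lt hρd₂⟩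
  -- the eigenvalue is constant along the curve
  set m := min ρ₁ d₂ with hm
  have hm0 : 0 < m := lt_min hρ₁ hd₂
  have hρm : ρ < m := lt_min hρρ hρd₂
  have hIoo : ∀ s ∈ Ioo (-m) m, |s| < ρ₁ ∧ |s| < d₂ := fun s hs => lt_min_iff.1 (abs_lt.2 hs)
  have h0m : (0 : ℝ) ∈ Ioo (-m) m := ⟨by linarith, hm0⟩
  have hconst : ∀ s ∈ Ioo (-m) m, S.lam j (Φ (s, u)) = S.lam j u := by
    have h1 : ∀ s ∈ Ioo (-m) m, HasDerivAt (fun s => S.lam j (Φ (s, u))) 0 s := fun s hs => by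
      have h2 := ((hloc u s hud₂ (hIoo s hs).2).2.1.differentiableAt (by norm_num)).hasFDerivAt
      obtain ⟨h3, h4⟩ := hΦd u huρ s (hIoo s hs).1
      have h5 := h2.comp_hasDerivAt s h4
      rwa [(S.linearlyDegenerate_of_not_gnl hj h3).1] at h5
    intro s hs
    have h2 := isOpen_Ioo.is_const_of_deriv_eq_zero isPreconnected_Ioo
      (fun s hs => (h1 s hs).differentiableAt.differentiableWithinAt)
      (fun s hs => (h1 s hs).deriv) hs h0m
    simpa [hΦu] using h2
  -- Along the integral curve f - λ_j(u) id has derivative (λ_j - λ_j(u)) r_j = 0, so every state on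
  -- it is joined to `u` by a jump of speed λ_j(u).
  have hRH : ∀ s ∈ Ioo (-m) m, S.f (Φ (s, u)) - S.f u = S.lam j u • (Φ (s, u) - u) := by
    have h1 : ∀ s ∈ Ioo (-m) m,
        HasDerivAt (fun s => S.f (Φ (s, u)) - S.lam j u • Φ (s, u)) 0 s := fun s hs => by
      obtain ⟨h3, h4⟩ := hΦd u huρ s (hIoo s hs).1
      have h2 := ((S.contDiffOn_f.contDiffAt (S.isOpen_Ω.mem_nhds h3)).differentiableAt
        (by norm_num)).hasFDerivAt
      have h5 := (h2.comp_hasDerivAt s h4).sub (h4.const_smul (S.lam j u))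
      rw [S.eigen _ h3 j, hconst s hs, sub_self] at h5
      exact h5
    intro s hs
    have h2 := isOpen_Ioo.is_const_of_deriv_eq_zero isPreconnected_Ioo
      (fun s hs => (h1 s hs).differentiableAt.differentiableWithinAt)
      (fun s hs => (h1 s hs).deriv) hs h0m
    simp only [hΦu] at h2
    rw [smul_sub, sub_eq_sub_iff_sub_eq_sub]
    exact h2
  have hIccIoo : Icc (-ρ) ρ ⊆ Ioo (-m) m := fun s hs =>
    ⟨by linarith [hs.1], by linarith [hs.2]⟩
  have hud_on : UniqueDiffOn ℝ (Icc (-ρ) ρ) := uniqueDiffOn_Icc (by linarith)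
  have hder : ∀ s ∈ Icc (-ρ) ρ, derivWithin (fun s => Φ (s, u)) (Icc (-ρ) ρ) s =
      S.r j (Φ (s, u)) := fun s hs =>
    (hΦd u huρ s (hIoo s (hIccIoo hs)).1).2.hasDerivWithinAt.derivWithin (hud_on s hs)
  have hcurve : S.IsShockCurve ρ j u fun s => Φ (s, u) := by
    refine ⟨hΦu, ?_, ?_, fun s hs => (hΦd u huρ s (hIoo s (hIccIoo hs)).1).1,
      ⟨fun _ => S.lam j u, continuousOn_const, rfl, fun s hs => hRH s (hIccIoo hs)⟩,
      fun h => absurd h hj, fun _ s hs => ?_⟩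
    · rw [contDiffOn_one_iff_derivWithin hud_on]
      refine ⟨fun s hs => (hΦd u huρ s (hIoo s (hIccIoo hs)).1).2.differentiableAt.differentiableWithinAt,
        ContinuousOn.congr (fun s hs => ?_) hder⟩
      have h1 := (hloc u s hud₂ (hIoo s (hIccIoo hs)).2).1.continuousAt
      exact (ContinuousAt.comp (g := S.r j) (f := fun s => Φ (s, u)) h1
        (hΦd u huρ s (hIoo s (hIccIoo hs)).1).2.continuousAt).continuousWithinAt
    · have h1 := (hΦd u huρ 0 (by simpa using hρ₁)).2
      rwa [hΦu] at h1
    · rw [hder s hs]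
      exact (S.linearlyDegenerate_of_not_gnl hj (hΦd u huρ s (hIoo s (hIccIoo hs)).1).1).2
  -- all shock curves that stay close agree with it
  have hkey : ∀ γ, S.IsShockCurve ρ j u γ → ∀ s : ℝ → ℝ,
      (∀ σ ∈ Icc (-ρ) ρ, S.f (γ σ) - S.f u = s σ • (γ σ - u)) → ∀ t ≤ ρ,
      (∀ σ ∈ Icc (-t) t, ‖γ σ - u‖ < r ∧ |s σ - S.lam j 0| < r) →
      ∀ σ ∈ Icc (-t) t, |H.ell (γ σ - u)| < d ∧ γ σ = Γ (u, H.ell (γ σ - u)) ∧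
        (γ σ ≠ u → s σ = H.s (u, H.ell (γ σ - u))) ∧
        ∫ x in (0 : ℝ)..H.ell (γ σ - u), ‖D u x‖ = σ := by
    rintro γ ⟨g0, gC, gd, -, -, -, garc⟩ s gRH t ht hclose
    have hpt : ∀ σ ∈ Icc (-t) t, |H.ell (γ σ - u)| < d ∧ γ σ = Γ (u, H.ell (γ σ - u)) ∧
        (γ σ ≠ u → s σ = H.s (u, H.ell (γ σ - u))) := fun σ hσ => by
      obtain ⟨h1, h2⟩ := huniq u (γ σ) (s σ) hur (hclose σ hσ).1 (hclose σ hσ).2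
        (gRH σ ⟨by linarith [hσ.1], by linarith [hσ.2]⟩)
      exact ⟨hrd _ (hclose σ hσ).1, h1, h2⟩
    intro σ hσ
    obtain ⟨h1, h2, h3⟩ := hpt σ hσ
    refine ⟨h1, h2, h3, ?_⟩
    have := integral_norm_eq_of_arcLength (hΓD u hud) (hDc u hud) H.ell ht gC gd hell (garc hj)
      (fun σ hσ => by rw [g0]; exact ⟨(hpt σ hσ).1, (hpt σ hσ).2.1⟩) σ hσ
    rwa [g0] at this
  have hΦclose : ∀ σ ∈ Icc (-ρ) ρ, ‖Φ (σ, u) - u‖ < r / 2 := fun σ hσ =>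
    (hloc u σ hud₂ (hIoo σ (hIccIoo hσ)).2).2.2.1
  refine shock_eq_of_unique hcurve ?_ hσ
  intro γ hγ
  obtain ⟨g0, gC, gd, gΩ, ⟨s, hsc, hs0, gRH⟩, glam, garc⟩ := hγ
  have hγ : S.IsShockCurve ρ j u γ := ⟨g0, gC, gd, gΩ, ⟨s, hsc, hs0, gRH⟩, glam, garc⟩
  -- Both curves lie on the Hugoniot graph, at abscissas that correspond to the same arc length σ;
  -- these abscissas coincide, and with them states and speeds.
  have hagree : ∀ t ≤ ρ, (∀ σ ∈ Icc (-t) t, ‖γ σ - u‖ < r ∧ |s σ - S.lam j 0| < r) →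
      ∀ σ ∈ Icc (-t) t, γ σ = Φ (σ, u) ∧ s σ = S.lam j u := by
    intro t ht hclose σ hσ
    obtain ⟨a1, a2, a3, a4⟩ := hkey γ hγ s gRH t ht hclose σ hσ
    obtain ⟨b1, b2, b3, b4⟩ := hkey _ hcurve (fun _ => S.lam j u)
      (fun σ hσ => hRH σ (hIccIoo hσ)) t ht (fun σ hσ =>
        ⟨(hΦclose σ ⟨by linarith [hσ.1], by linarith [hσ.2]⟩).trans (by linarith),
          hlam0.trans (by linarith)⟩) σ hσ
    have hτ := hMinj u hud _ _ a1 b1 (a4.trans b4.symm)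
    have h1 : γ σ = Φ (σ, u) := by rw [a2, hτ, ← b2]
    refine ⟨h1, ?_⟩
    by_cases hγu : γ σ = u
    · have h2 : σ = 0 := by rw [← a4, hγu]; simp
      rw [h2, hs0]
    · rw [a3 hγu, hτ]
      exact (b3 (by rw [← h1]; exact hγu)).symm
  set φ : ℝ → ℝ := fun σ => max ‖γ σ - u‖ |s σ - S.lam j 0| with hφ
  have hφc : ContinuousOn φ (Icc (-ρ) ρ) :=
    ((gC.continuousOn.sub continuousOn_const).norm).sup ((hsc.sub continuousOn_const).abs)
  have hsymm : ∀ t, ∀ σ ∈ Icc (-t) t, (∀ x ∈ Icc 0 t, max (φ x) (φ (-x)) < r) → φ σ < r := by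
    intro t σ hσ h
    rcases le_total 0 σ with h1 | h1
    · exact (max_lt_iff.1 (h σ ⟨h1, hσ.2⟩)).1
    · have := (max_lt_iff.1 (h (-σ) ⟨by linarith, by linarith [hσ.1]⟩)).2
      rwa [neg_neg] at this
  -- Agreement at σ needs closeness on the whole interval from 0, since arc length is an integral.
  -- Hence continuous induction on symmetric intervals, in place of a pointwise intermediate value
  -- argument.
  have hboot : ∀ t ∈ Icc 0 ρ, max (φ t) (φ (-t)) < r := by
    refine lt_of_continuousOn_of_bootstrap (a := r / 2) (by linarith) ?_ ?_ ?_
    · refine ContinuousOn.sup (hφc.mono (Icc_subset_Icc (by linarith) le_rfl))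
        (hφc.comp continuousOn_neg fun x hx => ⟨by linarith [hx.2], by linarith [hx.1]⟩)
    · simp only [neg_zero, max_self, hφ, g0, hs0, sub_self, norm_zero]
      exact max_lt hr (hlam0.trans (by linarith))
    · intro t ht hlt
      have h1 := hagree t ht.2 fun σ hσ => max_lt_iff.1 (hsymm t σ hσ hlt)
      have h2 : ∀ σ ∈ Icc (-t) t, φ σ ≤ r / 2 := fun σ hσ => by
        obtain ⟨h3, h4⟩ := h1 σ hσ
        simp only [hφ, h3, h4]
        exact max_le (hΦclose σ ⟨by linarith [hσ.1, ht.2], by linarith [hσ.2, ht.2]⟩).le hlam0.le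
      exact max_le (h2 t ⟨by linarith [ht.1], le_rfl⟩) (h2 (-t) ⟨le_rfl, by linarith [ht.1]⟩)
  exact fun σ hσ => (hagree ρ le_rfl (fun σ hσ => max_lt_iff.1 (hsymm ρ σ hσ hboot)) σ hσ).1

end HyperbolicSystem
end

/-! ### Splicing and composing wave curves -/

noncomputable section

/-- Two functions of `(σ, u)` with the same strict derivative that agree at `σ = 0` can be spliced
along `σ = 0`. -/
theorem HasStrictFDerivAt.splice {E : Type} [NormedAddCommGroup E] [NormedSpace ℝ E]
    {Φ Ψ : ℝ × E → E} {L : ℝ × E →L[ℝ] E} (hΦ : HasStrictFDerivAt Φ L 0)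
    (hΨ : HasStrictFDerivAt Ψ L 0) (h0 : ∀ᶠ u in 𝓝 (0 : E), Φ (0, u) = Ψ (0, u)) :
    HasStrictFDerivAt (fun p => if 0 ≤ p.1 then Φ p else Ψ p) L 0 := by
  refine HasStrictFDerivAt.of_isLittleO (Asymptotics.isLittleO_iff.2 fun c hc => ?_)
  have h1 := Asymptotics.isLittleO_iff.1 hΦ.isLittleO hc
  have h2 := Asymptotics.isLittleO_iff.1 hΨ.isLittleO hc
  obtain ⟨d, hd, hball⟩ := Metric.eventually_nhds_iff.1 (h1.and h2)
  obtain ⟨d', hd', h0'⟩ := Metric.eventually_nhds_iff.1 h0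
  set B := Metric.ball (0 : ℝ × E) (min d d') with hB
  have hpair : ∀ p q : ℝ × E, p ∈ B → q ∈ B → ‖Φ p - Φ q - L (p - q)‖ ≤ c * ‖p - q‖ ∧
      ‖Ψ p - Ψ q - L (p - q)‖ ≤ c * ‖p - q‖ := fun p q hp hq => by
    refine hball (y := (p, q)) ?_
    rw [Prod.dist_eq]
    exact max_lt ((Metric.mem_ball.1 hp).trans_le (min_le_left _ _))
      ((Metric.mem_ball.1 hq).trans_le (min_le_left _ _))
  have hmix : ∀ p q : ℝ × E, p ∈ B → q ∈ B → 0 ≤ p.1 → q.1 < 0 →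
      ‖Φ p - Ψ q - L (p - q)‖ ≤ c * ‖p - q‖ := by
    intro p q hp hq hp1 hq1
    -- The segment from `q` to `p` crosses σ = 0 at `z`, where the two functions agree; the
    -- estimates on its two pieces add up because their lengths do.
    set t := -q.1 / (p.1 - q.1) with ht
    have hpq : 0 < p.1 - q.1 := by linarith
    have ht0 : 0 ≤ t := div_nonneg (by linarith) hpq.le
    have ht1 : t ≤ 1 := (div_le_one hpq).2 (by linarith)
    set z := q + t • (p - q) with hz
    have hzB : z ∈ B := (convex_ball (0 : ℝ × E) _).add_smul_sub_mem hq hp ⟨ht0, ht1⟩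
    have hz1 : z.1 = 0 := by
      simp only [hz, ht, Prod.fst_add, Prod.smul_fst, Prod.fst_sub, smul_eq_mul]
      field_simp
      ring
    have hΦΨ : Φ z = Ψ z := by
      have : z = (0, z.2) := Prod.ext hz1 rfl
      rw [this]
      refine h0' ?_
      rw [dist_zero_right]
      exact (norm_snd_le z).trans_lt
        ((mem_ball_zero_iff.1 hzB).trans_le (min_le_right _ _))
    have e1 : p - z = (1 - t) • (p - q) := by rw [hz, sub_smul, one_smul]; abel
    have e2 : z - q = t • (p - q) := by rw [hz]; abel
    calc ‖Φ p - Ψ q - L (p - q)‖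
        = ‖(Φ p - Φ z - L (p - z)) + (Ψ z - Ψ q - L (z - q))‖ := by
          rw [hΦΨ]; congr 1; simp only [map_sub]; abel
      _ ≤ c * ‖p - z‖ + c * ‖z - q‖ := (norm_add_le _ _).trans
          (add_le_add (hpair p z hp hzB).1 (hpair z q hzB hq).2)
      _ = c * ‖p - q‖ := by
          rw [e1, e2, norm_smul, norm_smul, Real.norm_eq_abs, Real.norm_eq_abs,
            abs_of_nonneg ht0, abs_of_nonneg (by linarith : 0 ≤ 1 - t)]
          ring
  have hev : ∀ᶠ p : (ℝ × E) × (ℝ × E) in 𝓝 (0, 0), p.1 ∈ B ∧ p.2 ∈ B := by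
    have h3 : ∀ᶠ p : ℝ × E in 𝓝 0, p ∈ B := Metric.ball_mem_nhds _ (lt_min hd hd')
    exact h3.prod_nhds h3
  filter_upwards [hev] with ⟨p, q⟩ ⟨hp, hq⟩
  by_cases hp1 : 0 ≤ p.1 <;> by_cases hq1 : 0 ≤ q.1
  · simpa only [hp1, hq1, if_true] using (hpair p q hp hq).1
  · simpa only [hp1, hq1, if_true, if_false] using hmix p q hp hq hp1 (not_le.1 hq1)
  · have h3 := hmix q p hq hp hq1 (not_le.1 hp1)
    simp only [hp1, hq1, if_true, if_false]
    rw [← norm_neg, norm_sub_rev p q]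
    convert! h3 using 2
    simp only [map_sub]; abel
  · simpa only [hp1, hq1, if_false] using (hpair p q hp hq).2

section Composition

variable {E : Type} [NormedAddCommGroup E] [NormedSpace ℝ E] {n : ℕ}

/-- The accumulator `A` is the composition reached so far. Every curve map has the derivative (σ, u)
↦ u + σ e, so by the chain rule each family just adds its tangent vector. -/
theorem hasStrictFDerivAt_foldl {T : Fin n → ℝ × E → E} {e : Fin n → E}
    (hT : ∀ j, HasStrictFDerivAt (T j) (curveDeriv (e j)) 0) (hT0 : ∀ j, T j 0 = 0)
    (l : List (Fin n)) :
    ∀ (A : E × (Fin n → ℝ) → E) (A' : E × (Fin n → ℝ) →L[ℝ] E), HasStrictFDerivAt A A' 0 →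
      A 0 = 0 → ∃ L : E × (Fin n → ℝ) →L[ℝ] E,
        HasStrictFDerivAt (fun q => l.foldl (fun v j => T j (q.2 j, v)) (A q)) L 0 ∧
        ∀ q, L q = A' q + (l.map fun j => q.2 j • e j).sum := by
  induction l with
  | nil => exact fun A A' hA _ => ⟨A', hA, fun q => by simp⟩
  | cons j l ih =>
    intro A A' hA hA0
    have h1 : HasStrictFDerivAt (fun q : E × (Fin n → ℝ) => q.2 j)
        ((ContinuousLinearMap.proj (R := ℝ) (φ := fun _ : Fin n => ℝ) j).comp
          (ContinuousLinearMap.snd ℝ E (Fin n → ℝ))) 0 :=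
      ((ContinuousLinearMap.proj (R := ℝ) (φ := fun _ : Fin n => ℝ) j).comp
          (ContinuousLinearMap.snd ℝ E (Fin n → ℝ))).hasStrictFDerivAt
    have h2 : HasStrictFDerivAt (fun q : E × (Fin n → ℝ) => T j (q.2 j, A q)) _ 0 :=
      HasStrictFDerivAt.comp (g := T j) (f := fun q : E × (Fin n → ℝ) => (q.2 j, A q)) 0
        (by
          have h3 : (((0 : E × (Fin n → ℝ)).2 j, A 0) : ℝ × E) = 0 := by rw [hA0]; rfl
          simp only [h3]; exact hT j) (h1.prodMk hA)
    obtain ⟨L, hL, hLq⟩ := ih _ _ h2 (by simp [hA0]; exact hT0 j)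
    refine ⟨L, hL, fun q => ?_⟩
    rw [hLq]
    simp [curveDeriv, add_assoc]

/-- The maps `T'` describe the curves only at small base points; continuity at 0 keeps all
intermediate states of the composition small. -/
theorem foldl_eq_foldl {E : Type} [NormedAddCommGroup E] {T : ℝ → Fin n → ℝ → E → E} {T' : Fin n → ℝ × E → E}
    (hT' : ∀ j, ContinuousAt (T' j) 0) (hT0 : ∀ j, T' j 0 = 0)
    (hT : ∀ j, ∃ ρ₀ > 0, ∀ ρ u σ, 0 < ρ → ρ < ρ₀ → ‖u‖ < ρ₀ → |σ| ≤ ρ → T ρ j σ u = T' j (σ, u))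
    (l : List (Fin n)) :
    ∃ ρ₀ > 0, ∀ ρ (u : E) (σ : Fin n → ℝ), 0 < ρ → ρ < ρ₀ → ‖u‖ < ρ₀ → (∀ i, |σ i| ≤ ρ) →
      l.foldl (fun v j => T ρ j (σ j) v) u = l.foldl (fun v j => T' j (σ j, v)) u := by
  induction l with
  | nil => exact ⟨1, one_pos, fun _ _ _ _ _ _ _ => rfl⟩
  | cons j l ih =>
    obtain ⟨ρ₁, hρ₁, h1⟩ := ih
    obtain ⟨ρ₂, hρ₂, h2⟩ := hT j
    obtain ⟨ρ₃, hρ₃, h3⟩ := Metric.continuousAt_iff.1 (hT' j) ρ₁ hρ₁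
    refine ⟨min ρ₁ (min ρ₂ ρ₃), by positivity, fun ρ u σ hρ hρ' hu hσ => ?_⟩
    simp only [lt_min_iff] at hρ' hu
    rw [List.foldl_cons, List.foldl_cons, h2 ρ u (σ j) hρ hρ'.2.1 hu.2.1 (hσ j)]
    refine h1 ρ _ σ hρ hρ'.1 ?_ hσ
    have h4 := @h3 (σ j, u) (by
      rw [dist_zero_right, Prod.norm_def, max_lt_iff]
      exact ⟨(hσ j).trans_lt hρ'.2.2, hu.2.2⟩)
    rwa [hT0, dist_zero_right] at h4

end Composition

namespace HyperbolicSystem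

variable {n : ℕ} (S : HyperbolicSystem n)

theorem shock_zero (ρ : ℝ) (j : Fin n) (u : State n) : S.shock ρ j 0 u = u := by
  unfold shock
  split_ifs with h
  · exact h.choose_spec.1
  · rfl

theorem rarefaction_zero (ρ : ℝ) (j : Fin n) (u : State n) : S.rarefaction ρ j 0 u = u := by
  unfold rarefaction
  split_ifs with h
  · exact h.choose_spec.1
  · rfl

theorem lax_zero (ρ : ℝ) (j : Fin n) (u : State n) : S.lax ρ j 0 u = u := by
  simp [lax, rarefaction_zero]

theorem foldl_eq_self {T : Fin n → State n → State n} (l : List (Fin n))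
    (h : ∀ j ∈ l, ∀ u, T j u = u) (u : State n) : l.foldl (fun v j => T j v) u = u := by
  induction l generalizing u with
  | nil => rfl
  | cons j l ih =>
    rw [List.foldl_cons, h j (by simp)]
    exact ih (fun i hi => h i (by simp [hi])) u

theorem shockMap_zero (ρ : ℝ) (u : State n) : S.shockMap ρ u 0 = u :=
  foldl_eq_self _ (fun j _ u => S.shock_zero ρ j u) u

theorem laxMap_zero (ρ : ℝ) (u : State n) : S.laxMap ρ u 0 = u :=
  foldl_eq_self _ (fun j _ u => S.lax_zero ρ j u) u

/-- The rarefaction and shock curves of one family near the origin, independently of the range of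
the parameter. -/
theorem exists_curves (j : Fin n) :
    ∃ Φ Ψ : ℝ × State n → State n, ∃ ρ₀ > 0, HasStrictFDerivAt Φ (curveDeriv (S.r j 0)) 0 ∧
      HasStrictFDerivAt Ψ (curveDeriv (S.r j 0)) 0 ∧
      (∀ u, ‖u‖ < ρ₀ → Φ (0, u) = u ∧ Ψ (0, u) = u) ∧
      (∀ ρ u σ, 0 < ρ → ρ < ρ₀ → ‖u‖ < ρ₀ → |σ| ≤ ρ →
        S.rarefaction ρ j σ u = Φ (σ, u) ∧ S.shock ρ j σ u = Ψ (σ, u)) ∧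
      (∀ u σ σ', ‖u‖ < ρ₀ → |σ| < ρ₀ → |σ'| < ρ₀ → Φ (σ, Φ (σ', u)) = Φ (σ + σ', u)) ∧
      (¬ S.GNL j → Ψ = Φ) := by
  obtain ⟨Φ, ρ₁, hρ₁, hΦ, hΦ0, hΦd, hΦr, hadd⟩ := S.exists_rarefaction_flow j
  have hex : ∃ Ψ : ℝ × State n → State n, ∃ ρ₂ > 0,
      HasStrictFDerivAt Ψ (curveDeriv (S.r j 0)) 0 ∧
      (∀ ρ u σ, 0 < ρ → ρ < ρ₂ → ‖u‖ < ρ₂ → |σ| ≤ ρ → S.shock ρ j σ u = Ψ (σ, u)) ∧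
      (¬ S.GNL j → Ψ = Φ) := by
    by_cases hj : S.GNL j
    · obtain ⟨Ψ, ρ₂, hρ₂, hΨ, hΨs⟩ := S.exists_shock_of_gnl hj
      exact ⟨Ψ, ρ₂, hρ₂, hΨ, hΨs, fun h => absurd hj h⟩
    · obtain ⟨ρ₂, hρ₂, h⟩ :=
        S.shock_eq_rarefaction_flow hj hρ₁ hΦ.continuousAt hΦ0 hΦd
      exact ⟨Φ, ρ₂, hρ₂, hΦ, h, fun _ => rfl⟩
  obtain ⟨Ψ, ρ₂, hρ₂, hΨ, hΨs, hLD⟩ := hex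
  refine ⟨Φ, Ψ, min ρ₁ ρ₂, by positivity, hΦ, hΨ, fun u hu => ⟨hΦ0 u (lt_min_iff.1 hu).1, ?_⟩,
    fun ρ u σ hρ hρ' hu hσ => ⟨hΦr ρ u σ hρ (lt_min_iff.1 hρ').1 (lt_min_iff.1 hu).1 hσ,
      hΨs ρ u σ hρ (lt_min_iff.1 hρ').2 (lt_min_iff.1 hu).2 hσ⟩, fun u σ σ' hu hσ hσ' =>
      hadd u σ σ' (lt_min_iff.1 hu).1 (lt_min_iff.1 hσ).1 (lt_min_iff.1 hσ').1, hLD⟩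
  rw [← hΨs (ρ₂ / 2) u 0 (by positivity) (by linarith) (lt_min_iff.1 hu).2 (by simp; positivity),
    shock_zero]

/-- The linear map `σ ↦ ∑ σ_j r_j(0)`. -/
theorem exists_linearEquiv_sum : ∃ B : (Fin n → ℝ) ≃L[ℝ] State n,
    ∀ σ, B σ = ((List.finRange n).map fun j => σ j • S.r j 0).sum := by
  have hli : LinearIndependent ℝ fun j => S.r j 0 :=
    Module.End.eigenvectors_linearIndependent' (fderiv ℝ S.f 0 : State n →ₗ[ℝ] State n)
      (fun i => S.lam i 0) (S.lam_strictMono 0 S.zero_mem).injective _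
      fun i => ⟨Module.End.mem_eigenspace_iff.2 (S.eigen 0 S.zero_mem i),
        S.r_ne_zero S.zero_mem i⟩
  have hinj : Function.Injective (Fintype.linearCombination ℝ fun j => S.r j 0) :=
    linearIndependent_iff_injective_fintypeLinearCombination.1 hli
  refine ⟨(LinearEquiv.ofInjectiveOfFinrankEq (Fintype.linearCombination ℝ fun j => S.r j 0)
    hinj (by simp)).toContinuousLinearEquiv, fun σ => ?_⟩
  change Fintype.linearCombination ℝ (fun j => S.r j 0) σ = _
  rw [Fintype.linearCombination_apply, ← List.sum_ofFn, List.ofFn_eq_map]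

end HyperbolicSystem
end

/-! ### Uniform estimates for the Riemann problem -/

noncomputable section

theorem exists_pos_forall_le {ι : Type} [Finite ι] {a : ι → ℝ} (ha : ∀ i, 0 < a i) :
    ∃ ρ > 0, ∀ i, ρ ≤ a i := by
  have h : ∀ᶠ ρ in 𝓝[>] (0 : ℝ), ∀ i, ρ ≤ a i :=
    eventually_all.2 fun i => (eventually_le_nhds (ha i)).filter_mono nhdsWithin_le_nhds
  obtain ⟨ρ, h1, h2⟩ := (h.and self_mem_nhdsWithin).exists
  exact ⟨ρ, h2, h1⟩

namespace HyperbolicSystem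

variable {n : ℕ} (S : HyperbolicSystem n)

/-- Quantitative properties of the wave curves near the origin, for wave sizes below `ρ`. -/
structure RiemannConstants (ρ r K : ℝ) : Prop where
  r_pos : 0 < r
  K_pos : 0 < K
  lax_lower : ∀ u, ‖u‖ < r → ∀ σ ∈ sizeBox n ρ, ∀ σ' ∈ sizeBox n ρ,
    ‖σ - σ'‖ ≤ K * ‖S.laxMap ρ u σ - S.laxMap ρ u σ'‖
  lax_upper : ∀ u, ‖u‖ < r → ∀ σ ∈ sizeBox n ρ, ∀ σ' ∈ sizeBox n ρ,
    ‖S.laxMap ρ u σ - S.laxMap ρ u σ'‖ ≤ K * ‖σ - σ'‖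
  shock_lower : ∀ u, ‖u‖ < r → ∀ σ ∈ sizeBox n ρ, ∀ σ' ∈ sizeBox n ρ,
    ‖σ - σ'‖ ≤ K * ‖S.shockMap ρ u σ - S.shockMap ρ u σ'‖
  shock_surj : ∀ u v, ‖u‖ < r → ‖v‖ < r → ∃ σ ∈ sizeBox n ρ, S.shockMap ρ u σ = v
  -- The base point is a state reached by the Lax map, because the state in front of a merged
  -- rarefaction is not itself known to lie in the ball of radius `r`.
  rarefaction_add : ∀ u, ‖u‖ < r → ∀ s ∈ sizeBox n ρ, ∀ j σ σ', 0 ≤ σ → 0 ≤ σ' → σ + σ' < ρ →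
    S.rarefaction ρ j σ (S.rarefaction ρ j σ' (S.laxMap ρ u s)) =
      S.rarefaction ρ j (σ + σ') (S.laxMap ρ u s)
  contact : ∀ j, ¬ S.GNL j → ∀ u, ‖u‖ < r → ∀ σ, |σ| < ρ →
    S.shock ρ j σ u = S.rarefaction ρ j σ u

/-- In σ the map differs from the isomorphism `B` by a Lipschitz map whose constant `c` is small
against 1 / ‖B⁻¹‖, so it is bi-Lipschitz. The constant is kept for the surjectivity argument that
also uses it. -/
theorem exists_bounds_of_hasStrictFDerivAt {E : Type} [NormedAddCommGroup E] [NormedSpace ℝ E]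
    {F : E × (Fin n → ℝ) → E} {L : E × (Fin n → ℝ) →L[ℝ] E} (hF : HasStrictFDerivAt F L 0)
    (B : (Fin n → ℝ) ≃L[ℝ] E) (hL : ∀ σ, L (0, σ) = B σ) :
    ∃ K > 0, ∃ d > 0, ∃ c : NNReal, (c : ℝ) * (2 * (‖(B.symm : E →L[ℝ] (Fin n → ℝ))‖ + 1)) ≤ 1 ∧
      ∀ u, ‖u‖ < d → ∀ σ σ', ‖σ‖ < d → ‖σ'‖ < d →
      ‖σ - σ'‖ ≤ K * ‖F (u, σ) - F (u, σ')‖ ∧ ‖F (u, σ) - F (u, σ')‖ ≤ K * ‖σ - σ'‖ ∧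
      ‖F (u, σ) - F (u, σ') - (B : (Fin n → ℝ) →L[ℝ] E) (σ - σ')‖ ≤ c * ‖σ - σ'‖ := by
  set b := ‖(B.symm : E →L[ℝ] (Fin n → ℝ))‖ with hb
  have hb0 : 0 ≤ b := norm_nonneg _
  set c : ℝ := (2 * (b + 1))⁻¹ with hc
  have hcpos : 0 < c := by positivity
  have hcb : c * (2 * (b + 1)) = 1 := inv_mul_cancel₀ (by positivity)
  obtain ⟨d, hd, hball⟩ := Metric.eventually_nhds_iff.1
    (Asymptotics.isLittleO_iff.1 hF.isLittleO hcpos)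
  refine ⟨2 * (b + 1) + (‖(B : (Fin n → ℝ) →L[ℝ] E)‖ + c), by positivity, d, hd, ⟨c, hcpos.le⟩,
    hcb.le, ?_⟩
  intro u hu σ σ' hσ hσ'
  have h1 : ‖F (u, σ) - F (u, σ') - (B : (Fin n → ℝ) →L[ℝ] E) (σ - σ')‖ ≤ c * ‖σ - σ'‖ := by
    have h2 := hball (y := ((u, σ), (u, σ'))) (by
      rw [Prod.dist_eq]
      simp only [dist_zero_right, Prod.norm_def, max_lt_iff]
      exact ⟨⟨hu, hσ⟩, hu, hσ'⟩)
    simp only [Prod.mk_sub_mk, sub_self, hL] at h2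
    simpa [Prod.norm_def] using h2
  set x := (B : (Fin n → ℝ) →L[ℝ] E) (σ - σ') with hx
  have h3 : ‖σ - σ'‖ ≤ b * ‖x‖ := by
    have : σ - σ' = (B.symm : E →L[ℝ] (Fin n → ℝ)) x := by simp [hx]
    calc ‖σ - σ'‖ = ‖(B.symm : E →L[ℝ] (Fin n → ℝ)) x‖ := by rw [← this]
      _ ≤ b * ‖x‖ := ContinuousLinearMap.le_opNorm _ _
  have h4 : ‖x‖ ≤ ‖F (u, σ) - F (u, σ')‖ + c * ‖σ - σ'‖ := by
    calc ‖x‖ = ‖(F (u, σ) - F (u, σ')) - (F (u, σ) - F (u, σ') - x)‖ := by congr 1; abel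
      _ ≤ _ := (norm_sub_le _ _).trans (by gcongr)
  have h5 : ‖x‖ ≤ ‖(B : (Fin n → ℝ) →L[ℝ] E)‖ * ‖σ - σ'‖ := ContinuousLinearMap.le_opNorm _ _
  have h6 : ‖F (u, σ) - F (u, σ')‖ ≤ ‖x‖ + c * ‖σ - σ'‖ := by
    calc ‖F (u, σ) - F (u, σ')‖ = ‖x + (F (u, σ) - F (u, σ') - x)‖ := by congr 1; abel
      _ ≤ _ := (norm_add_le _ _).trans (by gcongr)
  have hn := norm_nonneg (σ - σ')
  have hn' := norm_nonneg (F (u, σ) - F (u, σ'))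
  have hBn : 0 ≤ ‖(B : (Fin n → ℝ) →L[ℝ] E)‖ := norm_nonneg _
  refine ⟨?_, ?_, h1⟩
  · have h7 : ‖σ - σ'‖ ≤ 2 * (b + 1) * ‖F (u, σ) - F (u, σ')‖ := by
      have h8 : b * ‖x‖ ≤ (b + 1) * (‖F (u, σ) - F (u, σ')‖ + c * ‖σ - σ'‖) := by
        refine mul_le_mul (by linarith) h4 (norm_nonneg _) (by positivity)
      nlinarith
    refine h7.trans ?_
    gcongr
    linarith
  · refine h6.trans ?_
    have : 0 ≤ 2 * (b + 1) * ‖σ - σ'‖ := by positivity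
    nlinarith

/-- At the origin the Lax map and the shock map both have the σ-derivative ∑ σ_j r_j(0), an
isomorphism. The bound on ρ collects radii that do not depend on ρ; `r` is chosen afterwards. -/
theorem exists_riemannConstants :
    ∃ ρ₀ > 0, ∀ ρ, 0 < ρ → ρ < ρ₀ → ∃ r K, S.RiemannConstants ρ r K := by
  choose Φ Ψ ρ₁ hρ₁ hΦ hΨ h0 hloc hadd hLD using S.exists_curves
  have hΦ0 : ∀ j, Φ j 0 = 0 := fun j => (h0 j 0 (by simpa using hρ₁ j)).1
  have hΨ0 : ∀ j, Ψ j 0 = 0 := fun j => (h0 j 0 (by simpa using hρ₁ j)).2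
  set Λ : Fin n → ℝ × State n → State n := fun j p => if 0 ≤ p.1 then Φ j p else Ψ j p with hΛ
  have hΛd : ∀ j, HasStrictFDerivAt (Λ j) (curveDeriv (S.r j 0)) 0 := fun j => by
    refine (hΦ j).splice (hΨ j) ?_
    filter_upwards [Metric.ball_mem_nhds (0 : State n) (hρ₁ j)] with u hu
    have := h0 j u (by simpa using hu)
    rw [this.1, this.2]
  have hΛ0 : ∀ j, Λ j 0 = 0 := fun j => by simp [hΛ, hΦ0]
  obtain ⟨B, hB⟩ := S.exists_linearEquiv_sum
  have hfst : HasStrictFDerivAt (fun q : State n × (Fin n → ℝ) => q.1)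
    (ContinuousLinearMap.fst ℝ (State n) (Fin n → ℝ)) 0 := hasStrictFDerivAt_fst
  obtain ⟨L₁, hL₁, hL₁q⟩ := hasStrictFDerivAt_foldl hΛd hΛ0 (List.finRange n) _ _ hfst rfl
  obtain ⟨L₂, hL₂, hL₂q⟩ := hasStrictFDerivAt_foldl hΨ hΨ0 (List.finRange n) _ _ hfst rfl
  obtain ⟨K₁, hK₁, d₁, hd₁, c₁, -, hbd₁⟩ := exists_bounds_of_hasStrictFDerivAt hL₁ B
    fun σ => by rw [hL₁q, hB]; simp
  obtain ⟨K₂, hK₂, d₂, hd₂, c₂, hc₂, hbd₂⟩ := exists_bounds_of_hasStrictFDerivAt hL₂ B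
    fun σ => by rw [hL₂q, hB]; simp
  obtain ⟨ρ₂, hρ₂, hlax⟩ := foldl_eq_foldl (T := S.lax) (fun j => (hΛd j).continuousAt) hΛ0
    (fun j => ⟨ρ₁ j, hρ₁ j, fun ρ u σ hρ hρ' hu hσ => by
      obtain ⟨h1, h2⟩ := hloc j ρ u σ hρ hρ' hu hσ
      rw [lax, h1, h2]⟩) (List.finRange n)
  obtain ⟨ρ₃, hρ₃, hshock⟩ := foldl_eq_foldl (T := S.shock) (fun j => (hΨ j).continuousAt) hΨ0
    (fun j => ⟨ρ₁ j, hρ₁ j, fun ρ u σ hρ hρ' hu hσ => (hloc j ρ u σ hρ hρ' hu hσ).2⟩)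
    (List.finRange n)
  obtain ⟨ρ₄, hρ₄, hρ₄j⟩ := exists_pos_forall_le hρ₁
  -- Needed for the sum of two rarefactions: the state after the first one has to lie where the flow
  -- describes the second.
  obtain ⟨ρ₆, hρ₆, hρ₆j⟩ : ∃ ρ₆ > 0, ∀ j u σ, ‖u‖ < ρ₆ → |σ| < ρ₆ → ‖Φ j (σ, u)‖ < ρ₄ := by
    have h1 : ∀ j, ∃ d > 0, ∀ u σ, ‖u‖ < d → |σ| < d → ‖Φ j (σ, u)‖ < ρ₄ := fun j => by
      obtain ⟨d, hd, h2⟩ := Metric.continuousAt_iff.1 (hΦ j).continuousAt ρ₄ hρ₄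
      refine ⟨d, hd, fun u σ hu hσ => ?_⟩
      have h3 := @h2 (σ, u) (by
        rw [dist_zero_right, Prod.norm_def, max_lt_iff]; exact ⟨hσ, hu⟩)
      rwa [hΦ0, dist_zero_right] at h3
    choose d hd h2 using h1
    obtain ⟨ρ₆, h3, h4⟩ := exists_pos_forall_le hd
    exact ⟨ρ₆, h3, fun j u σ hu hσ => h2 j u σ (hu.trans_le (h4 j)) (hσ.trans_le (h4 j))⟩
  obtain ⟨ρ₅, hρ₅, hlaxsmall⟩ : ∃ ρ₅ > 0, ∀ (u : State n) (σ : Fin n → ℝ), ‖u‖ < ρ₅ → ‖σ‖ < ρ₅ →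
      ‖(List.finRange n).foldl (fun v j => Λ j (σ j, v)) u‖ < min ρ₄ ρ₆ := by
    obtain ⟨d, hd, h2⟩ := Metric.continuousAt_iff.1 hL₁.continuousAt (min ρ₄ ρ₆) (by positivity)
    refine ⟨d, hd, fun u σ hu hσ => ?_⟩
    have h3 := @h2 (u, σ) (by
      rw [dist_zero_right, Prod.norm_def, max_lt_iff]; exact ⟨hu, hσ⟩)
    have h4 : (List.finRange n).foldl (fun v j => Λ j ((0 : State n × (Fin n → ℝ)).2 j, v))
        (0 : State n × (Fin n → ℝ)).1 = 0 := by
      have : ∀ l : List (Fin n), l.foldl (fun v j => Λ j ((0 : ℝ), v)) (0 : State n) = 0 := by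
        intro l
        induction l with
        | nil => rfl
        | cons j l ih =>
          have h5 : Λ j (0, 0) = 0 := hΛ0 j
          rw [List.foldl_cons, h5, ih]
      exact this _
    rwa [h4, dist_zero_right] at h3
  have hbox : ∀ ρ, 0 < ρ → ∀ σ ∈ sizeBox n ρ, ‖σ‖ < ρ := fun ρ hρ σ hσ =>
    (pi_norm_lt_iff hρ).2 fun i => hσ i
  refine ⟨min (min d₁ d₂) (min (min ρ₂ ρ₃) (min ρ₄ (min ρ₅ ρ₆))), by positivity,
    fun ρ hρ hρ' => ?_⟩
  simp only [lt_min_iff] at hρ'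
  obtain ⟨⟨hρd₁, hρd₂⟩, ⟨hρ₂', hρ₃'⟩, hρ₄', hρ₅', hρ₆'⟩ := hρ'
  set b := ‖(B.symm : State n →L[ℝ] (Fin n → ℝ))‖ with hb
  have hb0 : 0 ≤ b := norm_nonneg _
  -- The last bound serves surjectivity: the image of the ball of radius ρ / 2 contains the ball of
  -- radius ρ / (4 (b + 1)) about `u`, and two states of norm below `r` are closer than that.
  set r := min (min (min d₁ d₂) (min (min ρ₂ ρ₃) (min ρ₄ (min ρ₅ ρ₆)))) (ρ / (8 * (b + 1))) with hr
  have hrpos : 0 < r := by positivity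
  have hru : ∀ u : State n, ‖u‖ < r → ((‖u‖ < d₁ ∧ ‖u‖ < d₂) ∧ (‖u‖ < ρ₂ ∧ ‖u‖ < ρ₃) ∧ ‖u‖ < ρ₄ ∧
      ‖u‖ < ρ₅ ∧ ‖u‖ < ρ₆) ∧ ‖u‖ < ρ / (8 * (b + 1)) := fun u hu => by
    simpa only [hr, lt_min_iff] using hu
  have hlaxeq : ∀ u, ‖u‖ < r → ∀ σ, (∀ i, |σ i| ≤ ρ) → S.laxMap ρ u σ =
      (List.finRange n).foldl (fun v j => Λ j (σ j, v)) u := fun u hu σ hσ =>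
    hlax ρ u σ hρ hρ₂' (hru u hu).1.2.1.1 hσ
  have hshockeq : ∀ u, ‖u‖ < r → ∀ σ, (∀ i, |σ i| ≤ ρ) → S.shockMap ρ u σ =
      (List.finRange n).foldl (fun v j => Ψ j (σ j, v)) u := fun u hu σ hσ =>
    hshock ρ u σ hρ hρ₃' (hru u hu).1.2.1.2 hσ
  refine ⟨r, K₁ + K₂, hrpos, by positivity, ?_, ?_, ?_, ?_, ?_, ?_⟩
  · intro u hu σ hσ σ' hσ'
    rw [hlaxeq u hu σ fun i => (hσ i).le, hlaxeq u hu σ' fun i => (hσ' i).le]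
    refine (hbd₁ u (hru u hu).1.1.1 σ σ' ((hbox ρ hρ σ hσ).trans hρd₁)
      ((hbox ρ hρ σ' hσ').trans hρd₁)).1.trans ?_
    gcongr; linarith
  · intro u hu σ hσ σ' hσ'
    rw [hlaxeq u hu σ fun i => (hσ i).le, hlaxeq u hu σ' fun i => (hσ' i).le]
    refine (hbd₁ u (hru u hu).1.1.1 σ σ' ((hbox ρ hρ σ hσ).trans hρd₁)
      ((hbox ρ hρ σ' hσ').trans hρd₁)).2.1.trans ?_
    gcongr; linarith
  · intro u hu σ hσ σ' hσ'
    rw [hshockeq u hu σ fun i => (hσ i).le, hshockeq u hu σ' fun i => (hσ' i).le]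
    refine (hbd₂ u (hru u hu).1.1.2 σ σ' ((hbox ρ hρ σ hσ).trans hρd₂)
      ((hbox ρ hρ σ' hσ').trans hρd₂)).1.trans ?_
    gcongr; linarith
  · intro u v hu hv
    set f : (Fin n → ℝ) → State n := fun σ =>
      (List.finRange n).foldl (fun v j => Ψ j (σ j, v)) u with hf
    have hin : ∀ σ ∈ Metric.closedBall (0 : Fin n → ℝ) (ρ / 2), ‖σ‖ < d₂ := fun σ hσ => by
      rw [mem_closedBall_zero_iff] at hσ; linarith
    have happ : ApproximatesLinearOn f (B : (Fin n → ℝ) →L[ℝ] State n)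
        (Metric.closedBall 0 (ρ / 2)) c₂ := by
      intro σ hσ σ' hσ'
      exact (hbd₂ u (hru u hu).1.1.2 σ σ' (hin σ hσ) (hin σ' hσ')).2.2
    let inv : (B : (Fin n → ℝ) →L[ℝ] State n).NonlinearRightInverse :=
      { toFun := B.symm
        nnnorm := ‖(B.symm : State n →L[ℝ] (Fin n → ℝ))‖₊ + 1
        bound' := fun y => by
          refine ((B.symm : State n →L[ℝ] (Fin n → ℝ)).le_opNorm y).trans ?_
          gcongr
          simp
        right_inv' := fun y => B.apply_symm_apply y }
    have hsurj := happ.surjOn_closedBall_of_nonlinearRightInverse inv (by positivity : 0 ≤ ρ / 2)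
      Subset.rfl
    have hf0 : f 0 = u := by
      have h1 := hshockeq u hu 0 (fun i => by simpa using hρ.le)
      rw [shockMap_zero] at h1
      exact h1.symm
    have hvm : v ∈ Metric.closedBall (f 0) (((inv.nnnorm : ℝ)⁻¹ - c₂) * (ρ / 2)) := by
      rw [hf0, mem_closedBall_iff_norm]
      have h1 : (inv.nnnorm : ℝ) = b + 1 := by simp [inv, hb]
      have h2 : (c₂ : ℝ) ≤ (b + 1)⁻¹ / 2 := by
        rw [le_div_iff₀ two_pos, ← one_div, le_div_iff₀ (by positivity)]
        linarith
      have h3 : ρ / (8 * (b + 1)) = (b + 1)⁻¹ * ρ / 8 := by field_simp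
      have h4 := (hru u hu).2
      have h5 := (hru v hv).2
      rw [h3] at h4 h5
      rw [h1]
      have h6 := norm_sub_le v u
      nlinarith
    obtain ⟨σ, hσ, hfσ⟩ := hsurj hvm
    rw [mem_closedBall_zero_iff] at hσ
    have hσ' : ∀ i, |σ i| < ρ := fun i =>
      ((norm_le_pi_norm σ i).trans hσ).trans_lt (by linarith)
    exact ⟨σ, hσ', (hshockeq u hu σ fun i => (hσ' i).le).trans hfσ⟩
  · intro u hu s hs j σ σ' hσ hσ' hsum
    have hw := hlaxsmall u s (hru u hu).1.2.2.2.1 ((hbox ρ hρ s hs).trans hρ₅')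
    rw [← hlaxeq u hu s fun i => (hs i).le, lt_min_iff] at hw
    set w := S.laxMap ρ u s
    have h1 : ∀ x : State n, ‖x‖ < ρ₄ → ∀ τ, |τ| ≤ ρ → S.rarefaction ρ j τ x = Φ j (τ, x) :=
      fun x hx τ hτ => (hloc j ρ x τ hρ (hρ₄'.trans_le (hρ₄j j)) (hx.trans_le (hρ₄j j)) hτ).1
    have hσa : |σ| ≤ ρ := by rw [abs_of_nonneg hσ]; linarith
    have hσ'a : |σ'| ≤ ρ := by rw [abs_of_nonneg hσ']; linarith
    rw [h1 w hw.1 σ' hσ'a, h1 _ (hρ₆j j w σ' hw.2 (hσ'a.trans_lt hρ₆')) σ hσa,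
      h1 w hw.1 (σ + σ') (by rw [abs_of_nonneg (by linarith)]; linarith)]
    exact hadd j w σ σ' (hw.1.trans_le (hρ₄j j)) (hσa.trans_lt (hρ₄'.trans_le (hρ₄j j)))
      (hσ'a.trans_lt (hρ₄'.trans_le (hρ₄j j)))
  · intro j hj u hu σ hσ
    obtain ⟨h1, h2⟩ := hloc j ρ u σ hρ (hρ₄'.trans_le (hρ₄j j))
      ((hru u hu).1.2.2.1.trans_le (hρ₄j j)) hσ.le
    rw [h1, h2, hLD j hj]

end HyperbolicSystem
end

/-! ### Piecewise constant functions and smallness in 𝒟* -/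

noncomputable section

namespace IsPiecewiseConst

variable {n : ℕ} {v : ℝ → State n}

theorem eventually_left (hv : IsPiecewiseConst v) (x : ℝ) :
    ∀ᶠ z in 𝓝[<] x, v z = Function.leftLim v x := by
  obtain ⟨F, hF⟩ := hv
  have h1 : ∀ᶠ y in 𝓝[<] x, ∀ z ∈ F, z < x → z < y := by
    rw [Finset.eventually_all]
    intro z _
    by_cases hz : z < x
    · exact ((eventually_gt_nhds hz).filter_mono nhdsWithin_le_nhds).mono fun y hy _ => hy
    · exact Eventually.of_forall fun y h => absurd h hz
  obtain ⟨y, hy, hyx⟩ := (h1.and self_mem_nhdsWithin).exists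
  have h2 : ∀ᶠ z in 𝓝[<] x, v z = v y := by
    filter_upwards [Ioo_mem_nhdsLT hyx] with z hz
    refine (hF y z hz.1.le fun p hp hpz => ?_).symm
    exact absurd (hy p hp (hpz.2.trans_lt hz.2)) (not_lt.2 hpz.1.le)
  have h3 : Function.leftLim v x = v y :=
    leftLim_eq_of_tendsto
      (tendsto_const_nhds.congr' (h2.mono fun z hz => hz.symm))
  rw [h3]; exact h2

theorem eventually_right (hv : IsPiecewiseConst v) (x : ℝ) : ∀ᶠ z in 𝓝[>] x, v z = v x := by
  obtain ⟨F, hF⟩ := hv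
  have h1 : ∀ᶠ y in 𝓝[>] x, ∀ z ∈ F, x < z → y < z := by
    rw [Finset.eventually_all]
    intro z _
    by_cases hz : x < z
    · exact ((eventually_lt_nhds hz).filter_mono nhdsWithin_le_nhds).mono fun y hy _ => hy
    · exact Eventually.of_forall fun y h => absurd h hz
  filter_upwards [h1, self_mem_nhdsWithin] with y hy hxy
  exact (hF x y (le_of_lt hxy) fun p hp hpz =>
    absurd (hy p hp hpz.1) (not_lt.2 hpz.2)).symm

theorem finite_jumpSet (hv : IsPiecewiseConst v) : (jumpSet v).Finite := by
  have hv' := hv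
  obtain ⟨F, hF⟩ := hv
  refine F.finite_toSet.subset fun x hx => ?_
  by_contra hxF
  have h1 : ∀ᶠ y in 𝓝[<] x, ∀ z ∈ F, z < x → z < y := by
    rw [Finset.eventually_all]
    intro z _
    by_cases hz : z < x
    · exact ((eventually_gt_nhds hz).filter_mono nhdsWithin_le_nhds).mono fun y hy _ => hy
    · exact Eventually.of_forall fun y h => absurd h hz
  obtain ⟨y, ⟨hy, hyx⟩, hyv⟩ :=
    ((h1.and self_mem_nhdsWithin).and (hv'.eventually_left x)).exists
  refine hx (hyv.symm.trans (hF y x (le_of_lt hyx) fun p hp hpx => ?_))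
  rcases hpx.2.lt_or_eq with h | h
  · exact absurd (hy p hp h) (not_lt.2 hpx.1.le)
  · exact hxF (by rw [← h]; exact hp)

/-- A piecewise constant function is constant on intervals without jumps. -/
theorem eq_of_no_jump (hv : IsPiecewiseConst v) {x y : ℝ} (hxy : x ≤ y)
    (h : ∀ z, x < z → z ≤ y → z ∉ jumpSet v) : v y = v x := by
  refine constant_of_has_deriv_right_zero (f := v) (a := x) (b := y) (fun z hz => ?_)
    (fun z _ => ?_) y (right_mem_Icc.2 hxy)
  · have hr : ContinuousWithinAt v (Ioi z) z :=
      tendsto_const_nhds.congr' ((hv.eventually_right z).mono fun _ h => h.symm)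
    have hr' : ContinuousWithinAt v (Ici z) z := continuousWithinAt_Ioi_iff_Ici.1 hr
    rcases hz.1.eq_or_lt with rfl | hxz
    · exact hr'.mono fun p hp => hp.1
    · have hl : ContinuousWithinAt v (Iio z) z := by
        have h1 : Function.leftLim v z = v z := not_not.1 (h z hxz hz.2)
        have h2 := hv.eventually_left z
        rw [h1] at h2
        exact tendsto_const_nhds.congr' (h2.mono fun _ h => h.symm)
      exact (continuousAt_iff_continuous_left'_right'.2 ⟨hl, hr⟩).continuousWithinAt
  · have h1 : v =ᶠ[𝓝[Ici z] z] fun _ => v z := by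
      rw [← Ioi_insert, nhdsWithin_insert]
      exact eventually_sup.2 ⟨by simp, hv.eventually_right z⟩
    exact (hasDerivWithinAt_const z (Ici z) (v z)).congr_of_eventuallyEq h1 rfl

theorem eventually_eq (hv : IsPiecewiseConst v) {x : ℝ} (hx : x ∉ jumpSet v) :
    ∀ᶠ y in 𝓝 x, v y = v x := by
  have h1 : Function.leftLim v x = v x := not_not.1 hx
  have h2 := hv.eventually_left x
  rw [h1] at h2
  rw [← nhdsLT_sup_nhdsGE, eventually_sup]
  refine ⟨h2, ?_⟩
  rw [← Ioi_insert, nhdsWithin_insert]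
  exact eventually_sup.2 ⟨by simp, hv.eventually_right x⟩

/-- A constant that is integrable on a half-line is 0. This anchors the bounds on `v` at -∞. -/
theorem eq_zero_of_no_jump (hv : IsPiecewiseConst v) (hint : Integrable v) {x : ℝ}
    (h : ∀ z, z ≤ x → z ∉ jumpSet v) : v x = 0 := by
  have h1 : ∀ z ∈ Iic x, v z = v x := fun z hz =>
    (hv.eq_of_no_jump hz fun p _ hp => h p hp).symm
  have h2 : IntegrableOn (fun _ => v x) (Iic x) :=
    hint.integrableOn.congr_fun h1 measurableSet_Iic
  rw [integrableOn_const_iff] at h2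
  simpa using h2

end IsPiecewiseConst

namespace HyperbolicSystem

variable {n : ℕ} {S : HyperbolicSystem n} {ρ r K C₀ δ : ℝ} {v : ℝ → State n}

theorem riemannSizes_spec {um up : State n}
    (h : ∃ σ ∈ sizeBox n ρ, S.laxMap ρ um σ = up) :
    S.riemannSizes ρ um up ∈ sizeBox n ρ ∧ S.laxMap ρ um (S.riemannSizes ρ um up) = up :=
  ⟨Function.invFunOn_mem h, Function.invFunOn_eq h⟩

theorem zero_mem_sizeBox (hρ : 0 < ρ) : (0 : Fin n → ℝ) ∈ sizeBox n ρ := fun i => by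
  simpa using hρ

theorem strength_spec (hρ : 0 < ρ) (hv : v ∈ S.Dstar ρ C₀ δ) (x : ℝ) :
    S.strength ρ v x ∈ sizeBox n ρ ∧
      S.laxMap ρ (Function.leftLim v x) (S.strength ρ v x) = v x := by
  refine riemannSizes_spec ?_
  by_cases hx : x ∈ jumpSet v
  · exact hv.2.2.2.1 x hx
  · exact ⟨0, zero_mem_sizeBox hρ, by rw [laxMap_zero]; exact not_not.1 hx⟩

/-- The sizes are a chosen preimage under the Lax map, so even where nothing jumps their vanishing
depends on injectivity, hence on small states. -/
theorem RiemannConstants.strength_eq_zero (R : S.RiemannConstants ρ r K) (hρ : 0 < ρ)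
    (hv : v ∈ S.Dstar ρ C₀ δ) {x : ℝ} (hx : x ∉ jumpSet v) (hr : ‖v x‖ < r) :
    S.strength ρ v x = 0 := by
  have h0 : Function.leftLim v x = v x := not_not.1 hx
  obtain ⟨h1, h2⟩ := strength_spec hρ hv x
  have h3 := R.lax_lower (v x) hr _ h1 0 (zero_mem_sizeBox hρ)
  rw [h0] at h2
  rw [h2, laxMap_zero, sub_self, norm_zero, mul_zero, sub_zero] at h3
  exact norm_le_zero_iff.1 h3

theorem norm_le_sum_abs (σ : Fin n → ℝ) : ‖σ‖ ≤ ∑ i, |σ i| :=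
  (pi_norm_le_iff_of_nonneg (Finset.sum_nonneg fun _ _ => abs_nonneg _)).2 fun i =>
    Finset.single_le_sum (f := fun i => |σ i|) (fun _ _ => abs_nonneg _) (Finset.mem_univ i)

theorem Q_nonneg (S : HyperbolicSystem n) (ρ : ℝ) (v : ℝ → State n) : 0 ≤ S.Q ρ v :=
  finsum_nonneg fun _ => finsum_nonneg fun _ => abs_nonneg _

theorem V_lt (hC₀ : 0 < C₀) (hv : v ∈ S.Dstar ρ C₀ δ) : S.V ρ v < δ := by
  have h1 := hv.2.2.2.2
  have h2 := mul_nonneg hC₀.le (S.Q_nonneg ρ v)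
  unfold Upsilon at h1
  linarith

theorem V_eq_sum (hv : v ∈ S.Dstar ρ C₀ δ) :
    S.V ρ v = ∑ x ∈ hv.1.finite_jumpSet.toFinset, ∑ i, |S.strength ρ v x i| :=
  finsum_mem_eq_finite_toFinset_sum _ _

/-- A function in `𝒟*_δ` has small values. -/
theorem RiemannConstants.norm_le (R : S.RiemannConstants ρ r K) (hρ : 0 < ρ) (hC₀ : 0 < C₀)
    (hδ : K * δ < r) (hv : v ∈ S.Dstar ρ C₀ δ) (x : ℝ) : ‖v x‖ < r := by
  classical
  set J := hv.1.finite_jumpSet.toFinset with hJ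
  have hmemJ : ∀ y, y ∈ J ↔ y ∈ jumpSet v := fun y => Set.Finite.mem_toFinset _
  set a : ℝ → ℝ := fun y => ∑ i, |S.strength ρ v y i| with ha
  have ha0 : ∀ y, 0 ≤ a y := fun y => Finset.sum_nonneg fun _ _ => abs_nonneg _
  have htot : ∀ G ⊆ J, K * ∑ y ∈ G, a y < r := fun G hG => by
    have h1 : ∑ y ∈ G, a y ≤ S.V ρ v := by
      rw [V_eq_sum hv]
      exact Finset.sum_le_sum_of_subset_of_nonneg hG fun y _ _ => ha0 y
    have h2 := V_lt hC₀ hv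
    nlinarith [R.K_pos]
  -- Induction on the number of jumps up to `x`, starting from 0 at -∞. At every jump the bound
  -- obtained so far keeps the left state in the ball where the Lax map is Lipschitz.
  suffices h : ∀ m x, (J.filter (· ≤ x)).card = m → ‖v x‖ ≤ K * ∑ y ∈ J.filter (· ≤ x), a y from
    (h _ x rfl).trans_lt (htot _ (Finset.filter_subset _ _))
  intro m
  induction m with
  | zero =>
    intro x hx
    rw [Finset.card_eq_zero] at hx
    have h1 : v x = 0 := hv.1.eq_zero_of_no_jump hv.2.1 fun z hz hzJ => by
      have : z ∈ J.filter (· ≤ x) := Finset.mem_filter.2 ⟨(hmemJ z).2 hzJ, hz⟩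
      rw [hx] at this
      simp at this
    rw [h1, hx]; simp
  | succ m ih =>
    intro x hx
    have hne : (J.filter (· ≤ x)).Nonempty := Finset.card_pos.1 (by omega)
    set y := (J.filter (· ≤ x)).max' hne with hy
    have hyJ := (J.filter (· ≤ x)).max'_mem hne
    rw [← hy, Finset.mem_filter] at hyJ
    have hvx : v x = v y := hv.1.eq_of_no_jump hyJ.2 fun z hz hzx hzJ =>
      absurd ((J.filter (· ≤ x)).le_max' z (Finset.mem_filter.2 ⟨(hmemJ z).2 hzJ, hzx⟩))
        (not_le.2 hz)
    have h1 : ∀ᶠ z in 𝓝[<] y, ∀ p ∈ J, p < y → p < z := by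
      rw [Finset.eventually_all]
      intro p _
      by_cases hp : p < y
      · exact ((eventually_gt_nhds hp).filter_mono nhdsWithin_le_nhds).mono fun _ h _ => h
      · exact Eventually.of_forall fun _ h => absurd h hp
    obtain ⟨z, ⟨hz1, hz2⟩, hz3⟩ := ((hv.1.eventually_left y).and (h1.and self_mem_nhdsWithin)).exists.imp
      fun z h => (⟨⟨h.1, h.2.1⟩, h.2.2⟩ : (_ ∧ _) ∧ _)
    have hzy : z < y := hz3
    have hset : J.filter (· ≤ x) = insert y (J.filter (· ≤ z)) := by
      ext p
      simp only [Finset.mem_filter, Finset.mem_insert]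
      constructor
      · rintro ⟨hp, hpx⟩
        rcases ((J.filter (· ≤ x)).le_max' p (Finset.mem_filter.2 ⟨hp, hpx⟩)).lt_or_eq with h | h
        · exact Or.inr ⟨hp, (hz2 p hp h).le⟩
        · exact Or.inl h
      · rintro (rfl | ⟨hp, hpz⟩)
        · exact hyJ
        · exact ⟨hp, hpz.trans (hzy.le.trans hyJ.2)⟩
    have hnot : y ∉ J.filter (· ≤ z) := by
      simp only [Finset.mem_filter, not_and, not_le]
      exact fun _ => hzy
    have hcard : (J.filter (· ≤ z)).card = m := by
      rw [hset, Finset.card_insert_of_notMem hnot] at hx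
      omega
    have h2 := ih z hcard
    have h3 : ‖Function.leftLim v y‖ < r := by
      rw [← hz1]; exact h2.trans_lt (htot _ (Finset.filter_subset _ _))
    obtain ⟨h4, h5⟩ := strength_spec hρ hv y
    have h6 := R.lax_upper _ h3 _ h4 0 (zero_mem_sizeBox hρ)
    rw [h5, laxMap_zero, sub_zero] at h6
    rw [hset, Finset.sum_insert hnot, hvx, mul_add]
    calc ‖v y‖ = ‖(v y - Function.leftLim v y) + v z‖ := by rw [hz1]; simp
      _ ≤ K * ‖S.strength ρ v y‖ + K * ∑ p ∈ J.filter (· ≤ z), a p :=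
        (norm_add_le _ _).trans (add_le_add h6 h2)
      _ ≤ _ := by
        gcongr
        · exact R.K_pos.le
        · exact norm_le_sum_abs _

theorem RiemannConstants.norm_leftLim_lt (R : S.RiemannConstants ρ r K) (hρ : 0 < ρ) (hC₀ : 0 < C₀)
    (hδ : K * δ < r) (hv : v ∈ S.Dstar ρ C₀ δ) (x : ℝ) : ‖Function.leftLim v x‖ < r := by
  obtain ⟨z, hz⟩ := (hv.1.eventually_left x).exists
  rw [← hz]
  exact R.norm_le hρ hC₀ hδ hv z

end HyperbolicSystem
end

/-! ### States across a Riemann fan of fronts -/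

noncomputable section

namespace HyperbolicSystem

variable {n : ℕ} {S : HyperbolicSystem n} {ρ r K : ℝ}

/-- If the later families carry no wave, ψ_k is the outermost factor. -/
theorem foldl_lax_eq (S : HyperbolicSystem n) (ρ : ℝ) (s : Fin n → ℝ) (k : Fin n)
    (hs : ∀ j, k < j → s j = 0) (l : List (Fin n)) (hl : l.Pairwise (· < ·)) (hk : k ∈ l) (u : State n) :
    l.foldl (fun v j => S.lax ρ j (s j) v) u =
      S.lax ρ k (s k) (l.foldl (fun v j => S.lax ρ j (Function.update s k 0 j) v) u) := by
  induction l generalizing u with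
  | nil => simp at hk
  | cons a l ih =>
    rw [List.pairwise_cons] at hl
    rw [List.foldl_cons, List.foldl_cons]
    by_cases hak : a = k
    · subst hak
      rw [foldl_eq_self, foldl_eq_self, Function.update_self, lax_zero]
      · intro j hj v
        rw [Function.update_of_ne (hl.1 j hj).ne', hs j (hl.1 j hj), lax_zero]
      · intro j hj v
        rw [hs j (hl.1 j hj), lax_zero]
    · rw [Function.update_of_ne hak]
      exact ih hl.2 (by simpa [Ne.symm hak] using hk) _

theorem laxMap_eq_lax (S : HyperbolicSystem n) (ρ : ℝ) (u : State n) (s : Fin n → ℝ) (k : Fin n)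
    (hs : ∀ j, k < j → s j = 0) :
    S.laxMap ρ u s = S.lax ρ k (s k) (S.laxMap ρ u (Function.update s k 0)) :=
  foldl_lax_eq S ρ s k hs _ (List.pairwise_lt_finRange n) (List.mem_finRange k) u

theorem laxMap_update (S : HyperbolicSystem n) (ρ : ℝ) (u : State n) (s : Fin n → ℝ) (k : Fin n)
    (hs : ∀ j, k < j → s j = 0) (σ : ℝ) :
    S.laxMap ρ u (Function.update s k σ) =
      S.lax ρ k σ (S.laxMap ρ u (Function.update s k 0)) := by
  rw [laxMap_eq_lax S ρ u _ k, Function.update_self, Function.update_idem]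
  intro j hj
  rw [Function.update_of_ne hj.ne', hs j hj]

theorem update_zero_mem_sizeBox {s : Fin n → ℝ} (hρ : 0 < ρ) (hs : s ∈ sizeBox n ρ) (k : Fin n) :
    Function.update s k 0 ∈ sizeBox n ρ := by
  intro i
  by_cases h : i = k
  · subst h; simpa using hρ
  · rw [Function.update_of_ne h]; exact hs i

/-- Adding a shock to a Riemann fan on the right. -/
theorem RiemannConstants.shock_laxMap (R : S.RiemannConstants ρ r K) {u : State n} {s : Fin n → ℝ}
    {k : Fin n} (hs : ∀ j, k ≤ j → s j = 0) {σ : ℝ} (hσ : |σ| < ρ) (hneg : S.GNL k → σ < 0)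
    (hr : ‖S.laxMap ρ u s‖ < r) :
    S.shock ρ k σ (S.laxMap ρ u s) = S.laxMap ρ u (Function.update s k σ) := by
  rw [laxMap_update S ρ u s k fun j hj => hs j hj.le]
  rw [show Function.update s k 0 = s by rw [← hs k le_rfl, Function.update_eq_self]]
  unfold lax
  split_ifs with h
  -- A nonnegative size is possible only in a linearly degenerate field. There `lax` uses the
  -- rarefaction curve, which is also the shock curve.
  · exact R.contact k (fun hg => absurd (hneg hg) (not_lt.2 h)) _ hr σ hσ
  · rfl

/-- Adding a rarefaction to a Riemann fan on the right. -/
theorem RiemannConstants.rarefaction_laxMap (R : S.RiemannConstants ρ r K) (hρ : 0 < ρ)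
    {u : State n} (hu : ‖u‖ < r) {s : Fin n → ℝ} (hsb : s ∈ sizeBox n ρ)
    {k : Fin n} (hs : ∀ j, k < j → s j = 0) (hsk : 0 ≤ s k) {σ : ℝ} (hσ : 0 ≤ σ)
    (hσρ : s k + σ < ρ) :
    S.rarefaction ρ k σ (S.laxMap ρ u s) = S.laxMap ρ u (Function.update s k (s k + σ)) := by
  rw [laxMap_update S ρ u s k hs, laxMap_eq_lax S ρ u s k hs, lax, if_pos hsk, lax,
    if_pos (add_nonneg hsk hσ), add_comm (s k) σ]
  exact R.rarefaction_add u hu _ (update_zero_mem_sizeBox hρ hsb k) k σ (s k) hσ hsk (by linarith)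

end HyperbolicSystem

namespace Front

open HyperbolicSystem

variable {n : ℕ} {S : HyperbolicSystem n} {ρ lamHat ε r K : ℝ}

theorem physical_or_nonphysical (a : Front n) :
    a.kind = .nonphysical ∨ ∃ k, a.IsPhysical k := by
  rcases h : a.kind with ⟨k, σ⟩ | ⟨k, σ⟩ | _
  · exact Or.inr ⟨k, Or.inl ⟨σ, h⟩⟩
  · exact Or.inr ⟨k, Or.inr ⟨σ, h⟩⟩
  · exact Or.inl rfl

theorem IsPhysical.rank {a : Front n} {k : Fin n} (h : a.IsPhysical k) : a.rank = k := by
  rcases h with ⟨σ, h⟩ | ⟨σ, h⟩ <;> simp [Front.rank, h]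

theorem IsPhysical.unique {a : Front n} {k k' : Fin n} (h : a.IsPhysical k)
    (h' : a.IsPhysical k') : k = k' :=
  Fin.ext (h.rank.symm.trans h'.rank)

theorem rank_nonphysical {a : Front n} (h : a.kind = .nonphysical) : a.rank = n := by
  simp [Front.rank, h]

theorem IsPhysical.ne_nonphysical {a : Front n} {k : Fin n} (h : a.IsPhysical k) :
    a.kind ≠ .nonphysical := by
  rcases h with ⟨σ, h⟩ | ⟨σ, h⟩ <;> simp [h]

theorem size_of_nonphysical {a : Front n} (h : a.kind = .nonphysical) :
    a.size = ‖a.right - a.left‖ := by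
  simp [Front.size, h]

theorem Admissible.size_pos_of_rarefaction {a : Front n} (h : a.Admissible S ρ lamHat ε)
    {k : Fin n} {σ : ℝ} (hk : a.kind = .rarefaction k σ) : 0 < a.size := by
  simp only [Admissible, hk] at h
  simpa [Front.size, hk] using h.2.1

/-- Adding a physical front to a Riemann fan on the right. -/
theorem Admissible.right_eq {a : Front n} (h : a.Admissible S ρ lamHat ε) {k : Fin n}
    (hk : a.IsPhysical k) (R : S.RiemannConstants ρ r K) (hρ : 0 < ρ) {u : State n} (hu : ‖u‖ < r)
    {s : Fin n → ℝ} (hsb : s ∈ sizeBox n ρ) (hs : ∀ j, k < j → s j = 0)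
    (hsk : s k = 0 ∨ (0 ≤ s k ∧ ∃ σ, a.kind = .rarefaction k σ))
    (hleft : a.left = S.laxMap ρ u s) (hr : ‖a.left‖ < r) (hsize : |s k + a.size| < ρ) :
    a.right = S.laxMap ρ u (Function.update s k (s k + a.size)) := by
  rcases hk with ⟨σ, hk⟩ | ⟨σ, hk⟩
  · have hsk0 : s k = 0 := by
      rcases hsk with h0 | ⟨_, σ', h0⟩
      · exact h0
      · rw [hk] at h0; cases h0
    have hsz : a.size = σ := by simp [Front.size, hk]
    simp only [Admissible, hk] at h
    rw [h.2.1, hsz, hsk0, zero_add, hleft]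
    refine R.shock_laxMap (fun j hj => ?_) h.1 h.2.2.1 (hleft ▸ hr)
    rcases hj.lt_or_eq with hj | rfl
    · exact hs j hj
    · exact hsk0
  · have hsz : a.size = σ := by simp [Front.size, hk]
    simp only [Admissible, hk] at h
    have hsk0 : 0 ≤ s k := hsk.elim (fun h => h.ge) fun h => h.1
    rw [h.2.2.2.1, hleft, hsz]
    exact R.rarefaction_laxMap hρ hu hsb hs hsk0 h.2.1.le
      ((le_abs_self _).trans_lt (hsz ▸ hsize))

end Front

section fan

open HyperbolicSystem

variable {n : ℕ} {S : HyperbolicSystem n} {ρ lamHat ε r K : ℝ} {ι : Type}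

open Classical in
/-- The signed total size of the physical fronts of the family `k` in `F`. -/
def waveSum (front : ι → Front n) (F : Finset ι) (k : Fin n) : ℝ :=
  ∑ a ∈ F with (front a).IsPhysical k, (front a).size

open Classical in
/-- The total strength of the physical fronts of the family `k` in `F`. -/
def waveStrength (front : ι → Front n) (F : Finset ι) (k : Fin n) : ℝ :=
  ∑ a ∈ F with (front a).IsPhysical k, |(front a).size|

open Classical in
/-- The total strength of the non-physical fronts in `F`. -/
def defect (front : ι → Front n) (F : Finset ι) : ℝ :=
  ∑ a ∈ F with (front a).kind = .nonphysical, ‖(front a).right - (front a).left‖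

/-- The fronts `a` and `b` may be neighbours in a Riemann fan, `a` on the left of `b`. -/
def Front.FanLT (a b : Front n) : Prop :=
  a.rank < b.rank ∨ ∃ k σ σ', a.kind = .rarefaction k σ ∧ b.kind = .rarefaction k σ'

theorem abs_waveSum_le (front : ι → Front n) {F G : Finset ι} (h : F ⊆ G) (k : Fin n) :
    |waveSum front F k| ≤ waveStrength front G k := by
  classical
  unfold waveSum waveStrength
  exact (Finset.abs_sum_le_sum_abs _ _).trans (Finset.sum_le_sum_of_subset_of_nonneg
    (Finset.filter_subset_filter _ h) fun _ _ _ => abs_nonneg _)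

theorem Front.FanLT.not_physical_of_lt {a b : Front n} (h : a.FanLT b) {j k : Fin n}
    (hb : b.IsPhysical k) (hkj : k < j) : ¬ a.IsPhysical j := by
  intro ha
  rcases h with h | ⟨i, σ, σ', h1, h2⟩
  · rw [ha.rank, hb.rank] at h
    exact absurd h (not_lt.2 (Fin.lt_def.1 hkj).le)
  · have h3 : i = j := IsPhysical.unique (Or.inr ⟨σ, h1⟩) ha
    have h4 : i = k := IsPhysical.unique (Or.inr ⟨σ', h2⟩) hb
    exact hkj.ne (h4.symm.trans h3)

theorem Front.FanLT.rarefaction_of_same {a b : Front n} (h : a.FanLT b) {k : Fin n}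
    (ha : a.IsPhysical k) (hb : b.IsPhysical k) :
    (∃ σ, a.kind = .rarefaction k σ) ∧ ∃ σ, b.kind = .rarefaction k σ := by
  rcases h with h | ⟨i, σ, σ', h1, h2⟩
  · rw [ha.rank, hb.rank] at h
    exact absurd h (lt_irrefl _)
  · obtain rfl : i = k := IsPhysical.unique (Or.inr ⟨σ, h1⟩) ha
    exact ⟨⟨σ, h1⟩, σ', h2⟩

theorem Front.FanLT.left_ne_nonphysical {a b : Front n} (h : a.FanLT b) :
    a.kind ≠ .nonphysical := by
  intro ha
  rcases h with h | ⟨k, σ, σ', h1, h2⟩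
  · rw [rank_nonphysical ha] at h
    rcases b.physical_or_nonphysical with hb | ⟨k, hb⟩
    · rw [rank_nonphysical hb] at h; exact lt_irrefl _ h
    · rw [hb.rank] at h; exact absurd k.2 (not_lt.2 h.le)
  · rw [ha] at h1; cases h1

variable {front : ι → Front n} {F : Finset ι} {p : ι → ℝ} {g : ℝ → State n} {xL xR : ℝ}

open Classical in
/-- The last front in front of `x`, together with a point between it and the others. -/
theorem exists_last_front (hg : IsPiecewiseConst g)
    (hinj : ∀ a ∈ F, ∀ b ∈ F, a ≠ b → p a ≠ p b)
    (hconst : ∀ x y, x ≤ y → (∀ a ∈ F, ¬ (x < p a ∧ p a ≤ y)) → g y = g x) {x : ℝ}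
    (hne : (F.filter fun a => xL < p a ∧ p a ≤ x).Nonempty) :
    ∃ a ∈ F, xL < p a ∧ p a ≤ x ∧ g x = g (p a) ∧ ∃ z, xL ≤ z ∧ z < p a ∧
      g z = Function.leftLim g (p a) ∧ a ∉ (F.filter fun b => xL < p b ∧ p b ≤ z) ∧
      (F.filter fun b => xL < p b ∧ p b ≤ x) =
        insert a (F.filter fun b => xL < p b ∧ p b ≤ z) ∧
      ∀ b ∈ F.filter (fun b => xL < p b ∧ p b ≤ z), p b < p a := by
  obtain ⟨a, ha, hmax⟩ := Finset.exists_max_image _ p hne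
  simp only [Finset.mem_filter] at ha hmax
  obtain ⟨haF, haL, hax⟩ := ha
  have h1 : ∀ᶠ z in 𝓝[<] (p a), ∀ b ∈ F, p b < p a → p b < z := by
    rw [Finset.eventually_all]
    intro b _
    by_cases hb : p b < p a
    · exact ((eventually_gt_nhds hb).filter_mono nhdsWithin_le_nhds).mono fun _ h _ => h
    · exact Eventually.of_forall fun _ h => absurd h hb
  have h2 : ∀ᶠ z in 𝓝[<] (p a), xL < z :=
    (eventually_gt_nhds haL).filter_mono nhdsWithin_le_nhds
  obtain ⟨z, hz1, hz2, hz3, hz4⟩ :=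
    ((hg.eventually_left (p a)).and (h1.and (h2.and self_mem_nhdsWithin))).exists
  have hz4 : z < p a := hz4
  refine ⟨a, haF, haL, hax, ?_, z, hz3.le, hz4, hz1, ?_, ?_, ?_⟩
  · exact hconst _ _ hax fun b hb hbx =>
      absurd (hmax b ⟨hb, haL.trans hbx.1, hbx.2⟩) (not_le.2 hbx.1)
  · simp only [Finset.mem_filter, not_and, not_le]
    exact fun _ _ => hz4
  · ext b
    simp only [Finset.mem_filter, Finset.mem_insert]
    constructor
    · rintro ⟨hb, hbL, hbx⟩
      by_cases hba : b = a
      · exact Or.inl hba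
      · have h3 := (hmax b ⟨hb, hbL, hbx⟩).lt_of_ne (hinj b hb a haF hba)
        exact Or.inr ⟨hb, hbL, (hz2 b hb h3).le⟩
    · rintro (rfl | ⟨hb, hbL, hbz⟩)
      · exact ⟨haF, haL, hax⟩
      · exact ⟨hb, hbL, hbz.trans (hz4.le.trans hax)⟩
  · intro b hb
    exact (Finset.mem_filter.1 hb).2.2.trans_lt hz4

open Classical in
theorem waveSum_insert {M : Finset ι} {a : ι} (ha : a ∉ M) {k : Fin n}
    (hk : (front a).IsPhysical k) :
    waveSum front (insert a M) =
      Function.update (waveSum front M) k (waveSum front M k + (front a).size) := by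
  funext j
  unfold waveSum
  rw [Finset.filter_insert]
  by_cases hj : j = k
  · subst hj
    rw [if_pos hk, Finset.sum_insert (by simp [ha]), Function.update_self, add_comm]
  · rw [if_neg fun h => hj (h.unique hk), Function.update_of_ne hj]

open Classical in
theorem waveSum_insert_nonphysical {M : Finset ι} {a : ι}
    (hk : (front a).kind = .nonphysical) :
    waveSum front (insert a M) = waveSum front M := by
  funext j
  unfold waveSum
  rw [Finset.filter_insert, if_neg fun h : (front a).IsPhysical j => h.ne_nonphysical hk]

open Classical in
/-- In a Riemann fan without non-physical fronts the sizes add up. -/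
theorem fan_eq_laxMap (R : S.RiemannConstants ρ r K) (hρ : 0 < ρ) (hg : IsPiecewiseConst g)
    (hgr : ∀ x, ‖g x‖ < r) (hadm : ∀ a ∈ F, (front a).Admissible S ρ lamHat ε)
    (hinj : ∀ a ∈ F, ∀ b ∈ F, a ≠ b → p a ≠ p b)
    (hconst : ∀ x y, x ≤ y → (∀ a ∈ F, ¬ (x < p a ∧ p a ≤ y)) → g y = g x)
    (hleft : ∀ a ∈ F, Function.leftLim g (p a) = (front a).left)
    (hright : ∀ a ∈ F, g (p a) = (front a).right)
    (hord : ∀ a ∈ F, ∀ b ∈ F, xL < p a → p a < p b → p b ≤ xR → (front a).FanLT (front b))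
    (hsmall : ∀ k, waveStrength front (F.filter fun a => xL < p a ∧ p a ≤ xR) k < ρ)
    (x : ℝ) (hLx : xL ≤ x) (hxR : x ≤ xR)
    (hphys : ∀ a ∈ F, xL < p a → p a ≤ x → (front a).kind ≠ .nonphysical) :
    g x = S.laxMap ρ (g xL) (waveSum front (F.filter fun a => xL < p a ∧ p a ≤ x)) := by
  have hsub : ∀ z ≤ xR, (F.filter fun a => xL < p a ∧ p a ≤ z) ⊆
      F.filter fun a => xL < p a ∧ p a ≤ xR := fun z hz =>
    Finset.monotone_filter_right _ fun a _ h => ⟨h.1, h.2.trans hz⟩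
  -- Induction on the number of fronts between `xL` and `x`, peeling off the rightmost one.
  obtain ⟨m, hm⟩ : ∃ m, (F.filter fun a => xL < p a ∧ p a ≤ x).card = m := ⟨_, rfl⟩
  induction m generalizing x with
  | zero =>
    rw [Finset.card_eq_zero] at hm
    rw [hm]
    have h0 : waveSum front (∅ : Finset ι) = 0 := by funext k; simp [waveSum]
    rw [h0, laxMap_zero]
    refine hconst _ _ hLx fun a ha hax => ?_
    have : a ∈ F.filter fun a => xL < p a ∧ p a ≤ x := Finset.mem_filter.2 ⟨ha, hax⟩
    rw [hm] at this; simp at this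
  | succ m ih =>
    obtain ⟨a, haF, haL, hax, hgx, z, hLz, hza, hgz, hnot, hins, hlt⟩ :=
      exists_last_front (xL := xL) (x := x) hg hinj hconst
        (Finset.card_pos.1 (by rw [hm]; exact m.succ_pos))
    rw [hins, Finset.card_insert_of_notMem hnot] at hm
    have hzR : z ≤ xR := hza.le.trans (hax.trans hxR)
    have h1 := ih z hLz hzR
      (fun b hb hbL hbz => hphys b hb hbL (hbz.trans (hza.le.trans hax))) (by omega)
    obtain ⟨k, hk⟩ := ((front a).physical_or_nonphysical).resolve_left (hphys a haF haL hax)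
    set M := F.filter fun b => xL < p b ∧ p b ≤ z with hM
    have hfan : ∀ b ∈ M, (front b).FanLT (front a) := fun b hb =>
      hord b (Finset.mem_filter.1 hb).1 a haF (Finset.mem_filter.1 hb).2.1 (hlt b hb)
        (hax.trans hxR)
    have hbox : ∀ k, |waveSum front (F.filter fun b => xL < p b ∧ p b ≤ x) k| < ρ := fun k =>
      (abs_waveSum_le front (hsub x hxR) k).trans_lt (hsmall k)
    have hsz : |waveSum front M k + (front a).size| < ρ := by
      have := hbox k
      rwa [hins, waveSum_insert hnot hk, Function.update_self] at this
    rw [hgx, hright a haF, hins, waveSum_insert hnot hk]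
    refine (hadm a haF).right_eq hk R hρ (hgr _)
      (fun j => (abs_waveSum_le front (hsub z hzR) j).trans_lt (hsmall j)) ?_ ?_ ?_ ?_ hsz
    · intro j hj
      refine Finset.sum_eq_zero fun b hb => ?_
      exact absurd (Finset.mem_filter.1 hb).2
        ((hfan b (Finset.mem_filter.1 hb).1).not_physical_of_lt hk hj)
    -- A shock has no earlier front of its family in the fan, so the sum so far is 0. A rarefaction
    -- is preceded in its family only by rarefactions, whose sizes are positive.
    · rcases hk with ⟨σ, hk'⟩ | ⟨σ, hk'⟩
      · left
        refine Finset.sum_eq_zero fun b hb => ?_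
        obtain ⟨σ', h2⟩ := ((hfan b (Finset.mem_filter.1 hb).1).rarefaction_of_same
          (Finset.mem_filter.1 hb).2 (Or.inl ⟨σ, hk'⟩)).2
        rw [hk'] at h2; cases h2
      · right
        refine ⟨Finset.sum_nonneg fun b hb => ?_, σ, hk'⟩
        obtain ⟨σ', h2⟩ := ((hfan b (Finset.mem_filter.1 hb).1).rarefaction_of_same
          (Finset.mem_filter.1 hb).2 (Or.inr ⟨σ, hk'⟩)).1
        exact ((hadm b (Finset.mem_filter.1
          (Finset.mem_filter.1 hb).1).1).size_pos_of_rarefaction h2).le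
    · rw [← hleft a haF, ← hgz, h1]
    · rw [← hleft a haF, ← hgz]; exact hgr z

open Classical in
/-- In a Riemann fan the sizes add up, up to the strength of the non-physical fronts. -/
theorem norm_sub_laxMap_le_defect (R : S.RiemannConstants ρ r K) (hρ : 0 < ρ)
    (hg : IsPiecewiseConst g)
    (hgr : ∀ x, ‖g x‖ < r) (hadm : ∀ a ∈ F, (front a).Admissible S ρ lamHat ε)
    (hinj : ∀ a ∈ F, ∀ b ∈ F, a ≠ b → p a ≠ p b)
    (hconst : ∀ x y, x ≤ y → (∀ a ∈ F, ¬ (x < p a ∧ p a ≤ y)) → g y = g x)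
    (hleft : ∀ a ∈ F, Function.leftLim g (p a) = (front a).left)
    (hright : ∀ a ∈ F, g (p a) = (front a).right)
    (hord : ∀ a ∈ F, ∀ b ∈ F, xL < p a → p a < p b → p b ≤ xR → (front a).FanLT (front b))
    (hsmall : ∀ k, waveStrength front (F.filter fun a => xL < p a ∧ p a ≤ xR) k < ρ)
    (hLR : xL ≤ xR) :
    ‖g xR - S.laxMap ρ (g xL) (waveSum front (F.filter fun a => xL < p a ∧ p a ≤ xR))‖ ≤
      defect front (F.filter fun a => xL < p a ∧ p a ≤ xR) := by
  by_cases hphys : ∀ a ∈ F, xL < p a → p a ≤ xR → (front a).kind ≠ .nonphysical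
  · rw [fan_eq_laxMap R hρ hg hgr hadm hinj hconst hleft hright hord hsmall xR hLR le_rfl hphys,
      sub_self, norm_zero]
    exact Finset.sum_nonneg fun _ _ => norm_nonneg _
  push Not at hphys
  obtain ⟨b, hbF, hbL, hbR, hb⟩ := hphys
  obtain ⟨a, haF, haL, hax, hgx, z, hLz, hza, hgz, hnot, hins, hlt⟩ :=
    exists_last_front (xL := xL) (x := xR) hg hinj hconst
      ⟨b, Finset.mem_filter.2 ⟨hbF, hbL, hbR⟩⟩
  set M := F.filter fun b => xL < p b ∧ p b ≤ z with hM
  have hfan : ∀ c ∈ M, (front c).FanLT (front a) := fun c hc =>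
    hord c (Finset.mem_filter.1 hc).1 a haF (Finset.mem_filter.1 hc).2.1 (hlt c hc) hax
  -- No front of a fan can follow a non-physical one, since no family number is larger. So the
  -- non-physical front is the last one and unique.
  have hba : b = a := by
    have h1 : b ∈ insert a M := hins ▸ Finset.mem_filter.2 ⟨hbF, hbL, hbR⟩
    rcases Finset.mem_insert.1 h1 with h | h
    · exact h
    · exact absurd hb (hfan b h).left_ne_nonphysical
  subst hba
  have h1 := fan_eq_laxMap R hρ hg hgr hadm hinj hconst hleft hright hord hsmall z hLz
    (hza.le.trans hax) fun c hc hcL hcz =>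
      (hfan c (Finset.mem_filter.2 ⟨hc, hcL, hcz⟩)).left_ne_nonphysical
  rw [hins, waveSum_insert_nonphysical hb, ← h1, hgx, hgz, hleft b haF, hright b haF]
  refine Finset.single_le_sum (f := fun c => ‖(front c).right - (front c).left‖)
    (fun _ _ => norm_nonneg _) (Finset.mem_filter.2 ⟨Finset.mem_insert_self _ _, hb⟩)

end fan
end

/-! ### Fronts at and shortly after a given time -/

noncomputable section

namespace FrontPattern

open HyperbolicSystem

variable {n : ℕ} {S : HyperbolicSystem n} {ρ lamHat ε r K C₀ δ : ℝ} {w : FrontPattern n} {t t' : ℝ}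

open Classical in
/-- The fronts present at time `t`. -/
def alive (w : FrontPattern n) (t : ℝ) : Finset (Fin w.N) :=
  Finset.univ.filter fun a => (w.front a).Alive t

open Classical in
/-- The fronts present at time `t` at the point `x`. -/
def frontsAt (w : FrontPattern n) (t x : ℝ) : Finset (Fin w.N) :=
  (w.alive t).filter fun a => (w.front a).pos t = x

theorem mem_alive {a : Fin w.N} : a ∈ w.alive t ↔ (w.front a).Alive t := by
  simp [alive]

theorem mem_frontsAt {x : ℝ} {a : Fin w.N} :
    a ∈ w.frontsAt t x ↔ (w.front a).Alive t ∧ (w.front a).pos t = x := by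
  simp [frontsAt, mem_alive]

/-- `t'` is after `t`, without birth or death of a front in between. -/
def Generic (w : FrontPattern n) (t t' : ℝ) : Prop :=
  t < t' ∧ ∀ a, ((w.front a).Alive t → (w.front a).birth < t' ∧ (t' : EReal) < (w.front a).death) ∧
    (¬ (w.front a).Alive t → ¬ ((w.front a).birth ≤ t' ∧ (t' : EReal) ≤ (w.front a).death))

theorem eventually_generic (w : FrontPattern n) (t : ℝ) : ∀ᶠ t' in 𝓝[>] t, w.Generic t t' := by
  have h0 : ∀ᶠ t' in 𝓝[>] t, t < t' := self_mem_nhdsWithin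
  refine h0.and (eventually_all.2 fun a => ?_)
  by_cases ha : (w.front a).Alive t
  · have h1 : ∀ᶠ t' : ℝ in 𝓝[>] t, (t' : EReal) < (w.front a).death :=
      ((continuous_coe_real_ereal.tendsto t).eventually (eventually_lt_nhds ha.2)).filter_mono
        nhdsWithin_le_nhds
    filter_upwards [h0, h1] with t' h2 h3
    exact ⟨fun _ => ⟨ha.1.trans_lt h2, h3⟩, fun h => absurd ha h⟩
  · by_cases hb : (w.front a).birth ≤ t
    · filter_upwards [h0] with t' h2
      refine ⟨fun h => absurd h ha, fun _ h => ha ⟨hb, ?_⟩⟩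
      exact lt_of_lt_of_le (EReal.coe_lt_coe_iff.2 h2) h.2
    · have h1 : ∀ᶠ t' : ℝ in 𝓝[>] t, t' < (w.front a).birth :=
        (eventually_lt_nhds (not_le.1 hb)).filter_mono nhdsWithin_le_nhds
      filter_upwards [h1] with t' h2
      exact ⟨fun h => absurd h ha, fun _ h => absurd h.1 (not_le.2 h2)⟩

theorem tendsto_prodMk_right {x : ℝ} (ht : 0 ≤ t) {l : Filter ℝ} (hl : l ≤ 𝓝 x) :
    Tendsto (fun y : ℝ => (t, y)) l (𝓝[{p : ℝ × ℝ | 0 ≤ p.1}] (t, x)) :=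
  tendsto_nhdsWithin_iff.2 ⟨(Continuous.tendsto (by fun_prop) x).mono_left hl,
    Eventually.of_forall fun _ => ht⟩

theorem tendsto_prodMk_left (x : ℝ) (ht : 0 ≤ t) :
    Tendsto (fun s : ℝ => (s, x)) (𝓝[>] t) (𝓝[{p : ℝ × ℝ | 0 ≤ p.1}] (t, x)) :=
  tendsto_nhdsWithin_iff.2 ⟨((by fun_prop : Continuous fun s : ℝ => (s, x)).tendsto t).mono_left
    nhdsWithin_le_nhds, eventually_nhdsWithin_of_forall fun _ h => ht.trans (le_of_lt h)⟩

theorem Generic.inj (hG : w.Generic t t') (hw : w.IsApproxSolution S ρ lamHat ε) :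
    ∀ a ∈ w.alive t, ∀ b ∈ w.alive t, a ≠ b → (w.front a).pos t' ≠ (w.front b).pos t' :=
  fun a ha b hb hab =>
    have ha' := (hG.2 a).1 (mem_alive.1 ha)
    have hb' := (hG.2 b).1 (mem_alive.1 hb)
    hw.disjoint a b hab t' ha'.1 ha'.2 hb'.1.le hb'.2.le

theorem IsApproxSolution.notMem_jumpSet (hw : w.IsApproxSolution S ρ lamHat ε) (ht : 0 ≤ t) {x : ℝ}
    (hx : ∀ a, (w.front a).birth ≤ t → (t : EReal) ≤ (w.front a).death → (w.front a).pos t ≠ x) :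
    x ∉ jumpSet (w.u t) := by
  have h2 := (tendsto_prodMk_right ht (nhdsWithin_le_nhds (s := Iio x))).eventually
    (hw.locally_const t ht x hx)
  exact not_not.2 (leftLim_eq_of_tendsto
    (tendsto_const_nhds.congr' (h2.mono fun z hz => hz.symm)))

/-- At a generic time a jump can sit only on a front that was already present at time `t`. -/
theorem Generic.const (hG : w.Generic t t') (hw : w.IsApproxSolution S ρ lamHat ε) (ht : 0 ≤ t)
    (hv : IsPiecewiseConst (w.u t')) (x y : ℝ) (hxy : x ≤ y)
    (h : ∀ a ∈ w.alive t, ¬ (x < (w.front a).pos t' ∧ (w.front a).pos t' ≤ y)) :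
    w.u t' y = w.u t' x := by
  refine hv.eq_of_no_jump hxy fun z hxz hzy =>
    hw.notMem_jumpSet (ht.trans hG.1.le) fun a hb hd hz => ?_
  by_cases ha : (w.front a).Alive t
  · exact h a (mem_alive.2 ha) (hz ▸ ⟨hxz, hzy⟩)
  · exact (hG.2 a).2 ha ⟨hb, hd⟩

theorem Generic.sides (hG : w.Generic t t') (hw : w.IsApproxSolution S ρ lamHat ε) {a : Fin w.N}
    (ha : a ∈ w.alive t) :
    Function.leftLim (w.u t') ((w.front a).pos t') = (w.front a).left ∧
      w.u t' ((w.front a).pos t') = (w.front a).right :=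
  have ha' := (hG.2 a).1 (mem_alive.1 ha)
  hw.sides a t' ha'.1 ha'.2

theorem abs_size_lt (hw : w.IsApproxSolution S ρ lamHat ε) (hε : ε < ρ) {a : Fin w.N} {k : Fin n}
    (hk : (w.front a).IsPhysical k) : |(w.front a).size| < ρ := by
  have h := hw.admissible a
  rcases hk with ⟨σ, hk⟩ | ⟨σ, hk⟩
  · simp only [Front.Admissible, hk] at h
    simpa [Front.size, hk] using h.1
  · simp only [Front.Admissible, hk] at h
    have : (w.front a).size = σ := by simp [Front.size, hk]
    rw [this, abs_of_pos h.2.1]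
    exact h.2.2.1.trans_lt hε

/-- At time `t'` the front is alone at its position, so its size is the only nonzero component of
the Riemann solution there, by injectivity of the Lax map. -/
theorem Generic.abs_size_le (hG : w.Generic t t') (hw : w.IsApproxSolution S ρ lamHat ε)
    (R : S.RiemannConstants ρ r K) (hρ : 0 < ρ) (hC₀ : 0 < C₀) (hδ : K * δ < r) (hε : ε < ρ)
    (hv : w.u t' ∈ S.Dstar ρ C₀ δ) {a : Fin w.N} (ha : a ∈ w.alive t) {k : Fin n}
    (hk : (w.front a).IsPhysical k) :
    |(w.front a).size| ≤ ∑ i, |S.strength ρ (w.u t') ((w.front a).pos t') i| := by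
  obtain ⟨hl, hr⟩ := hG.sides hw ha
  have hnl : ‖(w.front a).left‖ < r := hl ▸ R.norm_leftLim_lt hρ hC₀ hδ hv _
  obtain ⟨h1, h2⟩ := strength_spec hρ hv ((w.front a).pos t')
  have hsz := abs_size_lt hw hε hk
  have h3 := (hw.admissible a).right_eq hk R hρ hnl (zero_mem_sizeBox hρ) (fun _ _ => rfl)
    (Or.inl rfl) (laxMap_zero S ρ _).symm hnl (by simpa using hsz)
  rw [Pi.zero_apply, zero_add] at h3
  set s : Fin n → ℝ := Function.update 0 k (w.front a).size with hs
  have hsb : s ∈ sizeBox n ρ := by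
    intro i
    by_cases h : i = k
    · subst h; simpa [hs] using hsz
    · simpa [hs, Function.update_of_ne h] using hρ
  have h4 := R.lax_lower _ hnl _ hsb _ h1
  rw [← h3, ← hr, ← hl, h2, sub_self, norm_zero, mul_zero] at h4
  have h5 : s = S.strength ρ (w.u t') ((w.front a).pos t') :=
    sub_eq_zero.1 (norm_le_zero_iff.1 h4)
  rw [← h5]
  refine le_trans ?_ (Finset.single_le_sum (f := fun i => |s i|) (fun _ _ => abs_nonneg _)
    (Finset.mem_univ k))
  simp [hs]

open Classical in
/-- The total strength of the physical fronts is small. -/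
theorem sum_abs_size_lt (hw : w.IsApproxSolution S ρ lamHat ε)
    (R : S.RiemannConstants ρ r K) (hρ : 0 < ρ) (hC₀ : 0 < C₀) (hδ : K * δ < r) (hε : ε < ρ)
    (hD : ∀ t, 0 ≤ t → w.u t ∈ S.Dstar ρ C₀ δ) (ht : 0 ≤ t) :
    ∑ a ∈ w.alive t with (w.front a).kind ≠ .nonphysical, |(w.front a).size| < δ := by
  -- Sizes do not change along a front. At a slightly later time the fronts have distinct positions,
  -- so 𝐕 counts each of them separately.
  obtain ⟨t', hG⟩ := (w.eventually_generic t).exists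
  have hv := hD t' (ht.trans hG.1.le)
  refine lt_of_le_of_lt ?_ (V_lt hC₀ hv)
  rw [V_eq_sum hv]
  calc _ ≤ ∑ a ∈ w.alive t with (w.front a).kind ≠ .nonphysical,
        ∑ i, |S.strength ρ (w.u t') ((w.front a).pos t') i| := by
        refine Finset.sum_le_sum fun a ha => ?_
        obtain ⟨ha, hk⟩ := Finset.mem_filter.1 ha
        obtain ⟨k, hk⟩ := (w.front a).physical_or_nonphysical.resolve_left hk
        exact hG.abs_size_le hw R hρ hC₀ hδ hε hv ha hk
    _ = ∑ x ∈ ((w.alive t).filter fun a => (w.front a).kind ≠ .nonphysical).image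
          fun a => (w.front a).pos t', ∑ i, |S.strength ρ (w.u t') x i| := by
        rw [Finset.sum_image]
        intro a ha b hb hab
        by_contra hne
        exact hG.inj hw a (Finset.mem_filter.1 ha).1 b (Finset.mem_filter.1 hb).1 hne hab
    _ ≤ _ := by
        refine Finset.sum_le_sum_of_subset_of_nonneg (fun x hx => ?_)
          fun _ _ _ => Finset.sum_nonneg fun _ _ => abs_nonneg _
        obtain ⟨a, ha, rfl⟩ := Finset.mem_image.1 hx
        rw [Set.Finite.mem_toFinset]
        obtain ⟨hl, hr⟩ := hG.sides hw (Finset.mem_filter.1 ha).1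
        show _ ≠ _
        rw [hl, hr]
        exact hw.left_ne_right a

open Classical in
theorem waveStrength_le {F : Finset (Fin w.N)} (hF : F ⊆ w.alive t) (k : Fin n) :
    waveStrength w.front F k ≤
      ∑ a ∈ w.alive t with (w.front a).kind ≠ .nonphysical, |(w.front a).size| := by
  unfold waveStrength
  refine Finset.sum_le_sum_of_subset_of_nonneg (fun a ha => ?_) fun _ _ _ => abs_nonneg _
  obtain ⟨h1, h2⟩ := Finset.mem_filter.1 ha
  exact Finset.mem_filter.2 ⟨hF h1, h2.ne_nonphysical⟩

theorem pos_eq (a : Front n) (t t' : ℝ) : a.pos t' = a.pos t + a.speed * (t' - t) := by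
  unfold Front.pos; ring

/-- Points on the two sides of `x`, close enough to `x`. -/
theorem exists_near_points (hv : IsPiecewiseConst (w.u t)) (x : ℝ) :
    ∃ xL xR, xL < x ∧ x < xR ∧ w.u t xL = Function.leftLim (w.u t) x ∧ w.u t xR = w.u t x ∧
      ∀ a, (w.front a).pos t ≠ xL ∧ (w.front a).pos t ≠ xR ∧
        (xL < (w.front a).pos t → (w.front a).pos t < xR → (w.front a).pos t = x) := by
  have h1 : ∀ᶠ y in 𝓝[<] x, ∀ a, (w.front a).pos t < x → (w.front a).pos t < y := by
    refine eventually_all.2 fun a => ?_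
    by_cases hb : (w.front a).pos t < x
    · exact ((eventually_gt_nhds hb).filter_mono nhdsWithin_le_nhds).mono fun _ h _ => h
    · exact Eventually.of_forall fun _ h => absurd h hb
  have h2 : ∀ᶠ y in 𝓝[>] x, ∀ a, x < (w.front a).pos t → y < (w.front a).pos t := by
    refine eventually_all.2 fun a => ?_
    by_cases hb : x < (w.front a).pos t
    · exact ((eventually_lt_nhds hb).filter_mono nhdsWithin_le_nhds).mono fun _ h _ => h
    · exact Eventually.of_forall fun _ h => absurd h hb
  obtain ⟨xL, hL1, hL2, hL3⟩ := ((hv.eventually_left x).and (h1.and self_mem_nhdsWithin)).exists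
  obtain ⟨xR, hR1, hR2, hR3⟩ := ((hv.eventually_right x).and (h2.and self_mem_nhdsWithin)).exists
  have hL3 : xL < x := hL3
  have hR3 : x < xR := hR3
  refine ⟨xL, xR, hL3, hR3, hL1, hR1, fun a => ⟨fun h => ?_, fun h => ?_, fun h h' => ?_⟩⟩
  · exact lt_irrefl _ (h ▸ hL2 a (h ▸ hL3))
  · exact lt_irrefl _ (h ▸ hR2 a (h ▸ hR3))
  · by_contra hne
    rcases lt_or_gt_of_ne hne with h3 | h3
    · exact lt_asymm h (hL2 a h3)
    · exact lt_asymm h' (hR2 a h3)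

open Classical in
/-- At a regular time the sizes of the waves at a point are the sums of the sizes of the fronts
there, up to the strength of the non-physical fronts. -/
theorem IsApproxSolution.abs_strength_sub_waveSum_le (hw : w.IsApproxSolution S ρ lamHat ε)
    (R : S.RiemannConstants ρ r K) (hρ : 0 < ρ) (hC₀ : 0 < C₀) (hδ : K * δ < r) (hδρ : δ ≤ ρ)
    (hε : ε < ρ)
    (hD : ∀ t, 0 ≤ t → w.u t ∈ S.Dstar ρ C₀ δ) (ht : 0 ≤ t) (hfan : w.FanOrdered t) (x : ℝ)
    (k : Fin n) :
    |S.strength ρ (w.u t) x k - waveSum w.front (w.frontsAt t x) k| ≤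
      K * defect w.front (w.frontsAt t x) := by
  have hv := hD t ht
  obtain ⟨xL, xR, hL, hR, huL, huR, hnear⟩ := exists_near_points (w := w) hv.1 x
  have hgen := w.eventually_generic t
  -- No front passes through (t, xL) or (t, xR), so the outer states at time t' are still those at
  -- time t.
  have hcL := (tendsto_prodMk_left xL ht).eventually
    (hw.locally_const t ht xL fun a _ _ => (hnear a).1)
  have hcR := (tendsto_prodMk_left xR ht).eventually
    (hw.locally_const t ht xR fun a _ _ => (hnear a).2.1)
  have hposc : ∀ a, Tendsto (fun s => (w.front a).pos s) (𝓝[>] t) (𝓝 ((w.front a).pos t)) :=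
    fun a => Tendsto.mono_left (Continuous.tendsto (by unfold Front.pos; fun_prop) t)
      nhdsWithin_le_nhds
  -- Shortly after t, the fronts between xL and xR are exactly those that were at x at time t.
  have hpos : ∀ᶠ s in 𝓝[>] t, ∀ a, (xL < (w.front a).pos s ∧ (w.front a).pos s ≤ xR) ↔
      (w.front a).pos t = x := by
    refine eventually_all.2 fun a => ?_
    obtain ⟨h1, h2, h3⟩ := hnear a
    rcases lt_or_gt_of_ne h1 with h1 | h1
    · filter_upwards [(hposc a).eventually (eventually_lt_nhds h1)] with s hs
      exact ⟨fun h => absurd h.1 (not_lt.2 hs.le), fun h => absurd (h ▸ h1) (not_lt.2 hL.le)⟩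
    rcases lt_or_gt_of_ne h2 with h2 | h2
    · filter_upwards [(hposc a).eventually (eventually_gt_nhds h1),
        (hposc a).eventually (eventually_lt_nhds h2)] with s hs hs'
      exact ⟨fun _ => h3 h1 h2, fun _ => ⟨hs, hs'.le⟩⟩
    · filter_upwards [(hposc a).eventually (eventually_gt_nhds h2)] with s hs
      exact ⟨fun h => absurd h.2 (not_le.2 hs), fun h => absurd (h ▸ h2) (not_lt.2 hR.le)⟩
  obtain ⟨t', hG, hL', hR', hP⟩ := (hgen.and (hcL.and (hcR.and hpos))).exists
  have ht' : 0 ≤ t' := ht.trans hG.1.le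
  have hv' := hD t' ht'
  have hset : ((w.alive t).filter fun a => xL < (w.front a).pos t' ∧ (w.front a).pos t' ≤ xR) =
      w.frontsAt t x := Finset.filter_congr fun a _ => hP a
  have hlt : ∀ k, waveStrength w.front (w.frontsAt t x) k < ρ := fun k =>
    ((waveStrength_le (Finset.filter_subset _ _) k).trans_lt
      (sum_abs_size_lt hw R hρ hC₀ hδ hε hD ht)).trans_le hδρ
  have hmain := norm_sub_laxMap_le_defect (front := w.front) (F := w.alive t)
    (p := fun a => (w.front a).pos t') (g := w.u t') (xL := xL) (xR := xR) R hρ hv'.1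
    (R.norm_le hρ hC₀ hδ hv') (fun a _ => hw.admissible a) (hG.inj hw)
    (hG.const hw ht hv'.1) (fun a ha => (hG.sides hw ha).1) (fun a ha => (hG.sides hw ha).2)
    (fun a ha b hb h1 h2 h3 => by
      have hax := (hP a).1 ⟨h1, h2.le.trans h3⟩
      have hbx := (hP b).1 ⟨h1.trans h2, h3⟩
      -- Fronts leaving a common point are ordered at t' as their speeds are, which is the order in
      -- the regularity of t.
      refine hfan a b (mem_alive.1 ha) (mem_alive.1 hb) (hax.trans hbx.symm) ?_
      rw [pos_eq _ t t', pos_eq _ t t', hax, hbx] at h2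
      have h4 := lt_of_add_lt_add_left h2
      exact lt_of_mul_lt_mul_right h4 (sub_pos.2 hG.1).le)
    (fun k => by rw [hset]; exact hlt k) (hL.trans hR).le
  rw [hset] at hmain
  simp only at hL' hR'
  rw [hL', hR', huL, huR] at hmain
  obtain ⟨h1, h2⟩ := strength_spec hρ hv x
  have h3 := R.lax_lower _ (R.norm_leftLim_lt hρ hC₀ hδ hv x) _ h1
    (waveSum w.front (w.frontsAt t x))
    (fun k => (abs_waveSum_le w.front (Finset.Subset.refl _) k).trans_lt (hlt k))
  rw [h2] at h3
  calc _ = |(S.strength ρ (w.u t) x - waveSum w.front (w.frontsAt t x)) k| := rfl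
    _ ≤ _ := (norm_le_pi_norm _ k).trans (h3.trans (mul_le_mul_of_nonneg_left hmain R.K_pos.le))

end FrontPattern
end

/-! ### Comparison of strengths and pair potentials -/

noncomputable section

namespace HyperbolicSystem

variable {n : ℕ} {S : HyperbolicSystem n} {ρ r K C₀ δ : ℝ} {v : ℝ → State n}

/-- Off the jumps the sizes vanish, so a single finite set can serve for the jumps and for the
positions of all fronts of both solutions. -/
theorem finsum_jumpSet_eq_sum (R : S.RiemannConstants ρ r K) (hρ : 0 < ρ) (hC₀ : 0 < C₀)
    (hδ : K * δ < r) (hv : v ∈ S.Dstar ρ C₀ δ) {X : Finset ℝ} (hX : jumpSet v ⊆ X)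
    {g : (Fin n → ℝ) → ℝ} (hg : g 0 = 0) (I : Set ℝ) [DecidablePred (· ∈ I)] :
    ∑ᶠ y ∈ jumpSet v ∩ I, g (S.strength ρ v y) = ∑ y ∈ X with y ∈ I, g (S.strength ρ v y) := by
  classical
  rw [finsum_mem_def, finsum_eq_sum_of_support_subset (s := X)]
  · rw [Finset.sum_filter]
    refine Finset.sum_congr rfl fun y _ => ?_
    by_cases hyI : y ∈ I
    · rw [if_pos hyI]
      by_cases hy : y ∈ jumpSet v
      · rw [indicator_of_mem (show y ∈ jumpSet v ∩ I from ⟨hy, hyI⟩)]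
      · rw [indicator_of_notMem fun h => hy h.1,
          R.strength_eq_zero hρ hv hy (R.norm_le hρ hC₀ hδ hv y), hg]
    · rw [if_neg hyI, indicator_of_notMem fun h => hyI h.2]
  · intro y hy
    by_contra h
    exact hy (indicator_of_notMem (fun h' => h (hX h'.1)) _)

theorem V_eq_sum_of_subset (R : S.RiemannConstants ρ r K) (hρ : 0 < ρ) (hC₀ : 0 < C₀)
    (hδ : K * δ < r) (hv : v ∈ S.Dstar ρ C₀ δ) {X : Finset ℝ} (hX : jumpSet v ⊆ X) :
    S.V ρ v = ∑ y ∈ X, ∑ i, |S.strength ρ v y i| := by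
  classical
  have h := finsum_jumpSet_eq_sum R hρ hC₀ hδ hv hX (g := fun s => ∑ i, |s i|) (by simp) univ
  simpa [V] using h

open Classical in
/-- The contribution to the interaction potential of an `i`-wave of size `a` on the left of a
`j`-wave of size `b`. -/
def pairPotential (S : HyperbolicSystem n) (i j : Fin n) (a b : ℝ) : ℝ :=
  if j < i ∨ (i = j ∧ S.GNL i ∧ min a b < 0) then |a * b| else 0

theorem abs_abs_mul_sub_le (a b a' b' : ℝ) :
    |(|a * b| - |a' * b'|)| ≤ |a - a'| * |b| + |a'| * |b - b'| :=
  calc |(|a * b| - |a' * b'|)| ≤ |a * b - a' * b'| := abs_abs_sub_abs_le_abs_sub _ _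
    _ = |(a - a') * b + a' * (b - b')| := by congr 1; ring
    _ ≤ _ := (abs_add_le _ _).trans_eq (by rw [abs_mul, abs_mul])

/-- The factor that is negative in the first pair is nonnegative in the second one, so its modulus
is at most its change. -/
theorem abs_mul_le_of_min_neg {a b a' b' : ℝ} (h : min a b < 0) (ha' : 0 ≤ a') (hb' : 0 ≤ b') :
    |a * b| ≤ |a - a'| * |b| + |a'| * |b - b'| := by
  rw [abs_mul]
  rcases lt_or_ge a 0 with ha | ha
  · have h1 : |a| ≤ |a - a'| := by
      rw [abs_of_neg ha, abs_of_neg (by linarith)]; linarith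
    have h2 : 0 ≤ |a'| * |b - b'| := by positivity
    nlinarith [mul_le_mul_of_nonneg_right h1 (abs_nonneg b)]
  · have hb : b < 0 := by
      rcases min_lt_iff.1 h with h | h
      · exact absurd h (not_lt.2 ha)
      · exact h
    have h1 : |b| ≤ |b - b'| := by
      rw [abs_of_neg hb, abs_of_neg (by linarith)]; linarith
    have h2 : |a| ≤ |a - a'| + |a'| := by
      have := abs_add_le (a - a') a'
      rwa [sub_add_cancel] at this
    nlinarith [mul_le_mul_of_nonneg_right h2 (abs_nonneg b),
      mul_le_mul_of_nonneg_left h1 (abs_nonneg a')]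

/-- The sign condition makes the potential discontinuous in form only: if it holds for just one of
the two pairs, some size changes its sign, and the product is bounded by that change. -/
theorem abs_pairPotential_sub_le (i j : Fin n) (a b a' b' : ℝ) :
    |S.pairPotential i j a b - S.pairPotential i j a' b'| ≤
      |a - a'| * |b| + |a'| * |b - b'| := by
  have h0 : 0 ≤ |a - a'| * |b| + |a'| * |b - b'| := by positivity
  unfold pairPotential
  split_ifs with h1 h2 h2
  · exact abs_abs_mul_sub_le a b a' b'
  · push Not at h2
    have h3 := h1.resolve_left (not_lt.2 h2.1)
    have h4 := h2.2 h3.1 h3.2.1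
    rw [sub_zero, abs_abs]
    exact abs_mul_le_of_min_neg h3.2.2 (le_min_iff.1 h4).1 (le_min_iff.1 h4).2
  · push Not at h1
    have h3 := h2.resolve_left (not_lt.2 h1.1)
    have h4 := h1.2 h3.1 h3.2.1
    rw [zero_sub, abs_neg, abs_abs, mul_comm a' b']
    have h5 := abs_mul_le_of_min_neg (a := b') (b := a') (a' := b) (b' := a)
      (by rw [min_comm]; exact h3.2.2) (le_min_iff.1 h4).2 (le_min_iff.1 h4).1
    rw [abs_sub_comm b' b, abs_sub_comm a' a] at h5
    linarith [mul_comm |b - b'| |a'|, mul_comm |b| |a - a'|]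
  · simpa using h0

open Classical in
theorem Q_eq_sum (R : S.RiemannConstants ρ r K) (hρ : 0 < ρ) (hC₀ : 0 < C₀)
    (hδ : K * δ < r) (hv : v ∈ S.Dstar ρ C₀ δ) {X : Finset ℝ} (hX : jumpSet v ⊆ X) :
    S.Q ρ v = ∑ p ∈ X ×ˢ Finset.univ, ∑ q ∈ X ×ˢ Finset.univ,
      if p.1 < q.1 then
        S.pairPotential p.2 q.2 (S.strength ρ v p.1 p.2) (S.strength ρ v q.1 q.2) else 0 := by
  have h0 : ∀ y, y ∉ jumpSet v → S.strength ρ v y = 0 := fun y hy =>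
    R.strength_eq_zero hρ hv hy (R.norm_le hρ hC₀ hδ hv y)
  rw [← Finset.sum_product', Q, finsum_mem_def, finsum_eq_sum_of_support_subset
    (s := (X ×ˢ Finset.univ) ×ˢ (X ×ˢ Finset.univ))]
  · refine Finset.sum_congr rfl fun p _ => ?_
    by_cases h1 : p.1.1 ∈ jumpSet v
    · by_cases h2 : p.2.1 ∈ jumpSet v
      · simp [indicator, approaching, pairPotential, h1, h2, ite_and]
      · rw [indicator_of_notMem fun h => h2 h.2.1]
        simp [pairPotential, h0 _ h2]
    · rw [indicator_of_notMem fun h => h1 h.1]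
      simp [pairPotential, h0 _ h1]
  · intro p hp
    by_contra h
    refine hp (indicator_of_notMem (fun h' => h ?_) _)
    simp only [Finset.coe_product, Finset.coe_univ, mem_prod, Finset.mem_coe, mem_univ, and_true]
    exact ⟨hX h'.1, hX h'.2.1⟩

end HyperbolicSystem

namespace FrontPattern

open HyperbolicSystem

variable {n : ℕ} {S : HyperbolicSystem n} {ρ lamHat ε r K C₀ δ : ℝ} {w : FrontPattern n} {t t' : ℝ}

/-- The time `t` is regular for the front tracking solution `w`, and the constants are such that
the estimates for Riemann problems apply. -/
structure RegularAt (S : HyperbolicSystem n) (ρ lamHat ε r K C₀ δ : ℝ) (w : FrontPattern n)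
    (t : ℝ) : Prop where
  sol : w.IsApproxSolution S ρ lamHat ε
  const : S.RiemannConstants ρ r K
  ρ_pos : 0 < ρ
  C₀_pos : 0 < C₀
  δ_lt : K * δ < r
  δ_le : δ ≤ ρ
  ε_lt : ε < ρ
  mem_Dstar : ∀ t, 0 ≤ t → w.u t ∈ S.Dstar ρ C₀ δ
  nonneg : 0 ≤ t
  fan : w.FanOrdered t

namespace RegularAt

/-- Equal speeds from a common point would make the two fronts overlap. -/
theorem speed_ne {a b : Fin w.N} (hw : w.IsApproxSolution S ρ lamHat ε)
    (ha : a ∈ w.alive t) (hb : b ∈ w.alive t) (hab : a ≠ b)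
    (hpos : (w.front a).pos t = (w.front b).pos t) : (w.front a).speed ≠ (w.front b).speed := by
  intro h
  obtain ⟨t', hG⟩ := (w.eventually_generic t).exists
  exact hG.inj hw a ha b hb hab (by rw [pos_eq _ t t', pos_eq _ t t', hpos, h])

/-- Several fronts of one family at one point are rarefactions. -/
theorem size_pos_of_ne (H : w.RegularAt S ρ lamHat ε r K C₀ δ t)
    {a b : Fin w.N} {x : ℝ} {k : Fin n} (ha : a ∈ w.frontsAt t x)
    (hb : b ∈ w.frontsAt t x) (hak : (w.front a).IsPhysical k) (hbk : (w.front b).IsPhysical k)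
    (hab : a ≠ b) : 0 < (w.front a).size := by
  have ha' := mem_frontsAt.1 ha
  have hb' := mem_frontsAt.1 hb
  have hpos := ha'.2.trans hb'.2.symm
  rcases lt_or_gt_of_ne (speed_ne H.sol (mem_alive.2 ha'.1) (mem_alive.2 hb'.1) hab hpos) with h | h
  · obtain ⟨σ, h1⟩ := (Front.FanLT.rarefaction_of_same (H.fan a b ha'.1 hb'.1 hpos h) hak hbk).1
    exact (H.sol.admissible a).size_pos_of_rarefaction h1
  · obtain ⟨σ, h1⟩ := (Front.FanLT.rarefaction_of_same
      (H.fan b a hb'.1 ha'.1 hpos.symm h) hbk hak).2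
    exact (H.sol.admissible a).size_pos_of_rarefaction h1

/-- If the family has several fronts at x, all are rarefactions and all sizes are positive;
otherwise the sum is the single size. Merging the fronts at a point thus preserves the sign
condition in the potential. -/
theorem size_neg_iff (H : w.RegularAt S ρ lamHat ε r K C₀ δ t)
    {a : Fin w.N} {x : ℝ} {k : Fin n} (ha : a ∈ w.frontsAt t x)
    (hak : (w.front a).IsPhysical k) :
    (w.front a).size < 0 ↔ waveSum w.front (w.frontsAt t x) k < 0 := by
  classical
  by_cases h : ∃ b ∈ w.frontsAt t x, (w.front b).IsPhysical k ∧ b ≠ a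
  · obtain ⟨b, hb, hbk, hba⟩ := h
    have h1 := H.size_pos_of_ne ha hb hak hbk hba.symm
    have h2 : 0 ≤ waveSum w.front (w.frontsAt t x) k := by
      refine Finset.sum_nonneg fun c hc => ?_
      obtain ⟨hc, hck⟩ := Finset.mem_filter.1 hc
      by_cases hca : c = a
      · exact hca ▸ h1.le
      · exact (H.size_pos_of_ne hc ha hck hak hca).le
    exact ⟨fun h => absurd h (not_lt.2 h1.le), fun h => absurd h (not_lt.2 h2)⟩
  · push Not at h
    have h1 : (w.frontsAt t x).filter (fun c => (w.front c).IsPhysical k) = {a} := by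
      ext c
      simp only [Finset.mem_filter, Finset.mem_singleton]
      exact ⟨fun hc => h c hc.1 hc.2, fun hc => hc ▸ ⟨ha, hak⟩⟩
    have h2 : waveSum w.front (w.frontsAt t x) k = (w.front a).size := by
      unfold waveSum
      convert Finset.sum_singleton (fun a => (w.front a).size) a
    rw [h2]

theorem abs_waveSum (H : w.RegularAt S ρ lamHat ε r K C₀ δ t) (x : ℝ) (k : Fin n) :
    |waveSum w.front (w.frontsAt t x) k| = waveStrength w.front (w.frontsAt t x) k := by
  classical
  rcases lt_or_ge (waveSum w.front (w.frontsAt t x) k) 0 with h | h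
  · rw [abs_of_neg h]
    unfold waveSum waveStrength
    rw [← Finset.sum_neg_distrib]
    refine Finset.sum_congr rfl fun a ha => ?_
    obtain ⟨ha, hk⟩ := Finset.mem_filter.1 ha
    rw [abs_of_neg ((H.size_neg_iff ha hk).2 h)]
  · rw [abs_of_nonneg h]
    unfold waveSum waveStrength
    refine Finset.sum_congr rfl fun a ha => ?_
    obtain ⟨ha, hk⟩ := Finset.mem_filter.1 ha
    rw [abs_of_nonneg (not_lt.1 fun h' => absurd ((H.size_neg_iff ha hk).1 h') (not_lt.2 h))]

/-- Each non-physical front is counted at one point only. -/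
theorem sum_defect_le (hw : w.IsApproxSolution S ρ lamHat ε) (ht : 0 ≤ t) (X : Finset ℝ) :
    ∑ x ∈ X, defect w.front (w.frontsAt t x) ≤ ε := by
  classical
  refine le_trans ?_ (hw.nonphysical_small t ht)
  unfold defect
  rw [← Finset.sum_biUnion]
  · refine Finset.sum_le_sum_of_subset_of_nonneg (fun a ha => ?_) fun _ _ _ => norm_nonneg _
    obtain ⟨x, _, ha⟩ := Finset.mem_biUnion.1 ha
    obtain ⟨ha, hk⟩ := Finset.mem_filter.1 ha
    exact Finset.mem_filter.2 ⟨Finset.mem_univ _, (mem_frontsAt.1 ha).1, hk⟩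
  · intro x _ y _ hxy
    refine Finset.disjoint_left.2 fun a ha hb => hxy ?_
    rw [← (mem_frontsAt.1 (Finset.mem_filter.1 ha).1).2,
      ← (mem_frontsAt.1 (Finset.mem_filter.1 hb).1).2]

theorem abs_strength_sub_le (H : w.RegularAt S ρ lamHat ε r K C₀ δ t) (x : ℝ) (k : Fin n) :
    |S.strength ρ (w.u t) x k - waveSum w.front (w.frontsAt t x) k| ≤
      K * defect w.front (w.frontsAt t x) :=
  H.sol.abs_strength_sub_waveSum_le H.const H.ρ_pos H.C₀_pos H.δ_lt H.δ_le H.ε_lt H.mem_Dstar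
    H.nonneg H.fan x k

theorem sum_abs_strength_sub_le (H : w.RegularAt S ρ lamHat ε r K C₀ δ t)
    (X : Finset ℝ) (k : Fin n) :
    ∑ x ∈ X, |S.strength ρ (w.u t) x k - waveSum w.front (w.frontsAt t x) k| ≤ K * ε :=
  calc _ ≤ ∑ x ∈ X, K * defect w.front (w.frontsAt t x) :=
        Finset.sum_le_sum fun x _ => H.abs_strength_sub_le x k
    _ ≤ K * ε := by
        rw [← Finset.mul_sum]
        exact mul_le_mul_of_nonneg_left (sum_defect_le H.sol H.nonneg X) H.const.K_pos.le

theorem abs_sum_strength_sub_le (H : w.RegularAt S ρ lamHat ε r K C₀ δ t)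
    (X : Finset ℝ) (k : Fin n) :
    |∑ x ∈ X, |S.strength ρ (w.u t) x k| - ∑ x ∈ X, waveStrength w.front (w.frontsAt t x) k| ≤
      K * ε := by
  rw [← Finset.sum_sub_distrib]
  refine (Finset.abs_sum_le_sum_abs _ _).trans (le_trans (Finset.sum_le_sum fun x _ => ?_)
    (H.sum_abs_strength_sub_le X k))
  rw [← H.abs_waveSum]
  exact abs_abs_sub_abs_le_abs_sub _ _

theorem sum_waveStrength {X : Finset ℝ} (hP : ∀ a ∈ w.alive t, (w.front a).pos t ∈ X) (k : Fin n)
    (I : Set ℝ) [DecidablePred (· ∈ I)]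
    [DecidablePred fun a => (w.front a).Alive t ∧ (w.front a).IsPhysical k ∧ (w.front a).pos t ∈ I] :
    ∑ a ∈ Finset.univ.filter (fun a =>
      (w.front a).Alive t ∧ (w.front a).IsPhysical k ∧ (w.front a).pos t ∈ I), |(w.front a).size| =
      ∑ y ∈ X with y ∈ I, waveStrength w.front (w.frontsAt t y) k := by
  classical
  rw [← Finset.sum_fiberwise_of_maps_to (g := fun a => (w.front a).pos t)
    (t := X.filter (· ∈ I))]
  · refine Finset.sum_congr rfl fun y hy => ?_
    unfold waveStrength
    refine Finset.sum_congr ?_ fun _ _ => rfl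
    ext a
    simp only [Finset.mem_filter, Finset.mem_univ, true_and, mem_frontsAt]
    constructor
    · rintro ⟨⟨h1, h2, h3⟩, h4⟩; exact ⟨⟨h1, h4⟩, h2⟩
    · rintro ⟨⟨h1, h4⟩, h2⟩; exact ⟨⟨h1, h2, h4 ▸ (Finset.mem_filter.1 hy).2⟩, h4⟩
  · intro a ha
    simp only [Finset.mem_filter, Finset.mem_univ, true_and] at ha ⊢
    exact ⟨hP a (mem_alive.2 ha.1), ha.2.2⟩

-- A jump at x itself counts in `Aminus`, whereas `leftWaves` omits a front at x. Off the finite set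
-- `X`, hence almost everywhere, the difference is invisible.
open Classical in
theorem Aminus_eq (H : w.RegularAt S ρ lamHat ε r K C₀ δ t)
    {X : Finset ℝ} (hJ : jumpSet (w.u t) ⊆ X) {x : ℝ} (hx : x ∉ X) (k : Fin n) :
    S.Aminus ρ (w.u t) k x = ∑ y ∈ X with y ∈ Iio x, |S.strength ρ (w.u t) y k| := by
  rw [Aminus, finsum_jumpSet_eq_sum H.const H.ρ_pos H.C₀_pos H.δ_lt (H.mem_Dstar t H.nonneg) hJ
    (g := fun s => |s k|) (by simp)]
  refine Finset.sum_congr (Finset.filter_congr fun y hy => ?_) fun _ _ => rfl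
  simp only [mem_Iic, mem_Iio]
  exact ⟨fun h => h.lt_of_ne fun h' => hx (h' ▸ hy), fun h => h.le⟩

open Classical in
theorem Aplus_eq (H : w.RegularAt S ρ lamHat ε r K C₀ δ t)
    {X : Finset ℝ} (hJ : jumpSet (w.u t) ⊆ X) (x : ℝ) (k : Fin n) :
    S.Aplus ρ (w.u t) k x = ∑ y ∈ X with y ∈ Ioi x, |S.strength ρ (w.u t) y k| :=
  finsum_jumpSet_eq_sum H.const H.ρ_pos H.C₀_pos H.δ_lt (H.mem_Dstar t H.nonneg) hJ
    (g := fun s => |s k|) (by simp) _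

theorem abs_Aminus_sub_le (H : w.RegularAt S ρ lamHat ε r K C₀ δ t)
    {X : Finset ℝ} (hJ : jumpSet (w.u t) ⊆ X)
    (hP : ∀ a ∈ w.alive t, (w.front a).pos t ∈ X) {x : ℝ} (hx : x ∉ X) (k : Fin n) :
    |S.Aminus ρ (w.u t) k x - w.leftWaves t k x| ≤ K * ε := by
  classical
  have h1 := sum_waveStrength hP k (Iio x)
  rw [H.Aminus_eq hJ hx]
  unfold leftWaves
  simp only [mem_Iio] at h1 ⊢
  convert H.abs_sum_strength_sub_le (X.filter (· < x)) k using 3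

theorem abs_Aplus_sub_le (H : w.RegularAt S ρ lamHat ε r K C₀ δ t)
    {X : Finset ℝ} (hJ : jumpSet (w.u t) ⊆ X)
    (hP : ∀ a ∈ w.alive t, (w.front a).pos t ∈ X) (x : ℝ) (k : Fin n) :
    |S.Aplus ρ (w.u t) k x - w.rightWaves t k x| ≤ K * ε := by
  classical
  have h1 := sum_waveStrength hP k (Ioi x)
  rw [H.Aplus_eq hJ]
  unfold rightWaves
  simp only [mem_Ioi] at h1 ⊢
  convert H.abs_sum_strength_sub_le (X.filter (x < ·)) k using 3

open Classical in
/-- Summation over the physical fronts by positions and families. -/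
theorem sum_physical {X : Finset ℝ} (hP : ∀ a ∈ w.alive t, (w.front a).pos t ∈ X)
    (g : Fin w.N → ℝ) :
    ∑ a ∈ w.alive t with (w.front a).kind ≠ .nonphysical, g a =
      ∑ p ∈ X ×ˢ (Finset.univ : Finset (Fin n)),
        ∑ a ∈ w.frontsAt t p.1 with (w.front a).IsPhysical p.2, g a := by
  rw [← Finset.sum_biUnion]
  · refine Finset.sum_congr ?_ fun _ _ => rfl
    ext a
    simp only [Finset.mem_filter, Finset.mem_biUnion, Finset.mem_product, Finset.mem_univ, and_true,
      mem_frontsAt, mem_alive, Prod.exists]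
    constructor
    · rintro ⟨h1, h2⟩
      obtain ⟨k, hk⟩ := (w.front a).physical_or_nonphysical.resolve_left h2
      exact ⟨_, k, hP a (mem_alive.2 h1), ⟨h1, rfl⟩, hk⟩
    · rintro ⟨x, k, _, ⟨h1, _⟩, hk⟩
      exact ⟨h1, hk.ne_nonphysical⟩
  · rintro ⟨x, i⟩ _ ⟨y, j⟩ _ hne
    refine Finset.disjoint_left.2 fun a ha hb => hne ?_
    obtain ⟨ha, hi⟩ := Finset.mem_filter.1 ha
    obtain ⟨hb, hj⟩ := Finset.mem_filter.1 hb
    exact Prod.ext ((mem_frontsAt.1 ha).2.symm.trans (mem_frontsAt.1 hb).2) (hi.unique hj)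

end RegularAt
end FrontPattern
end

/-! ### Comparison of the interaction potentials -/

noncomputable section

namespace FrontPattern.RegularAt

open HyperbolicSystem

variable {n : ℕ} {S : HyperbolicSystem n} {ρ lamHat ε r K C₀ δ : ℝ} {w : FrontPattern n} {t : ℝ}

-- Whether two physical fronts approach depends only on their positions, their families and the
-- signs of the merged waves, so all fronts of two groups approach or none do.
open Classical in
theorem approaching_iff (H : w.RegularAt S ρ lamHat ε r K C₀ δ t) {p q : ℝ × Fin n} {a b : Fin w.N}
    (ha : a ∈ w.frontsAt t p.1) (hak : (w.front a).IsPhysical p.2)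
    (hb : b ∈ w.frontsAt t q.1) (hbk : (w.front b).IsPhysical q.2) :
    w.Approaching S t a b ↔ p.1 < q.1 ∧ (q.2 < p.2 ∨ (p.2 = q.2 ∧ S.GNL p.2 ∧
      min (waveSum w.front (w.frontsAt t p.1) p.2)
        (waveSum w.front (w.frontsAt t q.1) q.2) < 0)) := by
  have ha' := mem_frontsAt.1 ha
  have hb' := mem_frontsAt.1 hb
  rw [Approaching, ha'.2, hb'.2, hak.rank, hbk.rank, min_lt_iff, ← H.size_neg_iff ha hak,
    ← H.size_neg_iff hb hbk, Fin.lt_def]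
  constructor
  · rintro ⟨_, _, h1, h2⟩
    refine ⟨h1, h2.imp id ?_⟩
    rintro ⟨k, h3, h4, h5, h6⟩
    obtain rfl := h4.unique hak
    exact ⟨h5.unique hbk, h3, h6⟩
  · rintro ⟨h1, h2⟩
    refine ⟨ha'.1, hb'.1, h1, h2.imp id ?_⟩
    rintro ⟨h3, h4, h5⟩
    exact ⟨p.2, h4, hak, h3 ▸ hbk, h5⟩

open Classical in
/-- The contribution of a pair of fronts to the interaction potential. -/
def frontPotential (S : HyperbolicSystem n) (w : FrontPattern n) (t : ℝ) (a b : Fin w.N) : ℝ :=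
  if w.Approaching S t a b then |(w.front a).size * (w.front b).size| else 0

open Classical in
theorem sum_frontPotential_group (H : w.RegularAt S ρ lamHat ε r K C₀ δ t) (p q : ℝ × Fin n) :
    ∑ a ∈ w.frontsAt t p.1 with (w.front a).IsPhysical p.2,
      ∑ b ∈ w.frontsAt t q.1 with (w.front b).IsPhysical q.2, frontPotential S w t a b =
    if p.1 < q.1 then S.pairPotential p.2 q.2 (waveSum w.front (w.frontsAt t p.1) p.2)
      (waveSum w.front (w.frontsAt t q.1) q.2) else 0 := by
  rw [pairPotential, abs_mul, H.abs_waveSum, H.abs_waveSum]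
  by_cases hc : p.1 < q.1 ∧ (q.2 < p.2 ∨ (p.2 = q.2 ∧ S.GNL p.2 ∧
      min (waveSum w.front (w.frontsAt t p.1) p.2)
        (waveSum w.front (w.frontsAt t q.1) q.2) < 0))
  · rw [if_pos hc.1, if_pos hc.2, waveStrength, waveStrength, Finset.sum_mul_sum]
    refine Finset.sum_congr rfl fun a ha => Finset.sum_congr rfl fun b hb => ?_
    obtain ⟨ha, hak⟩ := Finset.mem_filter.1 ha
    obtain ⟨hb, hbk⟩ := Finset.mem_filter.1 hb
    rw [frontPotential, if_pos ((H.approaching_iff ha hak hb hbk).2 hc), abs_mul]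
  · rw [← ite_and, if_neg hc]
    refine Finset.sum_eq_zero fun a ha => Finset.sum_eq_zero fun b hb => ?_
    obtain ⟨ha, hak⟩ := Finset.mem_filter.1 ha
    obtain ⟨hb, hbk⟩ := Finset.mem_filter.1 hb
    rw [frontPotential, if_neg fun h => hc ((H.approaching_iff ha hak hb hbk).1 h)]

-- The right front of an approaching pair is always physical, because no family number exceeds that
-- of a non-physical front.
open Classical in
theorem Q_eq_sum_alive (S : HyperbolicSystem n) (w : FrontPattern n) (t : ℝ) :
    w.Q S t = ∑ a ∈ w.alive t, ∑ b ∈ w.alive t with (w.front b).kind ≠ .nonphysical,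
      frontPotential S w t a b := by
  rw [← Finset.sum_product', Q, Finset.sum_filter]
  symm
  refine Finset.sum_subset (Finset.subset_univ _) fun p _ hp => ?_
  refine if_neg fun h => hp ?_
  rw [Finset.mem_product, Finset.mem_filter]
  refine ⟨mem_alive.2 h.1, mem_alive.2 h.2.1, fun hnp => ?_⟩
  rcases h.2.2.2 with h1 | ⟨k, _, _, h1, _⟩
  · rw [Front.rank_nonphysical hnp] at h1
    rcases (w.front p.1).physical_or_nonphysical with h2 | ⟨k, h2⟩
    · rw [Front.rank_nonphysical h2] at h1; exact lt_irrefl _ h1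
    · rw [h2.rank] at h1; exact absurd k.2 (not_lt.2 h1.le)
  · exact h1.ne_nonphysical hnp

open Classical in
theorem sum_abs_size_lt' (H : w.RegularAt S ρ lamHat ε r K C₀ δ t) :
    ∑ a ∈ w.alive t with (w.front a).kind ≠ .nonphysical, |(w.front a).size| < δ :=
  sum_abs_size_lt H.sol H.const H.ρ_pos H.C₀_pos H.δ_lt H.ε_lt H.mem_Dstar H.nonneg

open Classical in
/-- The non-physical fronts contribute little to the interaction potential. -/
theorem abs_Q_sub_sum_physical_le (H : w.RegularAt S ρ lamHat ε r K C₀ δ t) :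
    |w.Q S t - ∑ a ∈ w.alive t with (w.front a).kind ≠ .nonphysical,
      ∑ b ∈ w.alive t with (w.front b).kind ≠ .nonphysical, frontPotential S w t a b| ≤ δ * ε := by
  have hnp := H.sol.nonphysical_small t H.nonneg
  have hδ := H.sum_abs_size_lt'
  have h0 : ∀ a b, 0 ≤ frontPotential S w t a b ∧
      frontPotential S w t a b ≤ |(w.front a).size| * |(w.front b).size| := fun a b => by
    unfold frontPotential
    split_ifs
    · exact ⟨abs_nonneg _, (abs_mul _ _).le⟩
    · exact ⟨le_rfl, by positivity⟩
  -- What remains are pairs of a non-physical front on the left and a physical one on the right: at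
  -- most ε times δ.
  rw [Q_eq_sum_alive, ← Finset.sum_filter_add_sum_filter_not (w.alive t)
    fun a => (w.front a).kind ≠ .nonphysical, add_sub_cancel_left, abs_of_nonneg
    (Finset.sum_nonneg fun a _ => Finset.sum_nonneg fun b _ => (h0 a b).1)]
  calc _ ≤ ∑ a ∈ w.alive t with ¬ (w.front a).kind ≠ .nonphysical,
        ∑ b ∈ w.alive t with (w.front b).kind ≠ .nonphysical,
          |(w.front a).size| * |(w.front b).size| :=
        Finset.sum_le_sum fun a _ => Finset.sum_le_sum fun b _ => (h0 a b).2
    _ = (∑ a ∈ w.alive t with ¬ (w.front a).kind ≠ .nonphysical, |(w.front a).size|) *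
        ∑ b ∈ w.alive t with (w.front b).kind ≠ .nonphysical, |(w.front b).size| :=
        (Finset.sum_mul_sum _ _ _ _).symm
    _ ≤ ε * δ := by
        refine mul_le_mul (le_trans (le_of_eq ?_) hnp) hδ.le
          (Finset.sum_nonneg fun _ _ => abs_nonneg _)
          ((Finset.sum_nonneg fun _ _ => norm_nonneg _).trans hnp)
        refine Finset.sum_congr ?_ fun a ha => ?_
        · ext a; simp [mem_alive]
        · rw [Front.size_of_nonphysical (Finset.mem_filter.1 ha).2.2, abs_of_nonneg (norm_nonneg _)]
    _ = δ * ε := mul_comm _ _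

/-- The two interaction potentials agree up to `O(ε)`. -/
theorem abs_Q_sub_le (H : w.RegularAt S ρ lamHat ε r K C₀ δ t) {X : Finset ℝ}
    (hJ : jumpSet (w.u t) ⊆ X) (hP : ∀ a ∈ w.alive t, (w.front a).pos t ∈ X) :
    |S.Q ρ (w.u t) - w.Q S t| ≤ (2 * n * K + 1) * δ * ε := by
  classical
  set σ : ℝ × Fin n → ℝ := fun p => S.strength ρ (w.u t) p.1 p.2 with hσ
  set τ : ℝ × Fin n → ℝ := fun p => waveSum w.front (w.frontsAt t p.1) p.2 with hτ
  set P := X ×ˢ (Finset.univ : Finset (Fin n)) with hPdef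
  have hv := H.mem_Dstar t H.nonneg
  have hV : ∑ p ∈ P, |σ p| ≤ δ := by
    rw [hPdef, Finset.sum_product,
      ← V_eq_sum_of_subset H.const H.ρ_pos H.C₀_pos H.δ_lt hv hJ]
    exact (V_lt H.C₀_pos hv).le
  have hτV : ∑ p ∈ P, |τ p| ≤ δ := by
    have h1 := sum_physical hP fun a => |(w.front a).size|
    have h2 : ∑ p ∈ P, |τ p| =
        ∑ a ∈ w.alive t with (w.front a).kind ≠ .nonphysical, |(w.front a).size| := by
      rw [h1]
      exact Finset.sum_congr rfl fun p _ => H.abs_waveSum p.1 p.2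
    exact h2.le.trans H.sum_abs_size_lt'.le
  have hd : ∑ p ∈ P, |σ p - τ p| ≤ n * (K * ε) := by
    rw [hPdef, Finset.sum_product_right]
    refine (Finset.sum_le_sum fun k _ => H.sum_abs_strength_sub_le X k).trans_eq ?_
    simp
  have hQ1 : |S.Q ρ (w.u t) - ∑ a ∈ w.alive t with (w.front a).kind ≠ .nonphysical,
      ∑ b ∈ w.alive t with (w.front b).kind ≠ .nonphysical, frontPotential S w t a b| ≤
      (∑ p ∈ P, |σ p - τ p|) * (∑ q ∈ P, |σ q|) + (∑ p ∈ P, |τ p|) * ∑ q ∈ P, |σ q - τ q| := by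
    rw [Q_eq_sum H.const H.ρ_pos H.C₀_pos H.δ_lt hv hJ, sum_physical hP, ← hPdef]
    have h1 : ∀ p ∈ P, ∑ a ∈ w.frontsAt t p.1 with (w.front a).IsPhysical p.2,
        ∑ b ∈ w.alive t with (w.front b).kind ≠ .nonphysical, frontPotential S w t a b =
        ∑ q ∈ P, if p.1 < q.1 then S.pairPotential p.2 q.2 (τ p) (τ q) else 0 := fun p _ => by
      rw [Finset.sum_congr rfl fun a _ => sum_physical hP _, Finset.sum_comm]
      exact Finset.sum_congr rfl fun q _ => H.sum_frontPotential_group p q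
    rw [Finset.sum_congr rfl h1, Finset.sum_mul_sum, Finset.sum_mul_sum, ← Finset.sum_add_distrib,
      ← Finset.sum_sub_distrib]
    refine (Finset.abs_sum_le_sum_abs _ _).trans (Finset.sum_le_sum fun p _ => ?_)
    rw [← Finset.sum_add_distrib, ← Finset.sum_sub_distrib]
    refine (Finset.abs_sum_le_sum_abs _ _).trans (Finset.sum_le_sum fun q _ => ?_)
    split_ifs
    · exact abs_pairPotential_sub_le _ _ _ _ _ _
    · rw [sub_zero, abs_zero]; positivity
  have hQ2 := H.abs_Q_sub_sum_physical_le
  rw [abs_sub_comm] at hQ2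
  have h0 : 0 ≤ ∑ p ∈ P, |σ p - τ p| := Finset.sum_nonneg fun _ _ => abs_nonneg _
  have h0' : 0 ≤ ∑ p ∈ P, |σ p| := Finset.sum_nonneg fun _ _ => abs_nonneg _
  have h3 := mul_le_mul hd hV h0' (h0.trans hd)
  have h4 := mul_le_mul hτV hd h0 (h0'.trans hV)
  -- Two bilinear terms, each at most n K ε · δ, and δ ε from the non-physical fronts.
  refine (abs_sub_le _ _ _).trans ((add_le_add hQ1 hQ2).trans ?_)
  linarith

end FrontPattern.RegularAt
end

/-! ### Comparison of the functionals -/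

noncomputable section

theorem aestronglyMeasurable_of_eventually_eq {f : ℝ → ℝ} (X : Finset ℝ)
    (h : ∀ x ∉ X, ∀ᶠ y in 𝓝 x, f y = f x) : AEStronglyMeasurable f := by
  have h1 : ContinuousOn f (X : Set ℝ)ᶜ := fun x hx =>
    ContinuousAt.continuousWithinAt (tendsto_const_nhds.congr'
      ((h x hx).mono fun _ h => h.symm))
  have h2 := h1.aestronglyMeasurable (μ := volume) X.finite_toSet.isClosed.measurableSet.compl
  rwa [Measure.restrict_eq_self_of_ae_mem] at h2
  exact compl_mem_ae_iff.2 (X.finite_toSet.measure_zero _)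

theorem Finset.eventually_lt_iff (X : Finset ℝ) {x : ℝ} (hx : x ∉ X) :
    ∀ᶠ y in 𝓝 x, y ∉ X ∧ ∀ z ∈ X, (z < y ↔ z < x) ∧ (y < z ↔ x < z) := by
  refine (X.finite_toSet.isClosed.isOpen_compl.eventually_mem hx).and ?_
  rw [Finset.eventually_all]
  intro z hz
  rcases lt_or_gt_of_ne (ne_of_mem_of_not_mem hz hx) with h | h
  · filter_upwards [eventually_gt_nhds h] with y hy
    exact ⟨⟨fun _ => h, fun _ => hy⟩, fun h' => absurd h' (not_lt.2 hy.le),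
      fun h' => absurd h' (not_lt.2 h.le)⟩
  · filter_upwards [eventually_lt_nhds h] with y hy
    exact ⟨⟨fun h' => absurd h' (not_lt.2 hy.le), fun h' => absurd h' (not_lt.2 h.le)⟩,
      fun _ => h, fun _ => hy⟩

namespace FrontPattern.RegularAt

open HyperbolicSystem

variable {n : ℕ} {S : HyperbolicSystem n} {ρ lamHat ε r K C₀ δ : ℝ} {w w' : FrontPattern n} {t : ℝ}

theorem norm_lt (H : w.RegularAt S ρ lamHat ε r K C₀ δ t) (x : ℝ) : ‖w.u t x‖ < r :=
  H.const.norm_le H.ρ_pos H.C₀_pos H.δ_lt (H.mem_Dstar t H.nonneg) x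

/-- All ingredients of the two integrands are locally constant off `X`; this yields their
measurability. -/
theorem eventually_eq (H : w.RegularAt S ρ lamHat ε r K C₀ δ t) {X : Finset ℝ}
    (hJ : jumpSet (w.u t) ⊆ X) (hP : ∀ a ∈ w.alive t, (w.front a).pos t ∈ X) {x : ℝ} (hx : x ∉ X) :
    ∀ᶠ y in 𝓝 x, w.u t y = w.u t x ∧ ∀ k, S.Aminus ρ (w.u t) k y = S.Aminus ρ (w.u t) k x ∧
      S.Aplus ρ (w.u t) k y = S.Aplus ρ (w.u t) k x ∧ w.leftWaves t k y = w.leftWaves t k x ∧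
      w.rightWaves t k y = w.rightWaves t k x := by
  classical
  filter_upwards [(H.mem_Dstar t H.nonneg).1.eventually_eq fun h => hx (hJ h),
    X.eventually_lt_iff hx] with y h1 h2
  obtain ⟨hy, h2⟩ := h2
  refine ⟨h1, fun k => ⟨?_, ?_, ?_, ?_⟩⟩
  · rw [H.Aminus_eq hJ hx, H.Aminus_eq hJ hy]
    exact Finset.sum_congr (Finset.filter_congr fun z hz => (h2 z hz).1) fun _ _ => rfl
  · rw [H.Aplus_eq hJ, H.Aplus_eq hJ]
    exact Finset.sum_congr (Finset.filter_congr fun z hz => (h2 z hz).2) fun _ _ => rfl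
  · unfold leftWaves
    refine Finset.sum_congr (Finset.filter_congr fun a _ => ?_) fun _ _ => rfl
    exact and_congr_right fun ha => and_congr_right fun _ => (h2 _ (hP a (mem_alive.2 ha))).1
  · unfold rightWaves
    refine Finset.sum_congr (Finset.filter_congr fun a _ => ?_) fun _ _ => rfl
    exact and_congr_right fun ha => and_congr_right fun _ => (h2 _ (hP a (mem_alive.2 ha))).2

theorem sum_abs_strength_le (H : w.RegularAt S ρ lamHat ε r K C₀ δ t) {X Y : Finset ℝ}
    (hJ : jumpSet (w.u t) ⊆ X) (hY : Y ⊆ X) (k : Fin n) :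
    ∑ y ∈ Y, |S.strength ρ (w.u t) y k| ≤ δ := by
  have hv := H.mem_Dstar t H.nonneg
  refine le_trans ?_ (V_lt H.C₀_pos hv).le
  rw [V_eq_sum_of_subset H.const H.ρ_pos H.C₀_pos H.δ_lt hv hJ]
  refine (Finset.sum_le_sum_of_subset_of_nonneg hY fun _ _ _ => abs_nonneg _).trans
    (Finset.sum_le_sum fun y _ => ?_)
  exact Finset.single_le_sum (f := fun i => |S.strength ρ (w.u t) y i|)
    (fun _ _ => abs_nonneg _) (Finset.mem_univ k)

theorem Aminus_mem (H : w.RegularAt S ρ lamHat ε r K C₀ δ t) {X : Finset ℝ}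
    (hJ : jumpSet (w.u t) ⊆ X) {x : ℝ} (hx : x ∉ X) (k : Fin n) :
    |S.Aminus ρ (w.u t) k x| ≤ δ := by
  classical
  rw [H.Aminus_eq hJ hx, abs_of_nonneg (Finset.sum_nonneg fun _ _ => abs_nonneg _)]
  exact H.sum_abs_strength_le hJ (Finset.filter_subset _ _) k

theorem Aplus_mem (H : w.RegularAt S ρ lamHat ε r K C₀ δ t) {X : Finset ℝ}
    (hJ : jumpSet (w.u t) ⊆ X) (x : ℝ) (k : Fin n) :
    |S.Aplus ρ (w.u t) k x| ≤ δ := by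
  classical
  rw [H.Aplus_eq hJ, abs_of_nonneg (Finset.sum_nonneg fun _ _ => abs_nonneg _)]
  exact H.sum_abs_strength_le hJ (Finset.filter_subset _ _) k

theorem abs_sum_filter_le {p : Fin n → Prop} [DecidablePred p] {g : Fin n → ℝ} {c : ℝ} (hc : 0 ≤ c)
    (hg : ∀ k, |g k| ≤ c) : |∑ k ∈ Finset.univ.filter p, g k| ≤ n * c := by
  refine (Finset.abs_sum_le_sum_abs _ _).trans ((Finset.sum_le_sum fun k _ => hg k).trans ?_)
  rw [Finset.sum_const, nsmul_eq_mul]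
  refine mul_le_mul_of_nonneg_right ?_ hc
  exact_mod_cast (Finset.card_le_univ _).trans_eq (Fintype.card_fin n)

theorem abs_A_le (H : w.RegularAt S ρ lamHat ε r K C₀ δ t) {X : Finset ℝ}
    (hJ : jumpSet (w.u t) ⊆ X) {x : ℝ} (hx : x ∉ X) (i : Fin n) (q : ℝ) :
    |S.A ρ (w.u t) i q x| ≤ (2 * n + 1) * δ := by
  classical
  have hδ : 0 ≤ δ := (abs_nonneg _).trans (H.Aplus_mem hJ x i)
  unfold HyperbolicSystem.A
  have h1 := abs_sum_filter_le (p := (· < i)) hδ (H.Aplus_mem hJ x)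
  have h2 := abs_sum_filter_le (p := (i < ·)) hδ (H.Aminus_mem hJ hx)
  have h3 : |if S.GNL i then (if 0 ≤ q then S.Aplus ρ (w.u t) i x else S.Aminus ρ (w.u t) i x)
      else 0| ≤ δ := by
    split_ifs
    · exact H.Aplus_mem hJ x i
    · exact H.Aminus_mem hJ hx i
    · simpa using hδ
  refine (abs_add_three _ _ _).trans ?_
  linarith

/-- The two approaching strengths agree up to `O(ε)`. -/
theorem abs_A_sub_le (H : w.RegularAt S ρ lamHat ε r K C₀ δ t)
    (H' : w'.RegularAt S ρ lamHat ε r K C₀ δ t) {X : Finset ℝ}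
    (hJ : jumpSet (w.u t) ⊆ X) (hJ' : jumpSet (w'.u t) ⊆ X)
    (hP : ∀ a ∈ w.alive t, (w.front a).pos t ∈ X) (hP' : ∀ a ∈ w'.alive t, (w'.front a).pos t ∈ X)
    {x : ℝ} (hx : x ∉ X) (i : Fin n) {q : ℝ} (hq : q ≠ 0) :
    |S.A ρ (w.u t) i q x + S.A ρ (w'.u t) i (-q) x - FrontPattern.A S w w' t i q x| ≤
      (4 * n + 2) * (K * ε) := by
  classical
  have hm := H.abs_Aminus_sub_le hJ hP hx
  have hm' := H'.abs_Aminus_sub_le hJ' hP' hx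
  have hp := H.abs_Aplus_sub_le hJ hP x
  have hp' := H'.abs_Aplus_sub_le hJ' hP' x
  have hη : 0 ≤ K * ε := (abs_nonneg _).trans (hp i)
  have h1 := abs_sum_filter_le (p := (· < i)) (by positivity)
    fun k => (abs_add_le _ _).trans (add_le_add (hp k) (hp' k))
  have h2 := abs_sum_filter_le (p := (i < ·)) (by positivity)
    fun k => (abs_add_le _ _).trans (add_le_add (hm k) (hm' k))
  have h3 : |(if S.GNL i then (if 0 ≤ q then S.Aplus ρ (w.u t) i x else S.Aminus ρ (w.u t) i x)
        else 0) + (if S.GNL i then (if 0 ≤ -q then S.Aplus ρ (w'.u t) i x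
          else S.Aminus ρ (w'.u t) i x) else 0) -
      (if S.GNL i then (if q < 0 then w.leftWaves t i x + w'.rightWaves t i x
        else if 0 < q then w'.leftWaves t i x + w.rightWaves t i x else 0) else 0)| ≤
      K * ε + K * ε := by
    by_cases hg : S.GNL i
    · simp only [if_pos hg]
      rcases lt_or_gt_of_ne hq with h | h
      · rw [if_neg (not_le.2 h), if_pos (by linarith), if_pos h, add_sub_add_comm]
        exact (abs_add_le _ _).trans (add_le_add (hm i) (hp' i))
      · rw [if_pos h.le, if_neg (by linarith), if_neg (not_lt.2 h.le), if_pos h,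
          add_comm (w'.leftWaves t i x), add_sub_add_comm]
        exact (abs_add_le _ _).trans (add_le_add (hp i) (hm' i))
    · simp only [if_neg hg]
      rw [add_zero, sub_zero, abs_zero]
      positivity
  unfold HyperbolicSystem.A FrontPattern.A
  simp only [Finset.sum_add_distrib, Finset.sum_sub_distrib] at h1 h2 ⊢
  have h4 := (abs_add_three _ _ _).trans (add_le_add_three h1 h2 h3)
  refine le_trans (le_of_eq ?_) (h4.trans (le_of_eq (by ring)))
  congr 1
  ring

theorem norm_shockSizes_le (H : w.RegularAt S ρ lamHat ε r K C₀ δ t)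
    (H' : w'.RegularAt S ρ lamHat ε r K C₀ δ t) (x : ℝ) :
    ‖S.shockSizes ρ (w.u t x) (w'.u t x)‖ ≤ K * ‖w.u t x - w'.u t x‖ := by
  have h := H.const.shock_surj _ _ (H.norm_lt x) (H'.norm_lt x)
  have h1 : S.shockSizes ρ (w.u t x) (w'.u t x) ∈ sizeBox n ρ := Function.invFunOn_mem h
  have h2 : S.shockMap ρ (w.u t x) (S.shockSizes ρ (w.u t x) (w'.u t x)) = w'.u t x :=
    Function.invFunOn_eq h
  have h3 := H.const.shock_lower _ (H.norm_lt x) _ h1 0 (zero_mem_sizeBox H.ρ_pos)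
  rwa [h2, shockMap_zero, sub_zero, norm_sub_rev] at h3

/-- The weight in the functional `Φ^ε`. -/
def weightEps (S : HyperbolicSystem n) (κ₁ κ₂ : ℝ) (w w' : FrontPattern n) (t : ℝ) (i : Fin n)
    (q x : ℝ) : ℝ :=
  1 + κ₁ * FrontPattern.A S w w' t i q x + κ₁ * κ₂ * (w.Q S t + w'.Q S t)

/-- The integrands share the factor |q_i| ≤ K ‖w - w'‖ and their weights differ by at most `c` off a
finite set, so the estimate is integrated for each family; the factor `n` counts the families. -/
theorem abs_Phi_sub_PhiEps_le (H : w.RegularAt S ρ lamHat ε r K C₀ δ t)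
    (H' : w'.RegularAt S ρ lamHat ε r K C₀ δ t) {κ₁ κ₂ : ℝ} (hκ₁ : 0 < κ₁) (hκ₂ : 0 < κ₂)
    (hδ : δ ≤ 1) (hε : 0 < ε) :
    |S.Phi ρ κ₁ κ₂ (w.u t) (w'.u t) - w.PhiEps S ρ κ₁ κ₂ w' t| ≤
      n * (K * (κ₁ * ((4 * n + 2) * K) + κ₁ * κ₂ * (2 * (2 * n * K + 1)))) * ε *
        ∫ x, ‖w.u t x - w'.u t x‖ := by
  classical
  have hv := H.mem_Dstar t H.nonneg
  have hv' := H'.mem_Dstar t H.nonneg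
  obtain ⟨X, hJ, hJ', hP, hP'⟩ : ∃ X : Finset ℝ, jumpSet (w.u t) ⊆ X ∧ jumpSet (w'.u t) ⊆ X ∧
      (∀ a ∈ w.alive t, (w.front a).pos t ∈ X) ∧ ∀ a ∈ w'.alive t, (w'.front a).pos t ∈ X := by
    refine ⟨(hv.1.finite_jumpSet.toFinset ∪ hv'.1.finite_jumpSet.toFinset) ∪
      ((w.alive t).image (fun a => (w.front a).pos t) ∪
        (w'.alive t).image fun a => (w'.front a).pos t), fun x hx => ?_, fun x hx => ?_,
      fun a ha => ?_, fun a ha => ?_⟩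
    · simp [hx]
    · simp [hx]
    · exact Finset.mem_union_right _ (Finset.mem_union_left _ (Finset.mem_image_of_mem _ ha))
    · exact Finset.mem_union_right _ (Finset.mem_union_right _ (Finset.mem_image_of_mem _ ha))
  have hK := H.const.K_pos
  have haeX : ∀ᵐ x : ℝ, x ∉ X := compl_mem_ae_iff.2 (X.finite_toSet.measure_zero _)
  set q : Fin n → ℝ → ℝ := fun i x => S.shockSizes ρ (w.u t x) (w'.u t x) i with hq
  have hqle : ∀ i x, |q i x| ≤ K * ‖w.u t x - w'.u t x‖ := fun i x =>
    (norm_le_pi_norm _ i).trans (norm_shockSizes_le H H' x)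
  set c : ℝ := (κ₁ * ((4 * n + 2) * K) + κ₁ * κ₂ * (2 * (2 * n * K + 1))) * ε with hc
  have hc0 : 0 ≤ c := by positivity
  -- A crude bound on the weight, used for integrability and absent from the final estimate.
  set M : ℝ := 1 + κ₁ * ((2 * n + 1) * δ) + κ₁ * ((2 * n + 1) * δ) +
    |κ₁ * κ₂ * (S.Q ρ (w.u t) + S.Q ρ (w'.u t))| with hM
  have hint : Integrable fun x => ‖w.u t x - w'.u t x‖ := (hv.2.1.sub hv'.2.1).norm
  have hdiff : ∀ i, ∀ x ∉ X, |(|q i x| * S.W ρ κ₁ κ₂ (w.u t) (w'.u t) i (q i x) x -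
      |q i x| * weightEps S κ₁ κ₂ w w' t i (q i x) x)| ≤ K * c * ‖w.u t x - w'.u t x‖ := by
    intro i x hx
    -- At q = 0 the two weights follow different conventions, but the factor |q| vanishes.
    by_cases hq0 : q i x = 0
    · rw [hq0]; simp only [abs_zero, zero_mul, sub_zero]; positivity
    have h1 := abs_A_sub_le H H' hJ hJ' hP hP' hx i hq0
    have h2 := H.abs_Q_sub_le hJ hP
    have h3 := H'.abs_Q_sub_le hJ' hP'
    have h4 : (2 * n * K + 1) * δ * ε ≤ (2 * n * K + 1) * ε := by
      refine mul_le_mul_of_nonneg_right ?_ hε.le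
      exact mul_le_of_le_one_right (by positivity) hδ
    have h5 : |S.W ρ κ₁ κ₂ (w.u t) (w'.u t) i (q i x) x -
        weightEps S κ₁ κ₂ w w' t i (q i x) x| ≤ c := by
      have h6 : S.W ρ κ₁ κ₂ (w.u t) (w'.u t) i (q i x) x - weightEps S κ₁ κ₂ w w' t i (q i x) x =
          κ₁ * (S.A ρ (w.u t) i (q i x) x + S.A ρ (w'.u t) i (-(q i x)) x -
            FrontPattern.A S w w' t i (q i x) x) +
          κ₁ * κ₂ * ((S.Q ρ (w.u t) - w.Q S t) + (S.Q ρ (w'.u t) - w'.Q S t)) := by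
        unfold W weightEps; ring
      rw [h6]
      refine (abs_add_le _ _).trans ?_
      rw [abs_mul, abs_mul, abs_of_pos hκ₁, abs_of_pos (mul_pos hκ₁ hκ₂)]
      have h7 := mul_le_mul_of_nonneg_left h1 hκ₁.le
      have h8 := mul_le_mul_of_nonneg_left ((abs_add_le _ _).trans
        (add_le_add (h2.trans h4) (h3.trans h4))) (mul_pos hκ₁ hκ₂).le
      refine (add_le_add h7 h8).trans (le_of_eq ?_)
      rw [hc]; ring
    rw [← mul_sub, abs_mul, abs_abs]
    calc _ ≤ (K * ‖w.u t x - w'.u t x‖) * c :=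
          mul_le_mul (hqle i x) h5 (abs_nonneg _) (by positivity)
      _ = _ := by ring
  have hW : ∀ i, ∀ x ∉ X, |(|q i x| * S.W ρ κ₁ κ₂ (w.u t) (w'.u t) i (q i x) x)| ≤
      K * M * ‖w.u t x - w'.u t x‖ := by
    intro i x hx
    have h1 := H.abs_A_le hJ hx i (q i x)
    have h2 := H'.abs_A_le hJ' hx i (-(q i x))
    have h3 : |S.W ρ κ₁ κ₂ (w.u t) (w'.u t) i (q i x) x| ≤ M := by
      unfold W
      refine (abs_add_le _ _).trans (add_le_add ((abs_add_three _ _ _).trans ?_) le_rfl)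
      rw [abs_one, abs_mul, abs_mul, abs_of_pos hκ₁]
      gcongr
    rw [abs_mul, abs_abs]
    calc _ ≤ (K * ‖w.u t x - w'.u t x‖) * M :=
          mul_le_mul (hqle i x) h3 (abs_nonneg _) (by positivity)
      _ = _ := by ring
  have hlc : ∀ x ∉ X, ∀ᶠ y in 𝓝 x, ∀ i,
      |q i y| * S.W ρ κ₁ κ₂ (w.u t) (w'.u t) i (q i y) y =
        |q i x| * S.W ρ κ₁ κ₂ (w.u t) (w'.u t) i (q i x) x ∧
      |q i y| * weightEps S κ₁ κ₂ w w' t i (q i y) y =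
        |q i x| * weightEps S κ₁ κ₂ w w' t i (q i x) x := by
    intro x hx
    filter_upwards [H.eventually_eq hJ hP hx, H'.eventually_eq hJ' hP' hx] with y h1 h2 i
    have h3 : q i y = q i x := by simp only [hq]; rw [h1.1, h2.1]
    rw [h3]
    unfold W weightEps HyperbolicSystem.A FrontPattern.A
    simp only [h1.2, h2.2, and_self]
  have hf : ∀ i, Integrable fun x => |q i x| * S.W ρ κ₁ κ₂ (w.u t) (w'.u t) i (q i x) x :=
    fun i => (hint.const_mul (K * M)).mono'
      (aestronglyMeasurable_of_eventually_eq X fun x hx => (hlc x hx).mono fun _ h => (h i).1)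
      (haeX.mono fun x hx => hW i x hx)
  have hg : ∀ i, Integrable fun x => |q i x| * weightEps S κ₁ κ₂ w w' t i (q i x) x := by
    intro i
    refine ((hint.const_mul (K * M)).add (hint.const_mul (K * c))).mono'
      (aestronglyMeasurable_of_eventually_eq X fun x hx => (hlc x hx).mono fun _ h => (h i).2)
      (haeX.mono fun x hx => ?_)
    have h1 := hW i x hx
    have h2 := hdiff i x hx
    rw [Real.norm_eq_abs]
    rw [abs_sub_comm] at h2
    have h3 := abs_add_le (|q i x| * weightEps S κ₁ κ₂ w w' t i (q i x) x -
      |q i x| * S.W ρ κ₁ κ₂ (w.u t) (w'.u t) i (q i x) x)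
      (|q i x| * S.W ρ κ₁ κ₂ (w.u t) (w'.u t) i (q i x) x)
    rw [sub_add_cancel] at h3
    simp only [Pi.add_apply]
    linarith
  have hterm : ∀ i, |(∫ x, |q i x| * S.W ρ κ₁ κ₂ (w.u t) (w'.u t) i (q i x) x) -
      ∫ x, |q i x| * weightEps S κ₁ κ₂ w w' t i (q i x) x| ≤
      K * c * ∫ x, ‖w.u t x - w'.u t x‖ := by
    intro i
    rw [← integral_sub (hf i) (hg i), ← integral_const_mul, ← Real.norm_eq_abs]
    exact norm_integral_le_of_norm_le (hint.const_mul (K * c)) (haeX.mono fun x hx => hdiff i x hx)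
  have hmain : S.Phi ρ κ₁ κ₂ (w.u t) (w'.u t) - w.PhiEps S ρ κ₁ κ₂ w' t =
      ∑ i, ((∫ x, |q i x| * S.W ρ κ₁ κ₂ (w.u t) (w'.u t) i (q i x) x) -
        ∫ x, |q i x| * weightEps S κ₁ κ₂ w w' t i (q i x) x) := by
    rw [Finset.sum_sub_distrib]; rfl
  rw [hmain]
  refine (Finset.abs_sum_le_sum_abs _ _).trans ((Finset.sum_le_sum fun i _ => hterm i).trans ?_)
  rw [Finset.sum_const, Finset.card_univ, Fintype.card_fin, nsmul_eq_mul]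
  refine le_of_eq ?_
  rw [hc]; ring

end FrontPattern.RegularAt

end

theorem mainTheorem7 {n : ℕ} (S : HyperbolicSystem n)
    (C₀ κ₁ κ₂ lamHat : ℝ) (hC₀ : 0 < C₀) (hκ₁ : 0 < κ₁) (hκ₂ : 0 < κ₂)
    (hlamHat : ∀ᶠ u in 𝓝 (0 : State n), ∀ j, S.lam j u < lamHat) :
    ∃ ρ₀ > 0, ∀ ρ, 0 < ρ → ρ < ρ₀ →
    ∃ δ₀ > 0, ∃ C > 0, ∀ δ, 0 < δ → δ < δ₀ →
    ∃ ε₀ > 0, ∀ ε, 0 < ε → ε < ε₀ →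
    ∀ w w' : FrontPattern n,
      w.IsApproxSolution S ρ lamHat ε → w'.IsApproxSolution S ρ lamHat ε →
      (∀ t, 0 ≤ t → w.u t ∈ S.Dstar ρ C₀ δ ∧ w'.u t ∈ S.Dstar ρ C₀ δ) →
      ∀ t, 0 ≤ t → w.FanOrdered t → w'.FanOrdered t →
        |S.Phi ρ κ₁ κ₂ (w.u t) (w'.u t) - w.PhiEps S ρ κ₁ κ₂ w' t| ≤
          C * ε * ∫ x, ‖w.u t x - w'.u t x‖ := by
  obtain ⟨ρ₀, hρ₀, hR⟩ := S.exists_riemannConstants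
  refine ⟨ρ₀, hρ₀, fun ρ hρ hρ' => ?_⟩
  obtain ⟨r, K, R⟩ := hR ρ hρ hρ'
  have hK := R.K_pos
  -- The bound δ < 1 absorbs the factor δ of the potential estimate, δ < ρ keeps the summed sizes
  -- admissible, and K δ < r keeps all states in the ball of the Riemann estimates. The summand 1 in
  -- the constant makes it positive even for n = 0.
  refine ⟨min (min 1 ρ) (r / K), lt_min (lt_min one_pos hρ) (div_pos R.r_pos hK),
    n * (K * (κ₁ * ((4 * n + 2) * K) + κ₁ * κ₂ * (2 * (2 * n * K + 1)))) + 1, by positivity,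
    fun δ _ hδ => ?_⟩
  obtain ⟨hδ1, hδr⟩ := lt_min_iff.1 hδ
  obtain ⟨hδ1, hδρ⟩ := lt_min_iff.1 hδ1
  -- With ε < ρ, rarefaction fronts have admissible sizes.
  refine ⟨ρ, hρ, fun ε hε hερ w w' hw hw' hD t ht hf hf' => ?_⟩
  have hδK : K * δ < r := by rwa [lt_div_iff₀ hK, mul_comm] at hδr
  have H : w.RegularAt S ρ lamHat ε r K C₀ δ t :=
    ⟨hw, R, hρ, hC₀, hδK, hδρ.le, hερ, fun t ht => (hD t ht).1, ht, hf⟩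
  have H' : w'.RegularAt S ρ lamHat ε r K C₀ δ t :=
    ⟨hw', R, hρ, hC₀, hδK, hδρ.le, hερ, fun t ht => (hD t ht).2, ht, hf'⟩
  refine (H.abs_Phi_sub_PhiEps_le H' hκ₁ hκ₂ hδ1.le hε).trans ?_
  refine mul_le_mul_of_nonneg_right (mul_le_mul_of_nonneg_right (by linarith) hε.le) ?_
  exact integral_nonneg fun _ => norm_nonneg _
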